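/- **Proposition 3.2.** Let $\alpha\in(-1,1)\setminus\{0\}$ and $\delta\ge 0$. Let $a:(0,\infty)\to\mathbb C$ be smooth with $|a^{(N)}(r)|\le C_N r^{-N}$ for all $r>0$, $N\ge 0$. Let $\beta\in C_c^\infty([\tfrac38,\tfrac43])$ be real-valued and generate a dyadic partition of unity, $\sum_{k\in\mathbb Z}\beta(2^{-k}r)=1$ for $r>0$, and put $\beta_0(r)=1-\sum_{k\ge1}\beta(2^{-k}r)$. For $r_1,r_2> 0$ and $s\ge 0$ let $|\mathbf n_s|=\sqrt{r_1^2+r_2^2+2r_1r_2\cosh s}$, and for $\ell=1,2,3$ let $$K_D^\ell(r_1,r_2;\theta)=\int_0^\infty e^{i|\mathbf n_s|}(1+|\mathbf n_s|)^{-\frac32-\delta}\,a(|\mathbf n_s|)\,w_\ell(s,\theta)\,ds,$$ $$w_1=e^{-|\alpha|s},\qquad w_2=\frac{(e^{-s}-\cos(\theta+\pi))\sinh(\alpha s)}{\cosh s-\cos(\theta+\pi)},\qquad w_3=\frac{\sin(\theta+\pi)\cosh(\alpha s)}{\cosh s-\cos(\theta+\pi)}.$$ Let $K_D^{\ell,0}=\beta_0(r_1+r_2)K_D^\ell$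 and $K_D^{\ell,j}=\beta(2^{-j}(r_1+r_2))K_D^\ell$ for $j\ge1$, and let $T_D^{\ell,j}$ be the operator on functions on $\mathbb R^2$, written in polar coordinates, $$T_D^{\ell,j}f(r_1,\theta_1)=\int_0^\infty\int_0^{2\pi}K_D^{\ell,j}(r_1,r_2;\theta_1-\theta_2)f(r_2,\theta_2)\,d\theta_2\,r_2\,dr_2 .$$ Write $\delta_c(p,2)=\max\{0,\,2|\tfrac12-\tfrac1p|-\tfrac12\}$. Then the integrals defining $K_D^\ell$ converge absolutely for all $r_1,r_2>0$ and all $\theta$; for $p=2$ and for $4\le p\le\infty$ the operators $T_D^{\ell,j}$ are well defined on $L^p(\mathbb R^2)$, the integral defining $T_D^{\ell,j}f$ converging absolutely almost everywhere for $f\in L^p(\mathbb R^2)$; and for all $\ell\in\{1,2,3\}$ and all integers $j\ge0$ the following bounds hold, with constants $C$ independent of $j$: * $\|T_D^{\ell,j}\|_{L^2\to L^2}\le C\,2^{-j\delta}$, with $C$ depending only on $\alpha,\delta,a,\beta$; * for every $6\le p\le\infty$, $\|T_D^{\ell,j}\|_{L^p\to L^p}\le C\,2^{j[\delta_c(p,2)-\delta]}$,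 with $C$ depending only on $\alpha,\delta,a,\beta,p$; * for every $4\le p<6$ and every $\varepsilon'>0$, $\|T_D^{\ell,j}\|_{L^p\to L^p}\le C\,2^{j[\delta_c(p,2)-\delta]}\,2^{j\varepsilon'}$, with $C$ depending only on $\alpha,\delta,a,\beta,p,\varepsilon'$. -/

import Mathlib

open MeasureTheory Set
open scoped ENNReal ContDiff

noncomputable section

namespace DiffractiveBR

/-- The Euclidean plane. -/
abbrev Plane : Type := EuclideanSpace ℝ (Fin 2)

/-- The polar angle in `[0, 2π)` of a point of the plane. -/
def polarAngle (x : Plane) : ℝ :=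
  toIcoMod Real.two_pi_pos 0 (Complex.arg ⟨x 0, x 1⟩)

/-- The critical Bochner-Riesz index `δ_c(p, n) = max {0, n |1/2 - 1/p| - 1/2}`, `1 ≤ p ≤ ∞`,
with `1/∞ = 0`. -/
def criticalIndex (p : ℝ≥0∞) (n : ℕ) : ℝ :=
  max 0 ((n : ℝ) * |1 / 2 - (p⁻¹).toReal| - 1 / 2)

/-- Amplitudes: smooth `a : (0, ∞) → ℂ` with `|a^(N)(r)| ≤ C_N r^(-N)` for every `N ≥ 0`.
(Values of `a` outside `(0, ∞)` are irrelevant.) -/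
structure IsAmplitude (a : ℝ → ℂ) : Prop where
  smooth : ContDiffOn ℝ ∞ a (Ioi 0)
  bound : ∀ N : ℕ, ∃ C : ℝ, ∀ r : ℝ, 0 < r → ‖iteratedDeriv N a r‖ ≤ C * (r ^ N)⁻¹

/-- A function `β ∈ C_c^∞([3/8, 4/3])` generating a dyadic partition of unity on `(0, ∞)`. -/
structure IsDyadicPartition (β : ℝ → ℝ) : Prop where
  smooth : ContDiff ℝ ∞ β
  support : tsupport β ⊆ Icc (3 / 8) (4 / 3)
  sum_eq_one : ∀ r : ℝ, 0 < r → ∑' k : ℤ, β ((2 : ℝ) ^ (-k) * r) = 1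

/-- The dyadic cutoffs: `β_0(r) = 1 - ∑_{k ≥ 1} β(2^(-k) r)`, and `β(2^(-j) r)` for `j ≥ 1`. -/
def dyadicCutoff (β : ℝ → ℝ) : ℕ → ℝ → ℝ
  | 0, r => 1 - ∑' k : ℕ, β ((2 : ℝ) ^ (-((k : ℤ) + 1)) * r)
  | j + 1, r => β ((2 : ℝ) ^ (-((j : ℤ) + 1)) * r)

/-- `|n_s| = √(r₁² + r₂² + 2 r₁ r₂ cosh s)`, the length of
`n_s = (r₁ + r₂, √(2 r₁ r₂ (cosh s - 1)))`. -/
def diffDist (r₁ r₂ s : ℝ) : ℝ :=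
  Real.sqrt (r₁ ^ 2 + r₂ ^ 2 + 2 * r₁ * r₂ * Real.cosh s)

/-- The three weights (`ℓ = 1, 2, 3`) in the diffractive kernel, with `θ = θ₁ - θ₂`. -/
def diffWeight (α θ s : ℝ) : ℕ → ℝ
  | 1 => Real.exp (-|α| * s)
  | 2 => (Real.exp (-s) - Real.cos (θ + Real.pi)) * Real.sinh (α * s)
          / (Real.cosh s - Real.cos (θ + Real.pi))
  | 3 => Real.sin (θ + Real.pi) * Real.cosh (α * s)
          / (Real.cosh s - Real.cos (θ + Real.pi))
  | _ => 0

/-- The integrand of `K_D^ℓ(r₁, r₂; θ)`: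
`e^(i|n_s|) (1 + |n_s|)^(-3/2-δ) a(|n_s|)` times the `ℓ`-th weight. -/
def diffIntegrand (α δ : ℝ) (a : ℝ → ℂ) (ℓ : ℕ) (r₁ r₂ θ s : ℝ) : ℂ :=
  Complex.exp (Complex.I * (diffDist r₁ r₂ s : ℂ))
    * (((1 + diffDist r₁ r₂ s) ^ (-(3 / 2) - δ) : ℝ) : ℂ)
    * a (diffDist r₁ r₂ s)
    * (diffWeight α θ s ℓ : ℂ)

/-- The kernel `K_D^ℓ(r₁, r₂; θ)`. -/
def diffKernel (α δ : ℝ) (a : ℝ → ℂ) (ℓ : ℕ) (r₁ r₂ θ : ℝ) : ℂ :=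
  ∫ s in Ioi (0 : ℝ), diffIntegrand α δ a ℓ r₁ r₂ θ s

/-- The localized kernel `K_D^{ℓ,j}(r₁, r₂; θ)`. -/
def diffKernelPiece (α δ : ℝ) (a : ℝ → ℂ) (β : ℝ → ℝ) (ℓ j : ℕ) (r₁ r₂ θ : ℝ) : ℂ :=
  (dyadicCutoff β j (r₁ + r₂) : ℂ) * diffKernel α δ a ℓ r₁ r₂ θ

/-- A kernel `K(r₁, r₂; θ₁ - θ₂)` given in polar coordinates, as a function on
`ℝ² × ℝ²`, where `x = r₁ (cos θ₁, sin θ₁)` and `y = r₂ (cos θ₂, sin θ₂)`. -/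
def planeKernel (K : ℝ → ℝ → ℝ → ℂ) (x y : Plane) : ℂ :=
  K ‖x‖ ‖y‖ (polarAngle x - polarAngle y)

/-- The integral operator `T_k f(x) = ∫_{ℝ²} k(x, y) f(y) dy`; in polar coordinates
`dy = dθ₂ r₂ dr₂`. -/
def integralOperator (k : Plane → Plane → ℂ) (f : Plane → ℂ) (x : Plane) : ℂ :=
  ∫ y : Plane, k x y * f y

/-- `T_k` is a well-defined bounded operator on `L^p(ℝ²)` with operator norm at most `M`:
for each `f ∈ L^p` the integral defining `T_k f(x)` converges absolutely for almost every `x`,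
`T_k f ∈ L^p`, and `‖T_k f‖_p ≤ M ‖f‖_p`. -/
def LpNormBound (k : Plane → Plane → ℂ) (p : ℝ≥0∞) (M : ℝ) : Prop :=
  ∀ f : Plane → ℂ, MemLp f p volume →
    (∀ᵐ x : Plane, Integrable (fun y : Plane => k x y * f y) volume) ∧
    MemLp (integralOperator k f) p volume ∧
    eLpNorm (integralOperator k f) p volume ≤ ENNReal.ofReal M * eLpNorm f p volume

end DiffractiveBR

end

/-!
For fixed radii the phase `|n_s|` has a nondecreasing `s`-derivative, at least a multiple of
`min(r₁, r₂) s` for `s ≤ 1`. By van der Corput's lemma, the kernel built on a nonincreasing weight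
of height `H` and integral `I` is therefore at most `(1 + r₁ + r₂)^(-3/2-δ)` times a multiple of
both `I` and `(H + I) (1 + min(r₁, r₂))^(-1/2)`.

The three weights are combinations of nonincreasing weights of integral bounded uniformly in `θ`,
but near `θ = π` the height of the third is of order `|cos (θ/2)|⁻¹`: pointwise, only
`|cos (θ/2)| K` gains decay. The third weight is however `cosh (α s)` times a conjugate Poisson
kernel in `θ`, with Fourier coefficients of modulus `2π e^(-|n| s)`, so that all the angular Fourier
coefficients of `K` do decay like `(1 + min(r₁, r₂))^(-1/2)`.

On radii at most a multiple of `L = 2^j`, this gives the `L²` bound by Parseval in the angle and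
Schur's test in the radius, and the `L^∞` bound by size times area. For `p < ∞`, interpolating the
two pointwise bounds replaces the decay by `|cos (θ/2)|^(-2σ) ((1 + r₁)^(-σ) + (1 + r₂)^(-σ))` with
`σ < 1/2`, whose angular factor is integrable, and Hölder's inequality applies in the radius. The
norm of `(1 + r)^(-σ)` in `L^p(r dr)` is finite for some `σ < 1/2` exactly when `p > 4`; otherwise
it is truncated at radius `2L`, which costs a power `L^ε`.
-/

noncomputable section

namespace DiffractiveBR

/-! ### Oscillatory integrals with monotone weights -/

section SecondMeanValue

variable {E : Type*} [NormedAddCommGroup E] [NormedSpace ℝ E] [CompleteSpace E]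

lemma exists_ae_eq_Ioc_of_antitoneOn {h : ℝ → ℝ} {a b : ℝ} (hab : a ≤ b)
    (hh : AntitoneOn h (Ioc a b)) (u : ℝ) :
    ∃ t ∈ Icc a b, {s ∈ Ioc a b | u < h s} =ᵐ[volume] Ioc a t := by
  set S : Set ℝ := {s ∈ Ioc a b | u < h s}
  have hub : b ∈ upperBounds (insert a S) := by
    rintro x (rfl | hx)
    exacts [hab, hx.1.2]
  have hbdd : BddAbove (insert a S) := ⟨b, hub⟩
  have hne : (insert a S).Nonempty := insert_nonempty a S
  refine ⟨sSup (insert a S), ⟨le_csSup hbdd (mem_insert _ _), csSup_le hne hub⟩, ?_⟩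
  have hsub : S ⊆ Ioc a (sSup (insert a S)) := fun s hs =>
    ⟨hs.1.1, le_csSup hbdd (mem_insert_of_mem _ hs)⟩
  have hsup : Ioo a (sSup (insert a S)) ⊆ S := by
    intro s hs
    obtain ⟨x, rfl | hx, hsx⟩ := exists_lt_of_lt_csSup hne hs.2
    · exact absurd hs.1 hsx.not_gt
    · have hsI : s ∈ Ioc a b := ⟨hs.1, hsx.le.trans hx.1.2⟩
      exact ⟨hsI, hx.2.trans_le (hh hsI hx.1 hsx.le)⟩
  exact hsub.eventuallyLE.antisymm (Ioo_ae_eq_Ioc.symm.le.trans hsup.eventuallyLE)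

lemma setIntegral_Ioc_indicator_Iio {y H : ℝ} (hy : y ∈ Icc 0 H) (z : E) :
    ∫ u in Ioc 0 H, (Iio y).indicator (fun _ => z) u = y • z := by
  have hset : Ioc 0 H ∩ Iio y = Ioo 0 y := by
    ext u
    simp only [mem_inter_iff, mem_Ioc, mem_Iio, mem_Ioo]
    exact ⟨fun h => ⟨h.1.1, h.2⟩, fun h => ⟨⟨h.1, h.2.le.trans hy.2⟩, h.2⟩⟩
  rw [setIntegral_indicator measurableSet_Iio, hset, setIntegral_const,
    Real.volume_real_Ioo_of_le hy.1, sub_zero]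

/- Bonnet's second mean value theorem, as an inequality. By the layer cake formula for `h` the
integral is an average over `u ∈ [0, H]` of the integrals of `e` over the superlevel sets
`{u < h}`, and these sets are initial segments of `(a, b]`. -/
theorem norm_intervalIntegral_smul_le_of_antitoneOn {e : ℝ → E} {h : ℝ → ℝ} {a b M H : ℝ}
    (hab : a ≤ b) (he : IntervalIntegrable e volume a b)
    (hM : ∀ t ∈ Icc a b, ‖∫ s in a..t, e s‖ ≤ M) (hh : AntitoneOn h (Ioc a b)) (hH0 : 0 ≤ H)
    (hH : MapsTo h (Ioc a b) (Icc 0 H)) :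
    ‖∫ s in a..b, h s • e s‖ ≤ M * H := by
  have hlayer : ∀ s ∈ Ioc a b,
      h s • e s = ∫ u in Ioc 0 H, (Iio (h s)).indicator (fun _ => e s) u :=
    fun s hs => (setIntegral_Ioc_indicator_Iio (hH hs) _).symm
  have hint : Integrable (indicator {q : ℝ × ℝ | q.2 < h q.1} (fun q => e q.1))
      ((volume.restrict (Ioc a b)).prod (volume.restrict (Ioc 0 H))) :=
    Integrable.indicator₀ (Integrable.comp_fst he.1 _)
      (nullMeasurableSet_lt measurable_snd.aemeasurable
        (aemeasurable_restrict_of_antitoneOn measurableSet_Ioc hh).comp_fst)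
  have hslice : ∀ u, ‖∫ s in Ioc a b, (Iio (h s)).indicator (fun _ => e s) u‖ ≤ M := by
    intro u
    obtain ⟨t, ht, hae⟩ := exists_ae_eq_Ioc_of_antitoneOn hab hh u
    have hS : NullMeasurableSet {s | u < h s} (volume.restrict (Ioc a b)) :=
      nullMeasurableSet_lt aemeasurable_const
        (aemeasurable_restrict_of_antitoneOn measurableSet_Ioc hh)
    have hset : {s | u < h s} ∩ Ioc a b = {s ∈ Ioc a b | u < h s} := inter_comm _ _
    calc ‖∫ s in Ioc a b, (Iio (h s)).indicator (fun _ => e s) u‖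
        = ‖∫ s in Ioc a b, {s | u < h s}.indicator e s‖ := rfl
      _ = ‖∫ s in a..t, e s‖ := by
          rw [integral_indicator₀ hS, Measure.restrict_restrict₀ hS, hset,
            setIntegral_congr_set hae, intervalIntegral.integral_of_le ht.1]
      _ ≤ M := hM t ht
  rw [intervalIntegral.integral_of_le hab, setIntegral_congr_fun measurableSet_Ioc hlayer,
    integral_integral_swap (f := fun s u => (Iio (h s)).indicator (fun _ => e s) u) hint]
  simpa [Real.volume_real_Ioc_of_le hH0] using
    norm_setIntegral_le_of_norm_le_const (μ := volume) (s := Ioc 0 H) (by simp) fun u _ => hslice u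

end SecondMeanValue

lemma hasDerivAt_exp_I_mul {φ : ℝ → ℝ} {φ' s : ℝ} (hφ : HasDerivAt φ φ' s) :
    HasDerivAt (fun s => -Complex.I * Complex.exp (Complex.I * φ s))
      (φ' • Complex.exp (Complex.I * φ s)) s := by
  convert! ((hφ.ofReal_comp.const_mul Complex.I).cexp).const_mul (-Complex.I) using 1
  rw [Complex.real_smul]
  linear_combination (φ' * Complex.exp (Complex.I * φ s)) * Complex.I_mul_I

/- Van der Corput's first derivative test: apply Bonnet to
`e ^ (iφ) = (1 / φ') • (φ' • e ^ (iφ))`. -/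
theorem norm_intervalIntegral_exp_I_mul_le {φ φ' : ℝ → ℝ} {a b l : ℝ} (hab : a ≤ b) (hl : 0 < l)
    (hφ : ∀ s, HasDerivAt φ (φ' s) s) (hφ' : Continuous φ') (hmono : MonotoneOn φ' (Icc a b))
    (hle : l ≤ φ' a) : ‖∫ s in a..b, Complex.exp (Complex.I * φ s)‖ ≤ 2 / l := by
  have hφc : Continuous φ := continuous_iff_continuousAt.mpr fun s => (hφ s).continuousAt
  have hec : Continuous fun s => φ' s • Complex.exp (Complex.I * φ s) := by fun_prop
  have hlφ' : ∀ s ∈ Icc a b, l ≤ φ' s := fun s hs =>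
    hle.trans (hmono (left_mem_Icc.mpr hab) hs hs.1)
  have hprim : ∀ t ∈ Icc a b, ‖∫ s in a..t, φ' s • Complex.exp (Complex.I * φ s)‖ ≤ 2 := by
    intro t _
    rw [intervalIntegral.integral_eq_sub_of_hasDerivAt (fun s _ => hasDerivAt_exp_I_mul (hφ s))
      (hec.intervalIntegrable _ _)]
    refine (norm_sub_le _ _).trans ?_
    simp only [norm_mul, norm_neg, Complex.norm_I, Complex.norm_exp_I_mul_ofReal]
    norm_num
  have hanti : AntitoneOn (fun s => (φ' s)⁻¹) (Ioc a b) := fun s hs t ht hst =>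
    inv_anti₀ (hl.trans_le (hlφ' s (Ioc_subset_Icc_self hs)))
      (hmono (Ioc_subset_Icc_self hs) (Ioc_subset_Icc_self ht) hst)
  have hbound : MapsTo (fun s => (φ' s)⁻¹) (Ioc a b) (Icc 0 l⁻¹) := fun s hs =>
    ⟨inv_nonneg.mpr (hl.le.trans (hlφ' s (Ioc_subset_Icc_self hs))),
      inv_anti₀ hl (hlφ' s (Ioc_subset_Icc_self hs))⟩
  have hcancel : ∀ s ∈ uIcc a b, Complex.exp (Complex.I * φ s)
      = (φ' s)⁻¹ • φ' s • Complex.exp (Complex.I * φ s) := fun s hs =>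
    (inv_smul_smul₀ (hl.trans_le (hlφ' s (uIcc_of_le hab ▸ hs))).ne' _).symm
  rw [intervalIntegral.integral_congr hcancel]
  exact norm_intervalIntegral_smul_le_of_antitoneOn hab (hec.intervalIntegrable _ _) hprim hanti
    (inv_nonneg.mpr hl.le) hbound

/- Integration by parts against an amplitude `b` whose variation is dominated by that of a
nonincreasing `h`. -/
theorem norm_intervalIntegral_mul_le_of_hasDerivAt {e b b' : ℝ → ℂ} {h h' : ℝ → ℝ} {a T M : ℝ}
    (haT : a ≤ T) (he : Continuous e) (hM : ∀ t ∈ Icc a T, ‖∫ s in a..t, e s‖ ≤ M)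
    (hb : ∀ s, HasDerivAt b (b' s) s) (hb' : Continuous b')
    (hh : ∀ s, HasDerivAt h (h' s) s) (hh' : Continuous h')
    (hle : ∀ s ∈ Icc a T, ‖b' s‖ ≤ -h' s) (hT : ‖b T‖ ≤ h T) :
    ‖∫ s in a..T, e s * b s‖ ≤ M * h a := by
  set F : ℝ → ℂ := fun t => ∫ s in a..t, e s
  have hF : ∀ t, HasDerivAt F (e t) t := fun t =>
    intervalIntegral.integral_hasDerivAt_right (he.intervalIntegrable _ _)
      he.aestronglyMeasurable.stronglyMeasurableAtFilter he.continuousAt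
  have hM0 : 0 ≤ M := (norm_nonneg _).trans (hM a (left_mem_Icc.mpr haT))
  have hparts : ∫ s in a..T, e s * b s = F T * b T - ∫ t in a..T, F t * b' t := by
    have hFa : F a = 0 := intervalIntegral.integral_same
    have h := intervalIntegral.integral_mul_deriv_eq_deriv_mul (fun t _ => hF t)
      (fun t _ => hb t) (he.intervalIntegrable a T) (hb'.intervalIntegrable a T)
    rw [h, hFa]
    ring
  have hboundary : ‖F T * b T‖ ≤ M * h T := by
    rw [norm_mul]
    exact mul_le_mul (hM T (right_mem_Icc.mpr haT)) hT (norm_nonneg _) hM0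
  have hinterior : ‖∫ t in a..T, F t * b' t‖ ≤ M * (h a - h T) := by
    calc ‖∫ t in a..T, F t * b' t‖ ≤ ∫ t in a..T, M * (-h' t) := by
          refine intervalIntegral.norm_integral_le_of_norm_le haT
            (Filter.Eventually.of_forall fun t ht => ?_)
            ((continuous_const.mul hh'.neg).intervalIntegrable _ _)
          rw [norm_mul]
          exact mul_le_mul (hM t ⟨ht.1.le, ht.2⟩) (hle t ⟨ht.1.le, ht.2⟩) (norm_nonneg _) hM0
      _ = M * (h a - h T) := by
          rw [intervalIntegral.integral_const_mul, intervalIntegral.integral_neg,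
            intervalIntegral.integral_eq_sub_of_hasDerivAt (fun t _ => hh t)
              (hh'.intervalIntegrable _ _), neg_sub]
  calc ‖∫ s in a..T, e s * b s‖ ≤ M * h T + M * (h a - h T) := by
        rw [hparts]
        exact (norm_sub_le _ _).trans (add_le_add hboundary hinterior)
    _ = M * h a := by ring

/-! ### The phase -/

lemma diffDist_sq {r₁ r₂ : ℝ} (h₁ : 0 ≤ r₁) (h₂ : 0 ≤ r₂) (s : ℝ) :
    diffDist r₁ r₂ s ^ 2 = r₁ ^ 2 + r₂ ^ 2 + 2 * r₁ * r₂ * Real.cosh s := by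
  have := Real.cosh_pos s
  exact Real.sq_sqrt (by positivity)

lemma diffDist_zero {r₁ r₂ : ℝ} (h₁ : 0 ≤ r₁) (h₂ : 0 ≤ r₂) : diffDist r₁ r₂ 0 = r₁ + r₂ := by
  rw [diffDist, Real.cosh_zero, ← Real.sqrt_sq (add_nonneg h₁ h₂)]
  ring_nf

lemma add_le_diffDist {r₁ r₂ : ℝ} (h₁ : 0 ≤ r₁) (h₂ : 0 ≤ r₂) (s : ℝ) :
    r₁ + r₂ ≤ diffDist r₁ r₂ s := by
  apply Real.le_sqrt_of_sq_le
  nlinarith [Real.one_le_cosh s, mul_nonneg h₁ h₂]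

lemma diffDist_pos {r₁ r₂ : ℝ} (h₁ : 0 < r₁) (h₂ : 0 < r₂) (s : ℝ) : 0 < diffDist r₁ r₂ s :=
  (add_pos h₁ h₂).trans_le (add_le_diffDist h₁.le h₂.le s)

@[fun_prop]
lemma continuous_diffDist (r₁ r₂ : ℝ) : Continuous (diffDist r₁ r₂) := by
  unfold diffDist; fun_prop

/-- The derivative of `s ↦ diffDist r₁ r₂ s`, for positive radii. -/
def diffDistDeriv (r₁ r₂ s : ℝ) : ℝ := r₁ * r₂ * Real.sinh s / diffDist r₁ r₂ s

lemma hasDerivAt_diffDist {r₁ r₂ : ℝ} (h₁ : 0 < r₁) (h₂ : 0 < r₂) (s : ℝ) :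
    HasDerivAt (diffDist r₁ r₂) (diffDistDeriv r₁ r₂ s) s := by
  have hpos := diffDist_pos h₁ h₂ s
  have hne : r₁ ^ 2 + r₂ ^ 2 + 2 * r₁ * r₂ * Real.cosh s ≠ 0 := by
    rw [← diffDist_sq h₁.le h₂.le]
    positivity
  have h : HasDerivAt (diffDist r₁ r₂) (2 * r₁ * r₂ * Real.sinh s / (2 * diffDist r₁ r₂ s)) s :=
    (((Real.hasDerivAt_cosh s).const_mul (2 * r₁ * r₂)).const_add (r₁ ^ 2 + r₂ ^ 2)).sqrt hne
  convert! h using 1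
  unfold diffDistDeriv
  field_simp

lemma continuous_diffDistDeriv {r₁ r₂ : ℝ} (h₁ : 0 < r₁) (h₂ : 0 < r₂) :
    Continuous (diffDistDeriv r₁ r₂) :=
  (continuous_const.mul Real.continuous_sinh).div (continuous_diffDist r₁ r₂)
    fun s => (diffDist_pos h₁ h₂ s).ne'

lemma diffDistDeriv_nonneg {r₁ r₂ s : ℝ} (h₁ : 0 < r₁) (h₂ : 0 < r₂) (hs : 0 ≤ s) :
    0 ≤ diffDistDeriv r₁ r₂ s :=
  div_nonneg (mul_nonneg (by positivity) (Real.sinh_nonneg_iff.mpr hs)) (diffDist_pos h₁ h₂ s).le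

lemma monotoneOn_diffDistDeriv {r₁ r₂ : ℝ} (h₁ : 0 < r₁) (h₂ : 0 < r₂) :
    MonotoneOn (diffDistDeriv r₁ r₂) (Ici 0) := by
  intro s hs t ht hst
  have hns := diffDist_pos h₁ h₂ s
  have hnt := diffDist_pos h₁ h₂ t
  have hsinh : 0 ≤ Real.sinh t := Real.sinh_nonneg_iff.mpr ht
  have hcosh : 0 ≤ Real.cosh t - Real.cosh s :=
    sub_nonneg.mpr (Real.cosh_le_cosh.mpr (by rwa [abs_of_nonneg hs, abs_of_nonneg ht]))
  have hcross : Real.sinh s * diffDist r₁ r₂ t ≤ Real.sinh t * diffDist r₁ r₂ s := by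
    apply le_of_sq_le_sq _ (by positivity)
    rw [mul_pow, mul_pow, diffDist_sq h₁.le h₂.le, diffDist_sq h₁.le h₂.le, Real.sinh_sq,
      Real.sinh_sq, ← sub_nonneg]
    have hfactor : (Real.cosh t ^ 2 - 1) * (r₁ ^ 2 + r₂ ^ 2 + 2 * r₁ * r₂ * Real.cosh s)
        - (Real.cosh s ^ 2 - 1) * (r₁ ^ 2 + r₂ ^ 2 + 2 * r₁ * r₂ * Real.cosh t)
        = (Real.cosh t - Real.cosh s) * ((r₁ ^ 2 + r₂ ^ 2) * (Real.cosh s + Real.cosh t)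
          + 2 * r₁ * r₂ * (Real.cosh s * Real.cosh t + 1)) := by ring
    have := Real.cosh_pos s
    have := Real.cosh_pos t
    rw [hfactor]
    exact mul_nonneg hcosh (by positivity)
  unfold diffDistDeriv
  rw [div_le_div_iff₀ hns hnt, mul_assoc, mul_assoc _ (Real.sinh t)]
  exact mul_le_mul_of_nonneg_left hcross (by positivity)

lemma cosh_le_two {s : ℝ} (hs : |s| ≤ 1) : Real.cosh s ≤ 2 := by
  have hexp := Real.exp_one_lt_d9
  have hexp' : Real.exp (-1) ≤ 1 := Real.exp_le_one_iff.mpr (by norm_num)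
  calc Real.cosh s ≤ Real.cosh 1 := Real.cosh_le_cosh.mpr (by rwa [abs_one])
    _ ≤ 2 := by rw [Real.cosh_eq]; linarith

lemma mul_div_four_le_diffDistDeriv {r₁ r₂ ρ s : ℝ} (hρ : 0 < ρ) (h₁ : ρ ≤ r₁) (h₂ : ρ ≤ r₂)
    (hs : 0 ≤ s) (hs1 : s ≤ 1) : ρ * s / 4 ≤ diffDistDeriv r₁ r₂ s := by
  have p₁ := hρ.trans_le h₁
  have p₂ := hρ.trans_le h₂
  have hdist : diffDist r₁ r₂ s ≤ 2 * (r₁ + r₂) := by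
    apply le_of_sq_le_sq _ (by positivity)
    have hcosh := cosh_le_two (abs_le.mpr ⟨by linarith, hs1⟩)
    rw [diffDist_sq p₁.le p₂.le]
    nlinarith [mul_pos p₁ p₂, sq_nonneg r₁, sq_nonneg r₂]
  have hradii : ρ * (r₁ + r₂) ≤ 2 * (r₁ * r₂) := by nlinarith
  rw [diffDistDeriv, le_div_iff₀ (diffDist_pos p₁ p₂ s)]
  calc ρ * s / 4 * diffDist r₁ r₂ s ≤ ρ * s / 4 * (2 * (r₁ + r₂)) := by gcongr
    _ = ρ * (r₁ + r₂) * s / 2 := by ring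
    _ ≤ 2 * (r₁ * r₂) * s / 2 := by gcongr
    _ = r₁ * r₂ * s := by ring
    _ ≤ r₁ * r₂ * Real.sinh s := by
        gcongr
        exact Real.self_le_sinh_iff.mpr hs

lemma norm_intervalIntegral_exp_I_mul_le_sub (φ : ℝ → ℝ) {a b : ℝ} (hab : a ≤ b) :
    ‖∫ s in a..b, Complex.exp (Complex.I * φ s)‖ ≤ b - a := by
  have h := intervalIntegral.norm_integral_le_of_norm_le_const (a := a) (b := b) (C := 1)
    (f := fun s => Complex.exp (Complex.I * φ s)) fun s _ => (Complex.norm_exp_I_mul_ofReal _).le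
  rwa [abs_of_nonneg (sub_nonneg.mpr hab), one_mul] at h

/- The phase is stationary only at `s = 0`. Its derivative is at least `ρ s / 4` there, so the
integral is split at `s = ρ ^ (-1 / 2)`. -/
theorem norm_intervalIntegral_exp_diffDist_le {r₁ r₂ ρ T : ℝ} (hρ : 1 ≤ ρ) (h₁ : ρ ≤ r₁)
    (h₂ : ρ ≤ r₂) (hT : 0 ≤ T) :
    ‖∫ s in (0 : ℝ)..T, Complex.exp (Complex.I * diffDist r₁ r₂ s)‖
      ≤ 9 * ρ ^ (-(1 / 2) : ℝ) := by
  have hρ0 : 0 < ρ := by linarith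
  have p₁ := hρ0.trans_le h₁
  have p₂ := hρ0.trans_le h₂
  set τ : ℝ := ρ ^ (-(1 / 2) : ℝ)
  have hτ0 : 0 < τ := Real.rpow_pos_of_pos hρ0 _
  have hτ1 : τ ≤ 1 := Real.rpow_le_one_of_one_le_of_nonpos hρ (by norm_num)
  have hτsq : ρ * (τ * τ) = 1 := by
    rw [← Real.rpow_add hρ0, show -(1 / 2) + -(1 / 2) = (-1 : ℝ) by norm_num, Real.rpow_neg_one,
      mul_inv_cancel₀ hρ0.ne']
  have hec : Continuous fun s => Complex.exp (Complex.I * diffDist r₁ r₂ s) := by fun_prop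
  have hnear {t : ℝ} (ht : 0 ≤ t) := norm_intervalIntegral_exp_I_mul_le_sub (diffDist r₁ r₂) ht
  rcases le_total T τ with hTτ | hτT
  · linarith [hnear hT]
  have hfar : ‖∫ s in τ..T, Complex.exp (Complex.I * diffDist r₁ r₂ s)‖ ≤ 2 / (ρ * τ / 4) :=
    norm_intervalIntegral_exp_I_mul_le hτT (by positivity) (hasDerivAt_diffDist p₁ p₂)
      (continuous_diffDistDeriv p₁ p₂)
      ((monotoneOn_diffDistDeriv p₁ p₂).mono fun s hs => hτ0.le.trans hs.1)
      (mul_div_four_le_diffDistDeriv hρ0 h₁ h₂ hτ0.le hτ1)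
  have hτeq : 2 / (ρ * τ / 4) = 8 * τ := by
    field_simp
    linarith
  calc _ = ‖(∫ s in (0 : ℝ)..τ, Complex.exp (Complex.I * diffDist r₁ r₂ s))
        + ∫ s in τ..T, Complex.exp (Complex.I * diffDist r₁ r₂ s)‖ := by
        rw [intervalIntegral.integral_add_adjacent_intervals (hec.intervalIntegrable 0 τ)
          (hec.intervalIntegrable τ T)]
    _ ≤ (τ - 0) + 8 * τ := (norm_add_le _ _).trans (add_le_add (hnear hτ0.le) (hτeq ▸ hfar))
    _ = 9 * τ := by ring

/-! ### Oscillatory integrals in the diffractive phase -/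

/-- Symbols of order `-μ` on `(0, ∞)`, to first order and with a single constant: `‖B x‖` is at
most `C (1 + x) ^ (-μ)`, and for `x ≥ 1` the derivative of `B` is dominated by that of this
majorant. -/
structure SymbolBound (μ C : ℝ) (B : ℝ → ℂ) : Prop where
  pos : 0 < C
  contDiffOn : ContDiffOn ℝ 1 B (Ioi 0)
  norm_le : ∀ x, 0 < x → ‖B x‖ ≤ C * (1 + x) ^ (-μ)
  norm_deriv_le : ∀ x, 1 ≤ x → ‖deriv B x‖ ≤ C * (μ * (1 + x) ^ (-μ - 1))

/-- The factor of the diffractive integrand that does not depend on the weight: the phase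
`e ^ (i |n_s|)` times a symbol `B` evaluated at `|n_s|`. -/
def oscFactor (B : ℝ → ℂ) (r₁ r₂ s : ℝ) : ℂ :=
  Complex.exp (Complex.I * diffDist r₁ r₂ s) * B (diffDist r₁ r₂ s)

/-- The oscillatory integral of a weight `w` on `(0, ∞)`. The diffractive kernel is the case of
the three weights `diffWeight`. -/
def oscIntegral (B : ℝ → ℂ) (r₁ r₂ : ℝ) (w : ℝ → ℝ) : ℂ :=
  ∫ s in Ioi (0 : ℝ), oscFactor B r₁ r₂ s * w s

/-- Nonincreasing weights on `(0, ∞)` with values in `[0, H]` and integral at most `I`. -/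
structure DecayingWeight (w : ℝ → ℝ) (H I : ℝ) : Prop where
  integrableOn : IntegrableOn w (Ioi 0)
  antitoneOn : AntitoneOn w (Ioi 0)
  nonneg : ∀ s, 0 < s → 0 ≤ w s
  le : ∀ s, 0 < s → w s ≤ H
  integral_le : ∫ s in Ioi (0 : ℝ), w s ≤ I

namespace DecayingWeight

variable {w v : ℝ → ℝ} {H I : ℝ}

lemma of_le (hv : IntegrableOn v (Ioi 0)) (hI : ∫ s in Ioi (0 : ℝ), v s ≤ I)
    (hanti : AntitoneOn w (Ioi 0)) (h0 : ∀ s, 0 < s → 0 ≤ w s) (hH : ∀ s, 0 < s → w s ≤ H)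
    (hle : ∀ s, 0 < s → w s ≤ v s) : DecayingWeight w H I := by
  have hint : IntegrableOn w (Ioi 0) := by
    refine Integrable.mono' hv
      (aemeasurable_restrict_of_antitoneOn measurableSet_Ioi hanti).aestronglyMeasurable ?_
    filter_upwards [ae_restrict_mem measurableSet_Ioi] with s hs
    rw [Real.norm_of_nonneg (h0 s hs)]
    exact hle s hs
  exact ⟨hint, hanti, h0, hH,
    (setIntegral_mono_on hint hv measurableSet_Ioi fun s hs => hle s hs).trans hI⟩

lemma setIntegral_abs (hw : DecayingWeight w H I) :
    ∫ s in Ioi (0 : ℝ), |w s| = ∫ s in Ioi (0 : ℝ), w s :=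
  setIntegral_congr_fun measurableSet_Ioi fun s hs => abs_of_nonneg (hw.nonneg s hs)

lemma bound_nonneg (hw : DecayingWeight w H I) : 0 ≤ H :=
  (hw.nonneg 1 one_pos).trans (hw.le 1 one_pos)

lemma integral_nonneg (hw : DecayingWeight w H I) : 0 ≤ ∫ s in Ioi (0 : ℝ), w s :=
  setIntegral_nonneg measurableSet_Ioi fun s hs => hw.nonneg s hs

end DecayingWeight

namespace SymbolBound

variable {μ C r₁ r₂ ρ : ℝ} {B : ℝ → ℂ}

lemma hasDerivAt (hB : SymbolBound μ C B) {x : ℝ} (hx : 0 < x) : HasDerivAt B (deriv B x) x :=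
  ((hB.contDiffOn.differentiableOn one_ne_zero).differentiableAt (Ioi_mem_nhds hx)).hasDerivAt

lemma continuous_comp_diffDist (hB : SymbolBound μ C B) (h₁ : 0 < r₁) (h₂ : 0 < r₂) :
    Continuous fun s => B (diffDist r₁ r₂ s) :=
  hB.contDiffOn.continuousOn.comp_continuous (continuous_diffDist r₁ r₂) (diffDist_pos h₁ h₂)

lemma continuous_oscFactor (hB : SymbolBound μ C B) (h₁ : 0 < r₁) (h₂ : 0 < r₂) :
    Continuous (oscFactor B r₁ r₂) :=
  Continuous.mul (by fun_prop) (hB.continuous_comp_diffDist h₁ h₂)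

lemma norm_oscFactor_le (hB : SymbolBound μ C B) (hμ : 0 ≤ μ) (h₁ : 0 < r₁) (h₂ : 0 < r₂)
    (s : ℝ) : ‖oscFactor B r₁ r₂ s‖ ≤ C * (1 + (r₁ + r₂)) ^ (-μ) := by
  have hdist := add_le_diffDist h₁.le h₂.le s
  rw [oscFactor, norm_mul, Complex.norm_exp_I_mul_ofReal, one_mul]
  exact (hB.norm_le _ (diffDist_pos h₁ h₂ s)).trans (mul_le_mul_of_nonneg_left
    (Real.rpow_le_rpow_of_nonpos (by linarith) (by linarith) (neg_nonpos.mpr hμ)) hB.pos.le)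

lemma integrableOn_oscFactor_mul (hB : SymbolBound μ C B) (hμ : 0 ≤ μ) (h₁ : 0 < r₁)
    (h₂ : 0 < r₂) {w : ℝ → ℝ} (hw : IntegrableOn w (Ioi 0)) :
    IntegrableOn (fun s => oscFactor B r₁ r₂ s * w s) (Ioi 0) :=
  Integrable.bdd_mul (hw.ofReal (𝕜 := ℂ)) (hB.continuous_oscFactor h₁ h₂).aestronglyMeasurable
    (Filter.Eventually.of_forall (hB.norm_oscFactor_le hμ h₁ h₂))

lemma norm_oscIntegral_le_integral_abs (hB : SymbolBound μ C B) (hμ : 0 ≤ μ) (h₁ : 0 < r₁)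
    (h₂ : 0 < r₂) {w : ℝ → ℝ} (hw : IntegrableOn w (Ioi 0)) :
    ‖oscIntegral B r₁ r₂ w‖ ≤ C * (1 + (r₁ + r₂)) ^ (-μ) * ∫ s in Ioi (0 : ℝ), |w s| := by
  rw [← integral_const_mul]
  refine norm_integral_le_of_norm_le (hw.norm.const_mul _) (Filter.Eventually.of_forall fun s => ?_)
  rw [norm_mul, Complex.norm_real, Real.norm_eq_abs]
  exact mul_le_mul_of_nonneg_right (hB.norm_oscFactor_le hμ h₁ h₂ s) (abs_nonneg _)

lemma norm_intervalIntegral_oscFactor_le (hB : SymbolBound μ C B) (hρ : 1 ≤ ρ) (h₁ : ρ ≤ r₁)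
    (h₂ : ρ ≤ r₂) {T : ℝ} (hT : 0 ≤ T) :
    ‖∫ s in (0 : ℝ)..T, oscFactor B r₁ r₂ s‖
      ≤ 9 * ρ ^ (-(1 / 2) : ℝ) * (C * (1 + (r₁ + r₂)) ^ (-μ)) := by
  have p₁ : 0 < r₁ := by linarith
  have p₂ : 0 < r₂ := by linarith
  have hdist : ∀ s, 1 ≤ diffDist r₁ r₂ s := fun s => by
    linarith [add_le_diffDist p₁.le p₂.le s]
  have hne : ∀ s, 1 + diffDist r₁ r₂ s ≠ 0 := fun s => by linarith [hdist s]
  have hφ := hasDerivAt_diffDist p₁ p₂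
  have hφ' := continuous_diffDistDeriv p₁ p₂
  have hmajorant : Continuous fun s => (1 + diffDist r₁ r₂ s) ^ (-μ - 1) :=
    Continuous.rpow_const (by fun_prop) fun s => .inl (hne s)
  have hvariation : ∀ s ∈ Icc 0 T, ‖diffDistDeriv r₁ r₂ s • deriv B (diffDist r₁ r₂ s)‖
      ≤ -(C * (diffDistDeriv r₁ r₂ s * -μ * (1 + diffDist r₁ r₂ s) ^ (-μ - 1))) := by
    intro s hs
    have hnonneg := diffDistDeriv_nonneg p₁ p₂ hs.1
    rw [norm_smul, Real.norm_of_nonneg hnonneg]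
    calc _ ≤ diffDistDeriv r₁ r₂ s * (C * (μ * (1 + diffDist r₁ r₂ s) ^ (-μ - 1))) :=
          mul_le_mul_of_nonneg_left (hB.norm_deriv_le _ (hdist s)) hnonneg
      _ = _ := by ring
  have h := norm_intervalIntegral_mul_le_of_hasDerivAt
    (h := fun s => C * (1 + diffDist r₁ r₂ s) ^ (-μ)) hT (by fun_prop)
    (fun t ht => norm_intervalIntegral_exp_diffDist_le hρ h₁ h₂ ht.1)
    (fun s => (hB.hasDerivAt (diffDist_pos p₁ p₂ s)).scomp s (hφ s))
    (hφ'.smul ((hB.contDiffOn.continuousOn_deriv_of_isOpen isOpen_Ioi le_rfl).comp_continuous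
      (continuous_diffDist r₁ r₂) (diffDist_pos p₁ p₂)))
    (fun s => (((hφ s).const_add 1).rpow_const (.inl (hne s))).const_mul C)
    (continuous_const.mul ((hφ'.mul continuous_const).mul hmajorant)) hvariation
    (hB.norm_le _ (diffDist_pos p₁ p₂ T))
  rwa [diffDist_zero p₁.le p₂.le] at h

lemma norm_oscIntegral_le_of_one_le (hB : SymbolBound μ C B) (hμ : 0 ≤ μ) (hρ : 1 ≤ ρ)
    (h₁ : ρ ≤ r₁) (h₂ : ρ ≤ r₂) {w : ℝ → ℝ} {H I : ℝ} (hw : DecayingWeight w H I) :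
    ‖oscIntegral B r₁ r₂ w‖
      ≤ 9 * ρ ^ (-(1 / 2) : ℝ) * (C * (1 + (r₁ + r₂)) ^ (-μ)) * H := by
  have p₁ : 0 < r₁ := by linarith
  have p₂ : 0 < r₂ := by linarith
  have hint := hB.integrableOn_oscFactor_mul hμ p₁ p₂ hw.integrableOn
  refine le_of_tendsto (intervalIntegral_tendsto_integral_Ioi 0 hint Filter.tendsto_id).norm ?_
  filter_upwards [Filter.eventually_ge_atTop 0] with T hT
  have hswap : ∀ s, oscFactor B r₁ r₂ s * w s = w s • oscFactor B r₁ r₂ s := fun s => by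
    rw [Complex.real_smul, mul_comm]
  simp only [id, hswap]
  exact norm_intervalIntegral_smul_le_of_antitoneOn hT
    ((hB.continuous_oscFactor p₁ p₂).intervalIntegrable _ _)
    (fun t ht => hB.norm_intervalIntegral_oscFactor_le hρ h₁ h₂ ht.1)
    (hw.antitoneOn.mono fun s hs => hs.1) hw.bound_nonneg
    fun s hs => ⟨hw.nonneg s hs.1, hw.le s hs.1⟩

theorem norm_oscIntegral_le (hB : SymbolBound μ C B) (hμ : 0 ≤ μ) (h₁ : 0 < r₁) (h₂ : 0 < r₂)
    {w : ℝ → ℝ} {H I : ℝ} (hw : DecayingWeight w H I) :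
    ‖oscIntegral B r₁ r₂ w‖ ≤
      C * (1 + (r₁ + r₂)) ^ (-μ) * (1 + min r₁ r₂) ^ (-(1 / 2) : ℝ) * (18 * (H + I)) := by
  have hH := hw.bound_nonneg
  have hI : 0 ≤ I := hw.integral_nonneg.trans hw.integral_le
  have hC := hB.pos
  have hhalf : (1 : ℝ) / 2 ≤ 2 ^ (-(1 / 2) : ℝ) := by
    rw [one_div, ← Real.rpow_neg_one]
    exact Real.rpow_le_rpow_of_exponent_le (by norm_num) (by norm_num)
  have hP : 0 < (1 + (r₁ + r₂)) ^ (-μ) := Real.rpow_pos_of_pos (by linarith) _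
  set P := (1 + (r₁ + r₂)) ^ (-μ)
  set ρ := min r₁ r₂
  have hρ : 0 < ρ := lt_min h₁ h₂
  set Q := (1 + ρ) ^ (-(1 / 2) : ℝ)
  have hQ : 0 < Q := Real.rpow_pos_of_pos (by linarith) _
  rcases le_total 1 ρ with hρ1 | hρ1
  · have hρQ : ρ ^ (-(1 / 2) : ℝ) ≤ 2 * Q := by
      have hdouble : (2 * ρ) ^ (-(1 / 2) : ℝ) ≤ Q :=
        Real.rpow_le_rpow_of_nonpos (by linarith) (by linarith) (by norm_num)
      rw [Real.mul_rpow (by norm_num) hρ.le] at hdouble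
      nlinarith [Real.rpow_pos_of_pos hρ (-(1 / 2))]
    calc ‖oscIntegral B r₁ r₂ w‖ ≤ 9 * ρ ^ (-(1 / 2) : ℝ) * (C * P) * H :=
          hB.norm_oscIntegral_le_of_one_le hμ hρ1 (min_le_left _ _) (min_le_right _ _) hw
      _ ≤ 9 * (2 * Q) * (C * P) * (H + I) := by gcongr; linarith
      _ = C * P * Q * (18 * (H + I)) := by ring
  · have hQ2 : 1 ≤ 2 * Q := by
      have : (2 : ℝ) ^ (-(1 / 2) : ℝ) ≤ Q :=
        Real.rpow_le_rpow_of_nonpos (by linarith) (by linarith) (by norm_num)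
      linarith
    have hint := hw.integral_le
    calc ‖oscIntegral B r₁ r₂ w‖ ≤ C * P * ∫ s in Ioi (0 : ℝ), |w s| :=
          hB.norm_oscIntegral_le_integral_abs hμ h₁ h₂ hw.integrableOn
      _ ≤ C * P * (2 * Q * (9 * (H + I))) := by
          rw [hw.setIntegral_abs]
          gcongr
          nlinarith
      _ = C * P * Q * (18 * (H + I)) := by ring

end SymbolBound

/-! ### The amplitude of the diffractive kernel -/

/-- Amplitudes on `(0, ∞)` of which only the first two symbol bounds `‖a‖ ≤ C` and
`‖a' r‖ ≤ C / r` are required. -/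
structure IsC1Amplitude (a : ℝ → ℂ) : Prop where
  contDiffOn : ContDiffOn ℝ 1 a (Ioi 0)
  exists_norm_le : ∃ C : ℝ, ∀ r : ℝ, 0 < r → ‖a r‖ ≤ C
  exists_norm_deriv_le : ∃ C : ℝ, ∀ r : ℝ, 0 < r → ‖deriv a r‖ ≤ C * r⁻¹

lemma IsAmplitude.isC1Amplitude {a : ℝ → ℂ} (ha : IsAmplitude a) : IsC1Amplitude a where
  contDiffOn := ha.smooth.of_le (mod_cast le_top)
  exists_norm_le := by simpa using ha.bound 0
  exists_norm_deriv_le := by simpa using ha.bound 1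

/-- The part `(1 + |n_s|) ^ (-3/2 - δ) a(|n_s|)` of the diffractive integrand, as a function of
`x = |n_s|`. -/
def oscAmplitude (δ : ℝ) (a : ℝ → ℂ) (x : ℝ) : ℂ :=
  (((1 + x) ^ (-(3 / 2) - δ) : ℝ) : ℂ) * a x

lemma diffIntegrand_eq (α δ : ℝ) (a : ℝ → ℂ) (ℓ : ℕ) (r₁ r₂ θ s : ℝ) :
    diffIntegrand α δ a ℓ r₁ r₂ θ s
      = oscFactor (oscAmplitude δ a) r₁ r₂ s * diffWeight α θ s ℓ := by
  unfold diffIntegrand oscFactor oscAmplitude; ring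

lemma diffKernel_eq (α δ : ℝ) (a : ℝ → ℂ) (ℓ : ℕ) (r₁ r₂ θ : ℝ) :
    diffKernel α δ a ℓ r₁ r₂ θ
      = oscIntegral (oscAmplitude δ a) r₁ r₂ fun s => diffWeight α θ s ℓ := by
  simp only [diffKernel, oscIntegral, diffIntegrand_eq]

lemma contDiffOn_one_add_rpow (t : ℝ) : ContDiffOn ℝ 1 (fun x : ℝ => (1 + x) ^ t) (Ioi 0) :=
  fun x hx => ((contDiff_const.add contDiff_id).contDiffWithinAt).rpow_const_of_ne
    (by simpa using (add_pos one_pos (mem_Ioi.mp hx)).ne')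

lemma norm_deriv_oscAmplitude_le {δ C₀ C₁ x : ℝ} {a : ℝ → ℂ} (ha : DifferentiableAt ℝ a x)
    (hδ : -(3 / 2) < δ) (hx : 1 ≤ x) (h₀ : ‖a x‖ ≤ C₀) (h₁ : ‖deriv a x‖ ≤ C₁ * x⁻¹) :
    ‖deriv (oscAmplitude δ a) x‖
      ≤ ((3 / 2 + δ) * C₀ + 2 * C₁) * (1 + x) ^ (-(3 / 2 + δ) - 1) := by
  have hx1 : 0 < 1 + x := by linarith
  have hpow : HasDerivAt (fun y : ℝ => (1 + y) ^ (-(3 / 2) - δ))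
      ((-(3 / 2) - δ) * (1 + x) ^ (-(3 / 2) - δ - 1)) x := by
    simpa using ((hasDerivAt_id x).const_add 1).rpow_const (p := -(3 / 2) - δ) (.inl hx1.ne')
  have hsplit : (1 + x) ^ (-(3 / 2) - δ) = (1 + x) ^ (-(3 / 2) - δ - 1) * (1 + x) := by
    rw [← Real.rpow_add_one hx1.ne', sub_add_cancel]
  have hderiv : ‖deriv a x‖ * (1 + x) ≤ 2 * C₁ := by
    have hC₁ : 0 ≤ C₁ := by
      have := (norm_nonneg _).trans h₁
      exact nonneg_of_mul_nonneg_left this (by positivity)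
    calc ‖deriv a x‖ * (1 + x) ≤ C₁ * x⁻¹ * (2 * x) := by gcongr; linarith
      _ = 2 * C₁ := by field_simp
  have habs : |-(3 / 2) - δ| = 3 / 2 + δ := by
    rw [abs_of_neg (by linarith)]
    ring
  have hP : 0 < (1 + x) ^ (-(3 / 2) - δ - 1) := Real.rpow_pos_of_pos hx1 _
  have hprod : HasDerivAt (oscAmplitude δ a) _ x := hpow.ofReal_comp.mul ha.hasDerivAt
  rw [hprod.deriv, hsplit, neg_add']
  set P := (1 + x) ^ (-(3 / 2) - δ - 1)
  refine (norm_add_le _ _).trans ?_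
  simp only [norm_mul, Complex.norm_real, Real.norm_eq_abs, habs, abs_of_pos hP, abs_of_pos hx1]
  calc (3 / 2 + δ) * P * ‖a x‖ + P * (1 + x) * ‖deriv a x‖
      = ((3 / 2 + δ) * ‖a x‖ + ‖deriv a x‖ * (1 + x)) * P := by ring
    _ ≤ ((3 / 2 + δ) * C₀ + 2 * C₁) * P := by
        gcongr
        linarith

lemma IsC1Amplitude.exists_symbolBound {δ : ℝ} {a : ℝ → ℂ} (ha : IsC1Amplitude a)
    (hδ : -(3 / 2) < δ) : ∃ C, SymbolBound (3 / 2 + δ) C (oscAmplitude δ a) := by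
  obtain ⟨C₀, hC₀⟩ := ha.exists_norm_le
  obtain ⟨C₁, hC₁⟩ := ha.exists_norm_deriv_le
  have hμ : 0 < 3 / 2 + δ := by linarith
  have hC₀0 : 0 ≤ C₀ := (norm_nonneg _).trans (hC₀ 1 one_pos)
  have hC₁0 : 0 ≤ C₁ := by simpa using (norm_nonneg _).trans (hC₁ 1 one_pos)
  have hpos : 0 < C₀ + 2 * C₁ / (3 / 2 + δ) + 1 := by positivity
  refine ⟨C₀ + 2 * C₁ / (3 / 2 + δ) + 1, hpos, ?_, fun x hx => ?_, fun x hx => ?_⟩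
  · exact (Complex.ofRealCLM.contDiff.comp_contDiffOn (contDiffOn_one_add_rpow _)).mul
      ha.contDiffOn
  · have hP : 0 < (1 + x) ^ (-(3 / 2) - δ) := Real.rpow_pos_of_pos (by linarith) _
    rw [oscAmplitude, norm_mul, Complex.norm_real, Real.norm_of_nonneg hP.le, mul_comm, neg_add']
    gcongr
    have : 0 ≤ 2 * C₁ / (3 / 2 + δ) := by positivity
    linarith [hC₀ x hx]
  · have hx0 : 0 < x := by linarith
    have hdiff : DifferentiableAt ℝ a x :=
      (ha.contDiffOn.differentiableOn one_ne_zero).differentiableAt (Ioi_mem_nhds hx0)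
    refine (norm_deriv_oscAmplitude_le hdiff hδ hx (hC₀ x hx0) (hC₁ x hx0)).trans ?_
    rw [← mul_assoc]
    refine mul_le_mul_of_nonneg_right ?_ (Real.rpow_nonneg (by linarith) _)
    have : 2 * C₁ / (3 / 2 + δ) * (3 / 2 + δ) = 2 * C₁ := div_mul_cancel₀ _ hμ.ne'
    nlinarith

/-! ### Decaying quotients of hyperbolic functions -/

lemma antitoneOn_cosh_div_cosh {α : ℝ} (hα : |α| ≤ 1) :
    AntitoneOn (fun s => Real.cosh (α * s) / Real.cosh s) (Ici 0) := by
  intro s hs t ht hst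
  rw [mem_Ici] at hs ht
  have hcosh : ∀ x, Real.cosh (α * x) = Real.cosh (|α| * x) := fun x => by
    rw [← Real.cosh_abs (α * x), ← Real.cosh_abs (|α| * x), abs_mul, abs_mul, abs_abs]
  simp only [hcosh]
  have hb := abs_nonneg α
  generalize |α| = b at hα hb
  rw [div_le_div_iff₀ (Real.cosh_pos _) (Real.cosh_pos _)]
  have hadd : Real.cosh (b * t + s) ≤ Real.cosh (b * s + t) := by
    rw [Real.cosh_le_cosh, abs_of_nonneg (by positivity), abs_of_nonneg (by positivity)]
    nlinarith
  have hsub : Real.cosh (b * t - s) ≤ Real.cosh (b * s - t) := by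
    rw [Real.cosh_le_cosh, abs_sub_comm (b * s)]
    exact (abs_le.mpr ⟨by nlinarith, by nlinarith⟩).trans (le_abs_self _)
  rw [Real.cosh_add, Real.cosh_add] at hadd
  rw [Real.cosh_sub, Real.cosh_sub] at hsub
  linarith

lemma cosh_mul_le_exp {α s : ℝ} (hs : 0 ≤ s) : Real.cosh (α * s) ≤ Real.exp (|α| * s) := by
  rw [← Real.cosh_abs, abs_mul, abs_of_nonneg hs, Real.cosh_eq]
  have : Real.exp (-(|α| * s)) ≤ Real.exp (|α| * s) :=
    Real.exp_le_exp.mpr (neg_le_self (by positivity))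
  linarith

lemma cosh_div_cosh_le_exp {α s : ℝ} (hs : 0 ≤ s) :
    Real.cosh (α * s) / Real.cosh s ≤ 2 * Real.exp (-(1 - |α|) * s) := by
  have hexp : Real.exp s ≤ 2 * Real.cosh s := by
    rw [Real.cosh_eq]
    linarith [Real.exp_pos (-s)]
  rw [div_le_iff₀ (Real.cosh_pos _)]
  calc Real.cosh (α * s) ≤ Real.exp (-(1 - |α|) * s) * Real.exp s := by
        rw [← Real.exp_add]
        exact (cosh_mul_le_exp hs).trans_eq (by ring_nf)
    _ ≤ Real.exp (-(1 - |α|) * s) * (2 * Real.cosh s) := by gcongr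
    _ = _ := by ring

lemma cosh_div_cosh_le_one {α : ℝ} (hα : |α| ≤ 1) (s : ℝ) :
    Real.cosh (α * s) / Real.cosh s ≤ 1 := by
  rw [div_le_one (Real.cosh_pos _), Real.cosh_le_cosh, abs_mul]
  exact mul_le_of_le_one_left (abs_nonneg s) hα

lemma sinh_div_sinh_le_cosh_div_cosh {α s : ℝ} (hα : α ≤ 1) (hs : 0 < s) :
    Real.sinh (α * s) / Real.sinh s ≤ Real.cosh (α * s) / Real.cosh s := by
  rw [div_le_div_iff₀ (Real.sinh_pos_iff.mpr hs) (Real.cosh_pos _)]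
  have : 0 ≤ Real.sinh (s - α * s) := Real.sinh_nonneg_iff.mpr (by nlinarith)
  rw [Real.sinh_sub] at this
  linarith

lemma mul_cosh_mul_sinh_le_sinh_mul_cosh {α s : ℝ} (h0 : 0 ≤ α) (h1 : α ≤ 1) (hs : 0 ≤ s) :
    α * Real.cosh (α * s) * Real.sinh s ≤ Real.sinh (α * s) * Real.cosh s := by
  have hderiv : ∀ x, HasDerivAt
      (fun x => α * Real.cosh (α * x) * Real.sinh x - Real.sinh (α * x) * Real.cosh x)
      ((α ^ 2 - 1) * Real.sinh (α * x) * Real.sinh x) x := by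
    intro x
    have hlin : HasDerivAt (fun x => α * x) α x := by simpa using (hasDerivAt_id x).const_mul α
    convert! ((hlin.cosh.const_mul α).mul (Real.hasDerivAt_sinh x)).sub
      (hlin.sinh.mul (Real.hasDerivAt_cosh x)) using 1
    ring
  have hanti : AntitoneOn
      (fun x => α * Real.cosh (α * x) * Real.sinh x - Real.sinh (α * x) * Real.cosh x)
      (Ici 0) := by
    refine antitoneOn_of_deriv_nonpos (convex_Ici 0)
      (fun x _ => (hderiv x).continuousAt.continuousWithinAt)
      (fun x _ => (hderiv x).differentiableAt.differentiableWithinAt) fun x hx => ?_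
    rw [interior_Ici, mem_Ioi] at hx
    rw [(hderiv x).deriv]
    exact mul_nonpos_of_nonpos_of_nonneg (mul_nonpos_of_nonpos_of_nonneg (by nlinarith)
      (Real.sinh_nonneg_iff.mpr (by positivity))) (Real.sinh_nonneg_iff.mpr hx.le)
  simpa using hanti (mem_Ici.mpr le_rfl) hs hs

lemma antitoneOn_sinh_div_sinh {α : ℝ} (h0 : 0 ≤ α) (h1 : α ≤ 1) :
    AntitoneOn (fun s => Real.sinh (α * s) / Real.sinh s) (Ioi 0) := by
  have hderiv : ∀ s, 0 < s → HasDerivAt (fun s => Real.sinh (α * s) / Real.sinh s)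
      ((α * Real.cosh (α * s) * Real.sinh s - Real.sinh (α * s) * Real.cosh s)
        / Real.sinh s ^ 2) s := by
    intro s hs
    have hlin : HasDerivAt (fun s => α * s) α s := by simpa using (hasDerivAt_id s).const_mul α
    convert! hlin.sinh.div (Real.hasDerivAt_sinh s) (Real.sinh_pos_iff.mpr hs).ne' using 1
    ring
  refine antitoneOn_of_deriv_nonpos (convex_Ioi 0)
    (fun s hs => (hderiv s hs).continuousAt.continuousWithinAt)
    (fun s hs => (hderiv s (interior_subset hs)).differentiableAt.differentiableWithinAt)
    fun s hs => ?_
  rw [interior_Ioi, mem_Ioi] at hs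
  rw [(hderiv s hs).deriv]
  exact div_nonpos_of_nonpos_of_nonneg
    (sub_nonpos.mpr (mul_cosh_mul_sinh_le_sinh_mul_cosh h0 h1 hs.le)) (sq_nonneg _)

lemma one_add_sq_div_two_le_cosh (s : ℝ) : 1 + s ^ 2 / 2 ≤ Real.cosh s := by
  have hsinh : |s / 2| ≤ Real.sinh |s / 2| := Real.self_le_sinh_iff.mpr (abs_nonneg _)
  have hdouble := Real.cosh_two_mul |s / 2|
  rw [Real.cosh_sq, abs_div, abs_two, mul_div_cancel₀ _ (two_ne_zero' ℝ), Real.cosh_abs] at hdouble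
  rw [abs_div, abs_two] at hsinh
  nlinarith [sq_abs s, abs_nonneg s]

lemma cosh_sub_pos {c s : ℝ} (hc : c ≤ 1) (hs : 0 < s) : 0 < Real.cosh s - c := by
  linarith [Real.one_lt_cosh.mpr hs.ne']

lemma antitoneOn_inv_cosh_sub {c : ℝ} (hc : c ≤ 1) :
    AntitoneOn (fun s => (Real.cosh s - c)⁻¹) (Ioi 0) := by
  intro s hs t ht hst
  refine inv_anti₀ (cosh_sub_pos hc hs) (sub_le_sub_right (Real.cosh_le_cosh.mpr ?_) c)
  rwa [abs_of_pos hs, abs_of_pos ht]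

/-! ### The weights of the diffractive kernel -/

namespace DecayingWeight

variable {w v : ℝ → ℝ} {H I A : ℝ}

lemma mono {H' I' : ℝ} (hw : DecayingWeight w H I) (hH : H ≤ H') (hI : I ≤ I') :
    DecayingWeight w H' I' :=
  ⟨hw.integrableOn, hw.antitoneOn, hw.nonneg, fun s hs => (hw.le s hs).trans hH,
    hw.integral_le.trans hI⟩

lemma mul (hw : DecayingWeight w H I) (hv : AntitoneOn v (Ioi 0)) (hv0 : ∀ s, 0 < s → 0 ≤ v s)
    (hvA : ∀ s, 0 < s → v s ≤ A) : DecayingWeight (fun s => w s * v s) (H * A) (I * A) := by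
  have hA : 0 ≤ A := (hv0 1 one_pos).trans (hvA 1 one_pos)
  refine of_le (hw.integrableOn.mul_const A) ?_ ?_
    (fun s hs => mul_nonneg (hw.nonneg s hs) (hv0 s hs))
    (fun s hs => mul_le_mul (hw.le s hs) (hvA s hs) (hv0 s hs) hw.bound_nonneg)
    (fun s hs => mul_le_mul_of_nonneg_left (hvA s hs) (hw.nonneg s hs))
  · rw [integral_mul_const]
    exact mul_le_mul_of_nonneg_right hw.integral_le hA
  · intro s hs t ht hst
    exact mul_le_mul (hw.antitoneOn hs ht hst) (hv hs ht hst) (hv0 t ht) (hw.nonneg s hs)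

end DecayingWeight

lemma decayingWeight_exp {b : ℝ} (hb : 0 < b) :
    DecayingWeight (fun s => Real.exp (-b * s)) 1 (1 / b) where
  integrableOn := integrableOn_exp_mul_Ioi (by linarith) 0
  antitoneOn s _ t _ hst := Real.exp_le_exp.mpr (by nlinarith)
  nonneg s _ := (Real.exp_pos _).le
  le s hs := Real.exp_le_one_iff.mpr (by nlinarith)
  integral_le := by
    rw [integral_exp_mul_Ioi (by linarith)]
    simp

lemma DecayingWeight.of_le_two_mul_exp {w : ℝ → ℝ} {H b : ℝ} (hb : 0 < b)
    (hanti : AntitoneOn w (Ioi 0)) (h0 : ∀ s, 0 < s → 0 ≤ w s) (hH : ∀ s, 0 < s → w s ≤ H)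
    (hle : ∀ s, 0 < s → w s ≤ 2 * Real.exp (-b * s)) : DecayingWeight w H (2 / b) := by
  refine of_le ((decayingWeight_exp hb).integrableOn.const_mul 2) ?_ hanti h0 hH hle
  rw [integral_const_mul, div_eq_mul_one_div]
  exact mul_le_mul_of_nonneg_left (decayingWeight_exp hb).integral_le two_pos.le

lemma decayingWeight_cosh_div_cosh {α : ℝ} (hα : |α| < 1) :
    DecayingWeight (fun s => Real.cosh (α * s) / Real.cosh s) 1 (2 / (1 - |α|)) :=
  .of_le_two_mul_exp (sub_pos.mpr hα)
    ((antitoneOn_cosh_div_cosh hα.le).mono Ioi_subset_Ici_self)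
    (fun _ _ => div_nonneg (Real.cosh_pos _).le (Real.cosh_pos _).le)
    (fun s _ => cosh_div_cosh_le_one hα.le s) (fun _ hs => cosh_div_cosh_le_exp hs.le)

lemma decayingWeight_sinh_div_sinh {α : ℝ} (h0 : 0 ≤ α) (h1 : α < 1) :
    DecayingWeight (fun s => Real.sinh (α * s) / Real.sinh s) 1 (2 / (1 - α)) := by
  have hle := fun s (hs : 0 < s) => sinh_div_sinh_le_cosh_div_cosh h1.le hs
  refine .of_le_two_mul_exp (sub_pos.mpr h1) (antitoneOn_sinh_div_sinh h0 h1.le)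
    (fun s hs => div_nonneg (Real.sinh_nonneg_iff.mpr (by positivity))
      (Real.sinh_nonneg_iff.mpr hs.le))
    (fun s hs => (hle s hs).trans (cosh_div_cosh_le_one ((abs_of_nonneg h0).trans_le h1.le) s))
    (fun s hs => (hle s hs).trans ?_)
  simpa only [abs_of_nonneg h0] using cosh_div_cosh_le_exp (α := α) hs.le

lemma decayingWeight_exp_mul_cosh {α : ℝ} (hα : |α| < 1) {n : ℕ} (hn : n ≠ 0) :
    DecayingWeight (fun s => Real.exp (-(n : ℝ) * s) * Real.cosh (α * s)) 1 (2 / (1 - |α|)) := by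
  have hn1 : (1 : ℝ) ≤ n := by exact_mod_cast Nat.one_le_iff_ne_zero.mpr hn
  have hsplit : ∀ s, Real.exp (-(n : ℝ) * s) * Real.cosh (α * s)
      = (Real.exp (-(n - α) * s) + Real.exp (-(n + α) * s)) / 2 := by
    intro s
    rw [Real.cosh_eq, mul_div_assoc', mul_add, ← Real.exp_add, ← Real.exp_add]
    ring_nf
  obtain ⟨hα₁, hα₂⟩ := abs_lt.mp hα
  have hle : ∀ s, 0 < s → Real.exp (-(n : ℝ) * s) * Real.cosh (α * s)
      ≤ Real.exp (-(1 - |α|) * s) := by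
    intro s hs
    calc _ ≤ Real.exp (-(1 : ℝ) * s) * Real.exp (|α| * s) := by
          gcongr
          exact cosh_mul_le_exp hs.le
      _ = _ := by rw [← Real.exp_add]; ring_nf
  refine .of_le_two_mul_exp (sub_pos.mpr hα) (fun s _ t _ hst => ?_)
    (fun s _ => mul_nonneg (Real.exp_pos _).le (Real.cosh_pos _).le)
    (fun s hs => (hle s hs).trans (Real.exp_le_one_iff.mpr (by nlinarith)))
    (fun s hs => (hle s hs).trans (by linarith [Real.exp_pos (-(1 - |α|) * s)]))
  simp only [hsplit]
  have hexp : ∀ u : ℝ, 0 ≤ u → Real.exp (-u * t) ≤ Real.exp (-u * s) := fun u hu =>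
    Real.exp_le_exp.mpr (by nlinarith)
  linarith [hexp (n - α) (by linarith), hexp (n + α) (by linarith)]

/-- Weights on `(0, ∞)` of the form `c₁ w₁ + c₂ w₂` with `|c₁|, |c₂| ≤ 1` and `w₁`, `w₂`
nonincreasing, with values in `[0, H]` and integral at most `I`. The weights of the diffractive
kernel are of this form although they need be neither monotone nor positive. -/
structure DecayingCombination (w : ℝ → ℝ) (H I : ℝ) : Prop where
  exists_eq : ∃ (c₁ c₂ : ℝ) (w₁ w₂ : ℝ → ℝ), |c₁| ≤ 1 ∧ |c₂| ≤ 1 ∧ DecayingWeight w₁ H I ∧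
    DecayingWeight w₂ H I ∧ ∀ s, 0 < s → w s = c₁ * w₁ s + c₂ * w₂ s

lemma DecayingWeight.decayingCombination {w : ℝ → ℝ} {H I : ℝ} (hw : DecayingWeight w H I) :
    DecayingCombination w H I :=
  ⟨1, 0, w, w, by simp, by simp, hw, hw, fun s _ => by ring⟩

namespace DecayingCombination

variable {w : ℝ → ℝ} {H I : ℝ}

lemma integrableOn (hw : DecayingCombination w H I) : IntegrableOn w (Ioi 0) := by
  obtain ⟨c₁, c₂, w₁, w₂, -, -, hw₁, hw₂, heq⟩ := hw.exists_eq
  exact IntegrableOn.congr_fun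
    ((hw₁.integrableOn.const_mul c₁).add (hw₂.integrableOn.const_mul c₂))
    (fun s hs => (heq s hs).symm) measurableSet_Ioi

lemma integral_abs_le (hw : DecayingCombination w H I) : ∫ s in Ioi (0 : ℝ), |w s| ≤ 2 * I := by
  have hint := hw.integrableOn
  obtain ⟨c₁, c₂, w₁, w₂, hc₁, hc₂, hw₁, hw₂, heq⟩ := hw.exists_eq
  calc ∫ s in Ioi (0 : ℝ), |w s| ≤ ∫ s in Ioi (0 : ℝ), (w₁ s + w₂ s) := by
        refine setIntegral_mono_on hint.abs (hw₁.integrableOn.add hw₂.integrableOn)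
          measurableSet_Ioi fun s hs => ?_
        have h₁ := mul_le_of_le_one_left (hw₁.nonneg s hs) hc₁
        have h₂ := mul_le_of_le_one_left (hw₂.nonneg s hs) hc₂
        rw [heq s hs]
        refine (abs_add_le _ _).trans ?_
        rw [abs_mul, abs_mul, abs_of_nonneg (hw₁.nonneg s hs), abs_of_nonneg (hw₂.nonneg s hs)]
        exact add_le_add h₁ h₂
    _ ≤ 2 * I := by
        rw [integral_add hw₁.integrableOn hw₂.integrableOn, two_mul]
        exact add_le_add hw₁.integral_le hw₂.integral_le

end DecayingCombination

/-! ### Pointwise bounds for the oscillatory integrals -/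

namespace SymbolBound

variable {μ C r₁ r₂ : ℝ} {B : ℝ → ℂ} {w : ℝ → ℝ} {H I : ℝ}

lemma norm_oscIntegral_le_of_decayingCombination (hB : SymbolBound μ C B) (hμ : 0 ≤ μ)
    (h₁ : 0 < r₁) (h₂ : 0 < r₂) (hw : DecayingCombination w H I) :
    ‖oscIntegral B r₁ r₂ w‖ ≤ C * (1 + (r₁ + r₂)) ^ (-μ) * (2 * I) := by
  have hC := hB.pos
  have : 0 < (1 + (r₁ + r₂)) ^ (-μ) := Real.rpow_pos_of_pos (by linarith) _
  refine (hB.norm_oscIntegral_le_integral_abs hμ h₁ h₂ hw.integrableOn).trans ?_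
  gcongr
  exact hw.integral_abs_le

lemma norm_oscIntegral_le_decay_of_decayingCombination (hB : SymbolBound μ C B) (hμ : 0 ≤ μ)
    (h₁ : 0 < r₁) (h₂ : 0 < r₂) (hw : DecayingCombination w H I) :
    ‖oscIntegral B r₁ r₂ w‖ ≤
      C * (1 + (r₁ + r₂)) ^ (-μ) * (1 + min r₁ r₂) ^ (-(1 / 2) : ℝ) * (36 * (H + I)) := by
  obtain ⟨c₁, c₂, w₁, w₂, hc₁, hc₂, hw₁, hw₂, heq⟩ := hw.exists_eq
  have hsplit : oscIntegral B r₁ r₂ w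
      = c₁ * oscIntegral B r₁ r₂ w₁ + c₂ * oscIntegral B r₁ r₂ w₂ := by
    simp only [oscIntegral]
    rw [← integral_const_mul, ← integral_const_mul, ← integral_add
      ((hB.integrableOn_oscFactor_mul hμ h₁ h₂ hw₁.integrableOn).const_mul _)
      ((hB.integrableOn_oscFactor_mul hμ h₁ h₂ hw₂.integrableOn).const_mul _)]
    refine setIntegral_congr_fun measurableSet_Ioi fun s hs => ?_
    simp only [heq s hs]
    push_cast
    ring
  rw [hsplit]
  refine (norm_add_le _ _).trans ?_
  rw [norm_mul, norm_mul, Complex.norm_real, Complex.norm_real, Real.norm_eq_abs,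
    Real.norm_eq_abs]
  calc _ ≤ ‖oscIntegral B r₁ r₂ w₁‖ + ‖oscIntegral B r₁ r₂ w₂‖ :=
        add_le_add (mul_le_of_le_one_left (norm_nonneg _) hc₁)
          (mul_le_of_le_one_left (norm_nonneg _) hc₂)
    _ ≤ _ := add_le_add (hB.norm_oscIntegral_le hμ h₁ h₂ hw₁)
        (hB.norm_oscIntegral_le hμ h₁ h₂ hw₂)
    _ = _ := by ring

end SymbolBound

lemma diffWeight_two_eq (α θ : ℝ) {s : ℝ} (hs : 0 < s) :
    diffWeight α θ s 2 =
      SignType.sign α * (Real.sinh (|α| * s) / Real.sinh s * ((1 - Real.cos (θ + Real.pi))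
        + (1 - Real.cos (θ + Real.pi) ^ 2) * (Real.cosh s - Real.cos (θ + Real.pi))⁻¹))
      + -SignType.sign α * (Real.sinh (|α| * s) / Real.sinh s * (1 + Real.exp (-s))) := by
  have hsign : Real.sinh (α * s) = SignType.sign α * Real.sinh (|α| * s) := by
    rcases lt_trichotomy α 0 with h | rfl | h
    · simp [h, abs_of_neg]
    · simp
    · simp [h, abs_of_pos]
  simp only [diffWeight]
  rw [hsign]
  set c := Real.cos (θ + Real.pi)
  have hcosh : Real.cosh s - c ≠ 0 := (cosh_sub_pos (Real.cos_le_one _) hs).ne'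
  have hsinh : Real.sinh s ≠ 0 := (Real.sinh_pos_iff.mpr hs).ne'
  have hsq : Real.cosh s ^ 2 = 1 + Real.sinh s ^ 2 := by linarith [Real.cosh_sq s]
  rw [← Real.cosh_sub_sinh]
  field_simp
  linear_combination (SignType.sign α : ℝ) * Real.sinh (|α| * s) * hsq

lemma diffWeight_three_eq (α θ : ℝ) {s : ℝ} (hs : 0 < s) :
    diffWeight α θ s 3 = Real.sin (θ + Real.pi) * (Real.cosh (α * s) / Real.cosh s)
      + Real.cos (θ + Real.pi) * SignType.sign (Real.sin (θ + Real.pi))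
        * (|Real.sin (θ + Real.pi)| * (Real.cosh (α * s) / Real.cosh s
          * (Real.cosh s - Real.cos (θ + Real.pi))⁻¹)) := by
  have hne : Real.cosh s - Real.cos (θ + Real.pi) ≠ 0 :=
    (cosh_sub_pos (Real.cos_le_one _) hs).ne'
  have hcosh := (Real.cosh_pos s).ne'
  rw [mul_assoc, ← mul_assoc (SignType.sign _ : ℝ), sign_mul_abs]
  simp only [diffWeight]
  field_simp
  ring

lemma abs_sign_le_one (x : ℝ) : |(SignType.sign x : ℝ)| ≤ 1 := by
  rcases SignType.trichotomy (SignType.sign x) with h | h | h <;> simp [h]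

lemma decayingCombination_diffWeight_two {α : ℝ} (hα : |α| < 1) (θ : ℝ) :
    DecayingCombination (fun s => diffWeight α θ s 2) 2 (4 / (1 - |α|)) := by
  have hq := decayingWeight_sinh_div_sinh (abs_nonneg α) hα
  have hc := Real.cos_le_one (θ + Real.pi)
  have hc' := Real.neg_one_le_cos (θ + Real.pi)
  have hc2 : 0 ≤ 1 - Real.cos (θ + Real.pi) ^ 2 := by linarith [Real.cos_sq_le_one (θ + Real.pi)]
  refine ⟨SignType.sign α, -SignType.sign α, _, _, abs_sign_le_one α,
    (abs_neg _).trans_le (abs_sign_le_one α),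
    (hq.mul (A := 2) (fun s hs t ht hst => ?_) (fun s hs => ?_) fun s hs => ?_).mono (by norm_num)
      (by ring_nf; rfl),
    (hq.mul (A := 2) (fun s _ t _ hst => ?_) (fun s _ => ?_) fun s hs => ?_).mono (by norm_num)
      (by ring_nf; rfl), fun s hs => diffWeight_two_eq α θ hs⟩
  · exact add_le_add_right (mul_le_mul_of_nonneg_left (antitoneOn_inv_cosh_sub hc hs ht hst) hc2) _
  · exact add_nonneg (by linarith) (mul_nonneg hc2 (inv_pos.mpr (cosh_sub_pos hc hs)).le)
  · suffices (1 - Real.cos (θ + Real.pi) ^ 2) * (Real.cosh s - Real.cos (θ + Real.pi))⁻¹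
        ≤ 1 + Real.cos (θ + Real.pi) by linarith
    rw [← div_eq_mul_inv, div_le_iff₀ (cosh_sub_pos hc hs)]
    nlinarith [Real.one_le_cosh s]
  · exact add_le_add_right (Real.exp_le_exp.mpr (neg_le_neg hst)) _
  · positivity
  · linarith [Real.exp_le_one_iff.mpr (neg_nonpos.mpr hs.le)]

lemma cos_add_pi_eq (θ : ℝ) : Real.cos (θ + Real.pi) = 1 - 2 * Real.cos (θ / 2) ^ 2 := by
  rw [Real.cos_add_pi, Real.cos_sq, mul_div_cancel₀ _ (two_ne_zero' ℝ)]
  ring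

lemma abs_sin_add_pi_le (θ : ℝ) : |Real.sin (θ + Real.pi)| ≤ 2 * |Real.cos (θ / 2)| := by
  have hdouble := Real.sin_two_mul (θ / 2)
  rw [mul_div_cancel₀ _ (two_ne_zero' ℝ)] at hdouble
  rw [Real.sin_add_pi, abs_neg, hdouble, abs_mul, abs_mul, abs_two]
  exact mul_le_mul_of_nonneg_right
    (mul_le_of_le_one_right two_pos.le (Real.abs_sin_le_one _)) (abs_nonneg _)

lemma poisson_eq_comp_inv_mul {m : ℝ} (hm : m ≠ 0) (s : ℝ) :
    2 * m / (s ^ 2 + m ^ 2) = 2 * m⁻¹ * (1 + (m⁻¹ * s) ^ 2)⁻¹ := by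
  have : s ^ 2 + m ^ 2 ≠ 0 := by positivity
  have : 1 + (m⁻¹ * s) ^ 2 ≠ 0 := by positivity
  field_simp
  ring

lemma integrable_poisson {m : ℝ} (hm : m ≠ 0) :
    Integrable fun s : ℝ => 2 * m / (s ^ 2 + m ^ 2) := by
  simp only [poisson_eq_comp_inv_mul hm]
  exact (integrable_inv_one_add_sq.comp_mul_left' (inv_ne_zero hm)).const_mul _

lemma integral_poisson {m : ℝ} (hm : 0 < m) :
    ∫ s in Ioi (0 : ℝ), 2 * m / (s ^ 2 + m ^ 2) = Real.pi := by
  simp only [poisson_eq_comp_inv_mul hm.ne']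
  rw [integral_const_mul, integral_comp_mul_left_Ioi (fun x : ℝ => (1 + x ^ 2)⁻¹) 0
    (inv_pos.mpr hm), mul_zero, integral_Ioi_inv_one_add_sq, inv_inv, smul_eq_mul, Real.arctan_zero,
    sub_zero]
  field_simp

-- The majorant is the Poisson kernel of the half-plane at height `2 |cos (θ / 2)|`.
lemma sin_mul_cosh_div_le_poisson {α : ℝ} (hα : |α| ≤ 1) {θ : ℝ} (hθ : Real.cos (θ / 2) ≠ 0)
    {s : ℝ} (hs : 0 < s) :
    |Real.sin (θ + Real.pi)| * (Real.cosh (α * s) / Real.cosh s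
        * (Real.cosh s - Real.cos (θ + Real.pi))⁻¹)
      ≤ 2 * (2 * |Real.cos (θ / 2)|) / (s ^ 2 + (2 * |Real.cos (θ / 2)|) ^ 2) := by
  have : 0 < |Real.cos (θ / 2)| := abs_pos.mpr hθ
  have hden : (s ^ 2 + (2 * |Real.cos (θ / 2)|) ^ 2) / 2
      ≤ Real.cosh s - Real.cos (θ + Real.pi) := by
    rw [cos_add_pi_eq, mul_pow, sq_abs]
    linarith [one_add_sq_div_two_le_cosh s]
  calc _ ≤ 2 * |Real.cos (θ / 2)| * (1 * ((s ^ 2 + (2 * |Real.cos (θ / 2)|) ^ 2) / 2)⁻¹) := by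
        have := cosh_sub_pos (Real.cos_le_one (θ + Real.pi)) hs
        gcongr
        · exact abs_sin_add_pi_le θ
        · exact cosh_div_cosh_le_one hα s
    _ = _ := by field_simp

lemma decayingWeight_sin_mul_cosh_div {α : ℝ} (hα : |α| ≤ 1) {θ : ℝ} (hθ : Real.cos (θ / 2) ≠ 0) :
    DecayingWeight (fun s => |Real.sin (θ + Real.pi)| * (Real.cosh (α * s) / Real.cosh s
        * (Real.cosh s - Real.cos (θ + Real.pi))⁻¹)) (1 / |Real.cos (θ / 2)|) Real.pi := by
  have hκ : 0 < |Real.cos (θ / 2)| := abs_pos.mpr hθ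
  have hm : 0 < 2 * |Real.cos (θ / 2)| := by positivity
  have hq : ∀ s, 0 ≤ Real.cosh (α * s) / Real.cosh s := fun s =>
    div_nonneg (Real.cosh_pos _).le (Real.cosh_pos _).le
  have hden : ∀ s, 0 < s → 0 < (Real.cosh s - Real.cos (θ + Real.pi))⁻¹ :=
    fun s hs => inv_pos.mpr (cosh_sub_pos (Real.cos_le_one _) hs)
  refine .of_le (integrable_poisson hm.ne').integrableOn (integral_poisson hm).le
    (fun s hs t ht hst => mul_le_mul_of_nonneg_left ?_ (abs_nonneg _))
    (fun s hs => mul_nonneg (abs_nonneg _) (mul_nonneg (hq s) (hden s hs).le))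
    (fun s hs => (sin_mul_cosh_div_le_poisson hα hθ hs).trans ?_)
    fun s hs => sin_mul_cosh_div_le_poisson hα hθ hs
  · exact mul_le_mul
      (antitoneOn_cosh_div_cosh hα (Ioi_subset_Ici_self hs) (Ioi_subset_Ici_self ht) hst)
      (antitoneOn_inv_cosh_sub (Real.cos_le_one _) hs ht hst) (hden t ht).le (hq s)
  · rw [div_le_div_iff₀ (by positivity) hκ]
    nlinarith [sq_nonneg s]

lemma decayingCombination_diffWeight_three {α : ℝ} (hα : |α| < 1) {θ : ℝ}
    (hθ : Real.cos (θ / 2) ≠ 0) :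
    DecayingCombination (fun s => diffWeight α θ s 3) (1 / |Real.cos (θ / 2)|)
      (2 / (1 - |α|) + Real.pi) := by
  have hI : 0 ≤ 2 / (1 - |α|) := div_nonneg two_pos.le (by linarith)
  refine ⟨_, _, _, _, Real.abs_sin_le_one _, ?_,
    (decayingWeight_cosh_div_cosh hα).mono ?_ (by linarith [Real.pi_pos]),
    (decayingWeight_sin_mul_cosh_div hα.le hθ).mono le_rfl (by linarith),
    fun s hs => diffWeight_three_eq α θ hs⟩
  · rw [abs_mul]
    exact mul_le_one₀ (Real.abs_cos_le_one _) (abs_nonneg _) (abs_sign_le_one _)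
  · exact (one_le_div (abs_pos.mpr hθ)).mpr (Real.abs_cos_le_one _)

lemma diffWeight_three_eq_zero (α : ℝ) {θ : ℝ} (hθ : Real.cos (θ / 2) = 0) (s : ℝ) :
    diffWeight α θ s 3 = 0 := by
  have hsin := abs_sin_add_pi_le θ
  rw [hθ, abs_zero, mul_zero, abs_nonpos_iff] at hsin
  simp [diffWeight, hsin]

/-- A common bound for the heights and the integrals of the three weights; for the third one the
height is only controlled after multiplication by `|cos (θ / 2)|`. -/
def weightBound (α : ℝ) : ℝ :=
  1 + 4 / (1 - |α|) + 1 / |α| + Real.pi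

lemma weightBound_pos {α : ℝ} (hα : |α| ≤ 1) : 0 < weightBound α := by
  have := Real.pi_pos
  have : 0 ≤ 1 - |α| := by linarith
  unfold weightBound
  positivity

lemma exists_decayingCombination_diffWeight {α : ℝ} (hα : |α| < 1) (hα0 : α ≠ 0) (θ : ℝ) {ℓ : ℕ}
    (hℓ : ℓ ∈ Icc (1 : ℕ) 3) :
    ∃ H I, DecayingCombination (fun s => diffWeight α θ s ℓ) H I ∧ I ≤ weightBound α ∧
      |Real.cos (θ / 2)| * (H + I) ≤ weightBound α ∧ (ℓ ≠ 3 → H + I ≤ weightBound α) := by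
  have hπ := Real.pi_gt_three
  have hκ := Real.abs_cos_le_one (θ / 2)
  have hα1 : 0 < 1 / |α| := one_div_pos.mpr (abs_pos.mpr hα0)
  have hI : 0 < 1 / (1 - |α|) := one_div_pos.mpr (by linarith)
  have h4 : 4 / (1 - |α|) = 4 * (1 / (1 - |α|)) := by ring
  have h2 : 2 / (1 - |α|) = 2 * (1 / (1 - |α|)) := by ring
  have hcos : ∀ {x : ℝ}, 0 ≤ x → x ≤ weightBound α → |Real.cos (θ / 2)| * x ≤ weightBound α :=
    fun hx hle => (mul_le_of_le_one_left hx hκ).trans hle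
  obtain ⟨hℓ1, hℓ3⟩ := hℓ
  interval_cases ℓ
  · have hle : 1 + 1 / |α| ≤ weightBound α := by unfold weightBound; linarith
    exact ⟨_, _, (decayingWeight_exp (abs_pos.mpr hα0)).decayingCombination, by linarith,
      hcos (by positivity) hle, fun _ => hle⟩
  · have hle : 2 + 4 / (1 - |α|) ≤ weightBound α := by unfold weightBound; linarith
    exact ⟨_, _, decayingCombination_diffWeight_two hα θ, by linarith, hcos (by linarith) hle,
      fun _ => hle⟩
  · by_cases hθ : Real.cos (θ / 2) = 0
    · have hpos := weightBound_pos hα.le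
      have hzero : DecayingWeight (fun s => diffWeight α θ s 3) 0 0 := by
        simp only [diffWeight_three_eq_zero α hθ]
        exact ⟨integrableOn_zero, antitoneOn_const, fun _ _ => le_rfl, fun _ _ => le_rfl, by simp⟩
      exact ⟨0, 0, hzero.decayingCombination, hpos.le, by simpa using hpos.le, by simp⟩
    · refine ⟨_, _, decayingCombination_diffWeight_three hα hθ, ?_, ?_, by simp⟩
      · unfold weightBound
        linarith
      · have hle := mul_le_of_le_one_left (b := 2 / (1 - |α|) + Real.pi) (by linarith) hκ
        rw [mul_add, mul_one_div_cancel (abs_ne_zero.mpr hθ)]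
        unfold weightBound
        linarith

lemma integrableOn_diffWeight {α : ℝ} (hα : |α| < 1) (hα0 : α ≠ 0) (θ : ℝ) {ℓ : ℕ}
    (hℓ : ℓ ∈ Icc (1 : ℕ) 3) : IntegrableOn (fun s => diffWeight α θ s ℓ) (Ioi 0) := by
  obtain ⟨_, _, hw, -⟩ := exists_decayingCombination_diffWeight hα hα0 θ hℓ
  exact hw.integrableOn

namespace SymbolBound

variable {μ C r₁ r₂ α : ℝ} {B : ℝ → ℂ} {ℓ : ℕ}

theorem norm_oscIntegral_diffWeight_le (hB : SymbolBound μ C B) (hμ : 0 ≤ μ) (hα : |α| < 1)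
    (hα0 : α ≠ 0) (h₁ : 0 < r₁) (h₂ : 0 < r₂) (θ : ℝ) (hℓ : ℓ ∈ Icc (1 : ℕ) 3) :
    ‖oscIntegral B r₁ r₂ fun s => diffWeight α θ s ℓ‖
      ≤ C * (1 + (r₁ + r₂)) ^ (-μ) * (2 * weightBound α) := by
  obtain ⟨H, I, hw, hI, -⟩ := exists_decayingCombination_diffWeight hα hα0 θ hℓ
  have hC := hB.pos
  have : 0 < (1 + (r₁ + r₂)) ^ (-μ) := Real.rpow_pos_of_pos (by linarith) _
  exact (hB.norm_oscIntegral_le_of_decayingCombination hμ h₁ h₂ hw).trans (by gcongr)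

theorem norm_oscIntegral_diffWeight_le_decay (hB : SymbolBound μ C B) (hμ : 0 ≤ μ) (hα : |α| < 1)
    (hα0 : α ≠ 0) (h₁ : 0 < r₁) (h₂ : 0 < r₂) (θ : ℝ) (hℓ : ℓ ∈ Icc (1 : ℕ) 3) (hℓ3 : ℓ ≠ 3) :
    ‖oscIntegral B r₁ r₂ fun s => diffWeight α θ s ℓ‖
      ≤ C * (1 + (r₁ + r₂)) ^ (-μ) * (1 + min r₁ r₂) ^ (-(1 / 2) : ℝ) * (36 * weightBound α) := by
  obtain ⟨H, I, hw, -, -, hHI⟩ := exists_decayingCombination_diffWeight hα hα0 θ hℓ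
  have hC := hB.pos
  have : 0 < (1 + (r₁ + r₂)) ^ (-μ) := Real.rpow_pos_of_pos (by linarith) _
  have : 0 < (1 + min r₁ r₂) ^ (-(1 / 2) : ℝ) :=
    Real.rpow_pos_of_pos (by linarith [lt_min h₁ h₂]) _
  refine (hB.norm_oscIntegral_le_decay_of_decayingCombination hμ h₁ h₂ hw).trans ?_
  gcongr
  exact hHI hℓ3

theorem abs_cos_mul_norm_oscIntegral_diffWeight_le (hB : SymbolBound μ C B) (hμ : 0 ≤ μ)
    (hα : |α| < 1) (hα0 : α ≠ 0) (h₁ : 0 < r₁) (h₂ : 0 < r₂) (θ : ℝ) (hℓ : ℓ ∈ Icc (1 : ℕ) 3) :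
    |Real.cos (θ / 2)| * ‖oscIntegral B r₁ r₂ fun s => diffWeight α θ s ℓ‖
      ≤ C * (1 + (r₁ + r₂)) ^ (-μ) * (1 + min r₁ r₂) ^ (-(1 / 2) : ℝ) * (36 * weightBound α) := by
  obtain ⟨H, I, hw, -, hHI, -⟩ := exists_decayingCombination_diffWeight hα hα0 θ hℓ
  have hC := hB.pos
  have : 0 < (1 + (r₁ + r₂)) ^ (-μ) := Real.rpow_pos_of_pos (by linarith) _
  have : 0 < (1 + min r₁ r₂) ^ (-(1 / 2) : ℝ) :=
    Real.rpow_pos_of_pos (by linarith [lt_min h₁ h₂]) _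
  calc _ ≤ |Real.cos (θ / 2)| * (C * (1 + (r₁ + r₂)) ^ (-μ) * (1 + min r₁ r₂) ^ (-(1 / 2) : ℝ)
          * (36 * (H + I))) := by
        gcongr
        exact hB.norm_oscIntegral_le_decay_of_decayingCombination hμ h₁ h₂ hw
    _ = C * (1 + (r₁ + r₂)) ^ (-μ) * (1 + min r₁ r₂) ^ (-(1 / 2) : ℝ)
          * (36 * (|Real.cos (θ / 2)| * (H + I))) := by ring
    _ ≤ _ := by gcongr

end SymbolBound

/-! ### Fourier coefficients of the third weight -/

lemma norm_exp_int_mul (k : ℤ) (θ : ℝ) : ‖Complex.exp ((k : ℂ) * Complex.I * θ)‖ = 1 := by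
  rw [show (k : ℂ) * Complex.I * θ = ((k * θ : ℝ) : ℂ) * Complex.I by push_cast; ring]
  exact Complex.norm_exp_ofReal_mul_I _

lemma integral_exp_int_mul (k : ℤ) :
    ∫ θ in (-Real.pi)..Real.pi, Complex.exp ((k : ℂ) * Complex.I * θ)
      = if k = 0 then 2 * (Real.pi : ℂ) else 0 := by
  split_ifs with h
  · simp only [h, Int.cast_zero, zero_mul, Complex.exp_zero, intervalIntegral.integral_const,
      sub_neg_eq_add, Complex.real_smul, mul_one]
    push_cast; ring
  · have hk : (k : ℂ) * Complex.I ≠ 0 := mul_ne_zero (by exact_mod_cast h) Complex.I_ne_zero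
    have hperiod : (k : ℂ) * Complex.I * (Real.pi : ℝ)
        = (k : ℂ) * Complex.I * ((-Real.pi : ℝ) : ℂ) + (k : ℂ) * (2 * Real.pi * Complex.I) := by
      push_cast; ring
    rw [integral_exp_mul_complex hk, hperiod, Complex.exp_add,
      Complex.exp_int_mul_two_pi_mul_I, mul_one, sub_self, zero_div]

lemma integral_sin_mul_exp (k n : ℤ) :
    ∫ θ in (-Real.pi)..Real.pi,
        (Real.sin (k * θ) : ℂ) * Complex.exp (((-n : ℤ) : ℂ) * Complex.I * θ)
      = Complex.I * Real.pi * ((if k = -n then 1 else 0) - if k = n then 1 else 0) := by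
  have hsin : ∀ θ : ℝ, (Real.sin (k * θ) : ℂ) * Complex.exp (((-n : ℤ) : ℂ) * Complex.I * θ)
      = Complex.I / 2 * (Complex.exp (((-k - n : ℤ) : ℂ) * Complex.I * θ)
        - Complex.exp (((k - n : ℤ) : ℂ) * Complex.I * θ)) := fun θ => by
    rw [show (((-k - n : ℤ) : ℂ) * Complex.I * θ)
        = -(k * θ) * Complex.I + ((-n : ℤ) : ℂ) * Complex.I * θ by push_cast; ring,
      show (((k - n : ℤ) : ℂ) * Complex.I * θ)
        = k * θ * Complex.I + ((-n : ℤ) : ℂ) * Complex.I * θ by push_cast; ring,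
      Complex.exp_add, Complex.exp_add, Complex.ofReal_sin, Complex.sin]
    push_cast; ring
  have hint : ∀ m : ℤ, IntervalIntegrable (fun θ : ℝ => Complex.exp ((m : ℂ) * Complex.I * θ))
      volume (-Real.pi) Real.pi := fun m => Continuous.intervalIntegrable (by fun_prop) _ _
  simp_rw [hsin]
  rw [intervalIntegral.integral_const_mul, intervalIntegral.integral_sub (hint _) (hint _),
    integral_exp_int_mul, integral_exp_int_mul]
  simp only [show (-k - n = 0) ↔ k = -n by omega, sub_eq_zero]
  split_ifs <;> ring

-- The conjugate Poisson kernel is `2 Im (z / (1 - z))` for `z = -e ^ (-s + i θ)`.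
lemma hasSum_conjPoisson {s : ℝ} (hs : 0 < s) (θ : ℝ) :
    HasSum (fun m : ℕ => 2 * (-Real.exp (-s)) ^ (m + 1) * Real.sin ((m + 1 : ℕ) * θ))
      (Real.sin (θ + Real.pi) / (Real.cosh s - Real.cos (θ + Real.pi))) := by
  set z : ℂ := ((-Real.exp (-s) : ℝ) : ℂ) * Complex.exp (θ * Complex.I) with hz
  have hz1 : ‖z‖ < 1 := by
    rw [hz, norm_mul, Complex.norm_exp_ofReal_mul_I, mul_one, Complex.norm_real, norm_neg,
      Real.norm_of_nonneg (Real.exp_pos _).le]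
    exact Real.exp_lt_one_iff.mpr (neg_lt_zero.mpr hs)
  have hre : z.re = -Real.exp (-s) * Real.cos θ := by
    rw [hz, Complex.re_ofReal_mul, Complex.exp_ofReal_mul_I_re]
  have him : z.im = -Real.exp (-s) * Real.sin θ := by
    rw [hz, Complex.im_ofReal_mul, Complex.exp_ofReal_mul_I_im]
  have hpow : ∀ m : ℕ,
      (z * z ^ m).im = (-Real.exp (-s)) ^ (m + 1) * Real.sin ((m + 1 : ℕ) * θ) := by
    intro m
    rw [← pow_succ', hz, mul_pow, ← Complex.ofReal_pow, ← Complex.exp_nat_mul,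
      Complex.im_ofReal_mul, ← mul_assoc, ← Complex.ofReal_natCast, ← Complex.ofReal_mul,
      Complex.exp_ofReal_mul_I_im]
  have hsum := (Complex.hasSum_im
    ((hasSum_geometric_of_norm_lt_one hz1).mul_left z)).mul_left 2
  simp only [hpow, ← mul_assoc] at hsum
  convert! hsum using 1
  have hcosh : Real.cosh s = (Real.exp s + Real.exp (-s)) / 2 := Real.cosh_eq s
  have hprod : Real.exp s * Real.exp (-s) = 1 := by
    rw [← Real.exp_add, add_neg_cancel, Real.exp_zero]
  have hdist : Complex.normSq (1 - z)
      = 2 * Real.exp (-s) * (Real.cosh s - Real.cos (θ + Real.pi)) := by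
    rw [Complex.normSq_apply, Complex.sub_re, Complex.sub_im, Complex.one_re, Complex.one_im, hre,
      him, Real.cos_add_pi, hcosh]
    linear_combination Real.exp (-s) ^ 2 * Real.sin_sq_add_cos_sq θ - hprod
  have hpos := cosh_sub_pos (Real.cos_le_one (θ + Real.pi)) hs
  rw [Complex.mul_im, Complex.inv_re, Complex.inv_im, hdist, Complex.sub_re, Complex.sub_im,
    Complex.one_re, Complex.one_im, hre, him, Real.sin_add_pi]
  field_simp
  ring

lemma hasSum_integral_conjPoisson_mul_exp {s : ℝ} (hs : 0 < s) (n : ℤ) :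
    HasSum (fun m : ℕ => 2 * Real.pi * Complex.I * (-(Real.exp (-s) : ℂ)) ^ (m + 1)
        * ((if ((m + 1 : ℕ) : ℤ) = -n then 1 else 0) - if ((m + 1 : ℕ) : ℤ) = n then 1 else 0))
      (∫ θ in (-Real.pi)..Real.pi,
        ((Real.sin (θ + Real.pi) / (Real.cosh s - Real.cos (θ + Real.pi)) : ℝ) : ℂ)
          * Complex.exp (((-n : ℤ) : ℂ) * Complex.I * θ)) := by
  let F : ℕ → ℝ → ℂ := fun m θ =>
    ((2 * (-Real.exp (-s)) ^ (m + 1) * Real.sin ((m + 1 : ℕ) * θ) : ℝ) : ℂ)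
      * Complex.exp (((-n : ℤ) : ℂ) * Complex.I * θ)
  have hF : ∀ m θ, ‖F m θ‖ ≤ 2 * Real.exp (-s) ^ (m + 1) := by
    intro m θ
    simp only [F]
    rw [norm_mul, norm_exp_int_mul, mul_one, Complex.norm_real, norm_mul, norm_mul, norm_pow,
      norm_neg, Real.norm_of_nonneg (Real.exp_pos _).le, Real.norm_ofNat, Real.norm_eq_abs]
    exact mul_le_of_le_one_right (by positivity) (Real.abs_sin_le_one _)
  have hgeom : Summable fun m : ℕ => 2 * Real.exp (-s) ^ (m + 1) :=
    ((summable_nat_add_iff 1).mpr (summable_geometric_of_lt_one (Real.exp_pos _).le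
      (Real.exp_lt_one_iff.mpr (neg_lt_zero.mpr hs)))).mul_left 2
  have hsum := intervalIntegral.hasSum_integral_of_dominated_convergence
    (a := -Real.pi) (b := Real.pi) (μ := volume) (F := F)
    (fun m _ => 2 * Real.exp (-s) ^ (m + 1))
    (fun m => Continuous.aestronglyMeasurable (by fun_prop))
    (fun m => Filter.Eventually.of_forall fun θ _ => hF m θ)
    (Filter.Eventually.of_forall fun θ _ => hgeom) _root_.intervalIntegrable_const
    (Filter.Eventually.of_forall fun θ _ =>
      (Complex.hasSum_ofReal.mpr (hasSum_conjPoisson hs θ)).mul_right _)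
  refine hsum.congr_fun fun m => ?_
  have hsin := integral_sin_mul_exp (m + 1 : ℕ) n
  rw [Int.cast_natCast] at hsin
  simp only [F, Complex.ofReal_mul, mul_assoc, intervalIntegral.integral_const_mul] at hsin ⊢
  rw [hsin]
  push_cast; ring

-- Only the mode `m + 1 = |n|` of the series survives.
lemma integral_conjPoisson_mul_exp {s : ℝ} (hs : 0 < s) (n : ℤ) :
    ∫ θ in (-Real.pi)..Real.pi,
      ((Real.sin (θ + Real.pi) / (Real.cosh s - Real.cos (θ + Real.pi)) : ℝ) : ℂ)
        * Complex.exp (((-n : ℤ) : ℂ) * Complex.I * θ)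
      = -(2 * Real.pi * Complex.I) * (-1) ^ n.natAbs * n.sign * Real.exp (-(n.natAbs : ℝ) * s) := by
  have hpow : ∀ k : ℕ, (-(Real.exp (-s) : ℂ)) ^ k = (-1) ^ k * Real.exp (-(k : ℝ) * s) := by
    intro k
    rw [neg_pow, ← Complex.ofReal_pow, ← Real.exp_nat_mul, neg_mul, mul_neg]
  refine (hasSum_integral_conjPoisson_mul_exp hs n).unique ?_
  rw [show -(2 * Real.pi * Complex.I) * (-1) ^ n.natAbs * n.sign * Real.exp (-(n.natAbs : ℝ) * s)
    = 2 * Real.pi * Complex.I * (-(Real.exp (-s) : ℂ)) ^ (n.natAbs - 1 + 1)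
      * ((if ((n.natAbs - 1 + 1 : ℕ) : ℤ) = -n then 1 else 0)
        - if ((n.natAbs - 1 + 1 : ℕ) : ℤ) = n then 1 else 0) from ?_]
  · refine hasSum_single _ fun m hm => ?_
    rw [if_neg (by omega), if_neg (by omega), sub_zero, mul_zero]
  · rcases lt_trichotomy n 0 with h | rfl | h
    · rw [Nat.sub_add_cancel (by omega), hpow, Int.sign_eq_neg_one_of_neg h, if_pos (by omega),
        if_neg (by omega)]
      push_cast; ring
    · simp
    · rw [Nat.sub_add_cancel (by omega), hpow, Int.sign_eq_one_of_pos h, if_neg (by omega),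
        if_pos (by omega)]
      push_cast; ring

lemma norm_coeff_conjPoisson_le (n : ℤ) :
    ‖-(2 * Real.pi * Complex.I) * (-1) ^ n.natAbs * n.sign‖ ≤ 2 * Real.pi := by
  have hsign : ‖((n.sign : ℤ) : ℂ)‖ ≤ 1 := by
    rcases lt_trichotomy n 0 with h | rfl | h
    · simp [Int.sign_eq_neg_one_of_neg h]
    · simp
    · simp [Int.sign_eq_one_of_pos h]
  rw [norm_mul, norm_mul, norm_neg, norm_mul, norm_mul, Complex.norm_I, norm_pow, norm_neg,
    norm_one, one_pow, Complex.norm_real, Real.norm_of_nonneg Real.pi_pos.le, Complex.norm_ofNat,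
    mul_one, mul_one]
  exact mul_le_of_le_one_right (by positivity) hsign

namespace SymbolBound

variable {μ C r₁ r₂ α : ℝ} {B : ℝ → ℂ}

lemma integrable_prod_oscFactor_mul_diffWeight_three (hB : SymbolBound μ C B) (hμ : 0 ≤ μ)
    (hα : |α| < 1) (hα0 : α ≠ 0) (h₁ : 0 < r₁) (h₂ : 0 < r₂) (n : ℤ) :
    Integrable (fun p : ℝ × ℝ => oscFactor B r₁ r₂ p.2 * (diffWeight α p.1 p.2 3 : ℂ)
        * Complex.exp (((-n : ℤ) : ℂ) * Complex.I * p.1))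
      ((volume.restrict (Ioc (-Real.pi) Real.pi)).prod (volume.restrict (Ioi 0))) := by
  have hosc := (hB.continuous_oscFactor h₁ h₂).measurable
  have hweight : Measurable fun p : ℝ × ℝ => diffWeight α p.1 p.2 3 := by
    simp only [diffWeight]; fun_prop
  have hmeas : Measurable (fun p : ℝ × ℝ => oscFactor B r₁ r₂ p.2 * (diffWeight α p.1 p.2 3 : ℂ)
      * Complex.exp (((-n : ℤ) : ℂ) * Complex.I * p.1)) := by fun_prop
  have hint : ∀ θ, IntegrableOn (fun s => diffWeight α θ s 3) (Ioi 0) := fun θ =>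
    integrableOn_diffWeight hα hα0 θ (by simp)
  rw [integrable_prod_iff hmeas.aestronglyMeasurable]
  refine ⟨Filter.Eventually.of_forall fun θ =>
    Integrable.mul_const (hB.integrableOn_oscFactor_mul hμ h₁ h₂ (hint θ))
      (Complex.exp (((-n : ℤ) : ℂ) * Complex.I * θ)), ?_⟩
  refine Integrable.mono' (g := fun _ => C * (1 + (r₁ + r₂)) ^ (-μ) * (2 * weightBound α))
    (integrable_const _) hmeas.norm.stronglyMeasurable.integral_prod_right'.aestronglyMeasurable
    (Filter.Eventually.of_forall fun θ => ?_)
  obtain ⟨H, I, hw, hI, -⟩ := exists_decayingCombination_diffWeight hα hα0 θ (ℓ := 3) (by simp)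
  have hpos : 0 ≤ C * (1 + (r₁ + r₂)) ^ (-μ) :=
    mul_nonneg hB.pos.le (Real.rpow_nonneg (by linarith) _)
  rw [Real.norm_of_nonneg (integral_nonneg fun s => norm_nonneg _)]
  calc _ ≤ ∫ s in Ioi (0 : ℝ), C * (1 + (r₁ + r₂)) ^ (-μ) * |diffWeight α θ s 3| := by
        refine integral_mono_of_nonneg (Filter.Eventually.of_forall fun s => norm_nonneg _)
          ((hint θ).norm.const_mul _) (Filter.Eventually.of_forall fun s => ?_)
        dsimp only
        rw [norm_mul, norm_exp_int_mul, mul_one, norm_mul, Complex.norm_real, Real.norm_eq_abs]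
        exact mul_le_mul_of_nonneg_right (hB.norm_oscFactor_le hμ h₁ h₂ s) (abs_nonneg _)
    _ ≤ _ := by
        rw [integral_const_mul]
        exact mul_le_mul_of_nonneg_left (hw.integral_abs_le.trans (by linarith)) hpos

lemma integral_oscIntegral_diffWeight_three_mul_exp (hB : SymbolBound μ C B) (hμ : 0 ≤ μ)
    (hα : |α| < 1) (hα0 : α ≠ 0) (h₁ : 0 < r₁) (h₂ : 0 < r₂) (n : ℤ) :
    ∫ θ in (-Real.pi)..Real.pi, oscIntegral B r₁ r₂ (fun s => diffWeight α θ s 3)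
        * Complex.exp (((-n : ℤ) : ℂ) * Complex.I * θ)
      = -(2 * Real.pi * Complex.I) * (-1) ^ n.natAbs * n.sign * oscIntegral B r₁ r₂
        (fun s => Real.exp (-(n.natAbs : ℝ) * s) * Real.cosh (α * s)) := by
  have hπ : -Real.pi ≤ Real.pi := by linarith [Real.pi_pos]
  simp only [intervalIntegral.integral_of_le hπ, oscIntegral, ← integral_mul_const]
  rw [integral_integral_swap
      (hB.integrable_prod_oscFactor_mul_diffWeight_three hμ hα hα0 h₁ h₂ n), ← integral_const_mul]
  refine setIntegral_congr_fun measurableSet_Ioi fun s hs => ?_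
  have hcoeff := integral_conjPoisson_mul_exp hs n
  rw [intervalIntegral.integral_of_le hπ] at hcoeff
  have hfactor : ∀ θ : ℝ, oscFactor B r₁ r₂ s * (diffWeight α θ s 3 : ℂ)
        * Complex.exp (((-n : ℤ) : ℂ) * Complex.I * θ)
      = oscFactor B r₁ r₂ s * Real.cosh (α * s) *
        (((Real.sin (θ + Real.pi) / (Real.cosh s - Real.cos (θ + Real.pi)) : ℝ) : ℂ)
          * Complex.exp (((-n : ℤ) : ℂ) * Complex.I * θ)) := fun θ => by
    simp only [diffWeight]
    push_cast; ring
  simp_rw [hfactor]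
  rw [integral_const_mul, hcoeff]
  push_cast; ring

/- The third weight is only bounded with a loss in the angle, but its Fourier coefficients are
decaying weights with uniform bounds. -/
theorem norm_integral_oscIntegral_diffWeight_three_le (hB : SymbolBound μ C B) (hμ : 0 ≤ μ)
    (hα : |α| < 1) (hα0 : α ≠ 0) (h₁ : 0 < r₁) (h₂ : 0 < r₂) (n : ℤ) :
    ‖∫ θ in (-Real.pi)..Real.pi, oscIntegral B r₁ r₂ (fun s => diffWeight α θ s 3)
        * Complex.exp (((-n : ℤ) : ℂ) * Complex.I * θ)‖
      ≤ C * (1 + (r₁ + r₂)) ^ (-μ) * (1 + min r₁ r₂) ^ (-(1 / 2) : ℝ)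
        * (36 * Real.pi * (1 + 2 / (1 - |α|))) := by
  rw [hB.integral_oscIntegral_diffWeight_three_mul_exp hμ hα hα0 h₁ h₂ n, norm_mul]
  have hbound : 0 ≤ C * (1 + (r₁ + r₂)) ^ (-μ) * (1 + min r₁ r₂) ^ (-(1 / 2) : ℝ)
      * (36 * Real.pi * (1 + 2 / (1 - |α|))) := by
    have hC := hB.pos
    have : 0 < 2 / (1 - |α|) := div_pos two_pos (by linarith)
    have : 0 < (1 + (r₁ + r₂)) ^ (-μ) := Real.rpow_pos_of_pos (by linarith) _
    have : 0 < (1 + min r₁ r₂) ^ (-(1 / 2) : ℝ) :=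
      Real.rpow_pos_of_pos (by linarith [lt_min h₁ h₂]) _
    positivity
  rcases eq_or_ne n 0 with rfl | hn
  · simpa using hbound
  · calc _ ≤ 2 * Real.pi * _ := mul_le_mul (norm_coeff_conjPoisson_le n)
          (hB.norm_oscIntegral_le hμ h₁ h₂
            (decayingWeight_exp_mul_cosh hα (Int.natAbs_ne_zero.mpr hn)))
          (norm_nonneg _) (by positivity)
      _ = _ := by ring

end SymbolBound

/-! ### Convolution on the circle -/

/-- Lebesgue measure on `(-π, π]`, which serves as the circle of angles. -/
def angularMeasure : Measure ℝ := volume.restrict (Ioc (-Real.pi) Real.pi)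

instance : IsFiniteMeasure angularMeasure := by unfold angularMeasure; infer_instance

lemma ae_angularMeasure_mem : ∀ᵐ φ ∂angularMeasure, φ ∈ Ioc (-Real.pi) Real.pi :=
  ae_restrict_mem measurableSet_Ioc

lemma neg_pi_lt_pi : -Real.pi < Real.pi := by linarith [Real.pi_pos]

lemma intervalIntegral_neg_pi_pi (f : ℝ → ℂ) :
    ∫ φ in (-Real.pi)..Real.pi, f φ = ∫ φ, f φ ∂angularMeasure :=
  intervalIntegral.integral_of_le neg_pi_lt_pi.le

lemma lintegral_Ioc_comp_sub {T : ℝ} (hT : 0 < T) {ψ : ℝ → ℝ≥0∞} (hψ : Function.Periodic ψ T)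
    (a θ : ℝ) : ∫⁻ φ in Ioc a (a + T), ψ (θ - φ) = ∫⁻ φ in Ioc a (a + T), ψ φ := by
  have : Fact (0 < T) := ⟨hT⟩
  have hlift : ∀ φ : ℝ, hψ.lift ((θ : AddCircle T) - (φ : AddCircle T)) = ψ (θ - φ) := fun φ => by
    rw [← AddCircle.coe_sub, hψ.lift_coe]
  have hreflect := AddCircle.lintegral_preimage T a fun x => hψ.lift ((θ : AddCircle T) - x)
  rw [lintegral_sub_left_eq_self, ← AddCircle.lintegral_preimage T a hψ.lift] at hreflect
  simpa only [hlift, hψ.lift_coe] using hreflect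

lemma lintegral_angularMeasure_comp_sub {ψ : ℝ → ℝ≥0∞}
    (hψ : Function.Periodic ψ (2 * Real.pi)) (θ : ℝ) :
    ∫⁻ φ, ψ (θ - φ) ∂angularMeasure = ∫⁻ φ, ψ φ ∂angularMeasure := by
  have h := lintegral_Ioc_comp_sub Real.two_pi_pos hψ (-Real.pi) θ
  rwa [show -Real.pi + 2 * Real.pi = Real.pi by ring] at h

lemma fourierCoeffOn_neg_pi_pi (f : ℝ → ℂ) (n : ℤ) :
    fourierCoeffOn neg_pi_lt_pi f n = (2 * Real.pi : ℝ)⁻¹ * ∫ θ in (-Real.pi)..Real.pi,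
      f θ * Complex.exp (((-n : ℤ) : ℂ) * Complex.I * θ) := by
  have : (Real.pi : ℂ) ≠ 0 := by exact_mod_cast Real.pi_ne_zero
  rw [fourierCoeffOn_eq_integral, show Real.pi - -Real.pi = 2 * Real.pi by ring, one_div,
    Complex.real_smul]
  congr 1
  refine intervalIntegral.integral_congr fun θ _ => ?_
  simp only [fourier_coe_apply, smul_eq_mul]
  rw [mul_comm]
  congr 2
  push_cast
  field_simp

lemma periodic_exp_int_mul (k : ℤ) :
    Function.Periodic (fun θ : ℝ => Complex.exp ((k : ℂ) * Complex.I * θ)) (2 * Real.pi) := by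
  intro θ
  have hshift : (k : ℂ) * Complex.I * ((θ + 2 * Real.pi : ℝ) : ℂ)
      = (k : ℂ) * Complex.I * θ + (k : ℂ) * (2 * Real.pi * Complex.I) := by push_cast; ring
  simp only [hshift, Complex.exp_add, Complex.exp_int_mul_two_pi_mul_I, mul_one]

lemma intervalIntegral_comp_sub_of_periodic {f : ℝ → ℂ} (hf : Function.Periodic f (2 * Real.pi))
    (φ : ℝ) :
    ∫ θ in (-Real.pi)..Real.pi, f (θ - φ) = ∫ θ in (-Real.pi)..Real.pi, f θ := by
  have h := hf.intervalIntegral_add_eq (-Real.pi - φ) (-Real.pi)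
  rw [intervalIntegral.integral_comp_sub_right f φ]
  rwa [show -Real.pi - φ + 2 * Real.pi = Real.pi - φ by ring,
    show -Real.pi + 2 * Real.pi = Real.pi by ring] at h

lemma lintegral_enorm_sq_eq_ofReal {X : Type*} [MeasurableSpace X] {μ : Measure X} {g : X → ℂ}
    (hg : MemLp g 2 μ) : ∫⁻ x, ‖g x‖ₑ ^ 2 ∂μ = ENNReal.ofReal (∫ x, ‖g x‖ ^ 2 ∂μ) := by
  rw [ofReal_integral_eq_lintegral_ofReal (hg.integrable_norm_pow two_ne_zero)
    (Filter.Eventually.of_forall fun x => by positivity)]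
  exact lintegral_congr fun x => by rw [ENNReal.ofReal_pow (norm_nonneg _), ofReal_norm]

section Convolution

variable {k F : ℝ → ℂ} {A M : ℝ}

lemma intervalIntegral_convolution_mul_exp (hk : Measurable k)
    (hper : Function.Periodic k (2 * Real.pi)) (hA : ∀ θ, ‖k θ‖ ≤ A)
    (hF : Integrable F angularMeasure) (n : ℤ) :
    ∫ θ in (-Real.pi)..Real.pi, (∫ φ, k (θ - φ) * F φ ∂angularMeasure)
        * Complex.exp (((-n : ℤ) : ℂ) * Complex.I * θ)
      = (∫ θ in (-Real.pi)..Real.pi, k θ * Complex.exp (((-n : ℤ) : ℂ) * Complex.I * θ))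
        * ∫ θ in (-Real.pi)..Real.pi, F θ * Complex.exp (((-n : ℤ) : ℂ) * Complex.I * θ) := by
  set e : ℝ → ℂ := fun θ => Complex.exp (((-n : ℤ) : ℂ) * Complex.I * θ) with he
  change (∫ θ in (-Real.pi)..Real.pi, (∫ φ, k (θ - φ) * F φ ∂angularMeasure) * e θ)
    = (∫ θ in (-Real.pi)..Real.pi, k θ * e θ) * ∫ θ in (-Real.pi)..Real.pi, F θ * e θ
  have hchar : ∀ θ φ : ℝ, e θ = e (θ - φ) * e φ := fun θ φ => by
    simp only [he]
    rw [← Complex.exp_add]; congr 1; push_cast; ring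
  have hmodulate : ∀ θ φ, k (θ - φ) * F φ * e θ = k (θ - φ) * e (θ - φ) * (F φ * e φ) :=
    fun θ φ => by rw [hchar θ φ]; ring
  have hint : Integrable (Function.uncurry fun θ φ => k (θ - φ) * F φ * e θ)
      (angularMeasure.prod angularMeasure) := by
    refine Integrable.mono' (g := fun p : ℝ × ℝ => A * ‖F p.2‖)
      ((hF.norm.const_mul A).comp_snd _) ?_ (Filter.Eventually.of_forall fun p => ?_)
    · have hF' : AEStronglyMeasurable (fun p : ℝ × ℝ => F p.2)
          (angularMeasure.prod angularMeasure) := hF.aestronglyMeasurable.comp_snd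
      exact ((by fun_prop : Measurable fun p : ℝ × ℝ => k (p.1 - p.2)).aestronglyMeasurable.mul
        hF').mul (by fun_prop : Measurable fun p : ℝ × ℝ => e p.1).aestronglyMeasurable
    · simp only [Function.uncurry]
      rw [norm_mul, norm_mul, norm_exp_int_mul, mul_one]
      exact mul_le_mul_of_nonneg_right (hA _) (norm_nonneg _)
  have hinner : ∀ θ, (∫ φ, k (θ - φ) * F φ ∂angularMeasure) * e θ
      = ∫ φ, k (θ - φ) * F φ * e θ ∂angularMeasure := fun θ => (integral_mul_const _ _).symm
  simp only [intervalIntegral_neg_pi_pi, hinner]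
  rw [integral_integral_swap hint, ← integral_const_mul]
  refine integral_congr_ae (Filter.Eventually.of_forall fun φ => ?_)
  have hmul : Function.Periodic (fun θ => k θ * e θ) (2 * Real.pi) :=
    hper.mul (periodic_exp_int_mul (-n))
  simp only [hmodulate, integral_mul_const]
  rw [← intervalIntegral_neg_pi_pi, ← intervalIntegral_neg_pi_pi,
    intervalIntegral_comp_sub_of_periodic hmul]

lemma fourierCoeffOn_convolution (hk : Measurable k) (hper : Function.Periodic k (2 * Real.pi))
    (hA : ∀ θ, ‖k θ‖ ≤ A) (hF : Integrable F angularMeasure) (n : ℤ) :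
    fourierCoeffOn neg_pi_lt_pi (fun θ => ∫ φ, k (θ - φ) * F φ ∂angularMeasure) n
      = (∫ θ in (-Real.pi)..Real.pi, k θ * Complex.exp (((-n : ℤ) : ℂ) * Complex.I * θ))
        * fourierCoeffOn neg_pi_lt_pi F n := by
  rw [fourierCoeffOn_neg_pi_pi, fourierCoeffOn_neg_pi_pi, mul_left_comm,
    intervalIntegral_convolution_mul_exp hk hper hA hF]

lemma memLp_convolution (hk : Measurable k) (hA : ∀ θ, ‖k θ‖ ≤ A) (hF : Measurable F)
    (hF1 : Integrable F angularMeasure) (p : ℝ≥0∞) :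
    MemLp (fun θ => ∫ φ, k (θ - φ) * F φ ∂angularMeasure) p angularMeasure := by
  have hmeas : Measurable fun p : ℝ × ℝ => k (p.1 - p.2) * F p.2 := by fun_prop
  refine MemLp.of_bound hmeas.stronglyMeasurable.integral_prod_right'.aestronglyMeasurable
    (A * ∫ φ, ‖F φ‖ ∂angularMeasure) (Filter.Eventually.of_forall fun θ => ?_)
  rw [← integral_const_mul]
  refine norm_integral_le_of_norm_le (hF1.norm.const_mul _)
    (Filter.Eventually.of_forall fun φ => ?_)
  rw [norm_mul]
  exact mul_le_mul_of_nonneg_right (hA _) (norm_nonneg _)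

-- By Parseval, a convolution operator has as `L²` bound the supremum of its Fourier multipliers.
theorem lintegral_enorm_convolution_sq_le (hk : Measurable k)
    (hper : Function.Periodic k (2 * Real.pi)) (hA : ∀ θ, ‖k θ‖ ≤ A) (hM0 : 0 < M)
    (hM : ∀ n : ℤ, ‖∫ θ in (-Real.pi)..Real.pi,
      k θ * Complex.exp (((-n : ℤ) : ℂ) * Complex.I * θ)‖ ≤ M)
    (hF : Measurable F) :
    ∫⁻ θ, ‖∫ φ, k (θ - φ) * F φ ∂angularMeasure‖ₑ ^ 2 ∂angularMeasure
      ≤ ENNReal.ofReal M ^ 2 * ∫⁻ φ, ‖F φ‖ₑ ^ 2 ∂angularMeasure := by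
  by_cases hfin : ∫⁻ φ, ‖F φ‖ₑ ^ 2 ∂angularMeasure = ⊤
  · rw [hfin, ENNReal.mul_top (by positivity)]
    exact le_top
  have hF2 : MemLp F 2 angularMeasure := by
    refine ⟨hF.aestronglyMeasurable, ?_⟩
    rw [eLpNorm_lt_top_iff_lintegral_rpow_enorm_lt_top two_ne_zero ENNReal.ofNat_ne_top]
    simpa using lt_top_iff_ne_top.mpr hfin
  have hF1 : Integrable F angularMeasure := hF2.integrable one_le_two
  have hconv := memLp_convolution hk hA hF hF1 2
  have hparseval := hasSum_le (fun n : ℤ => ?_) (hasSum_sq_fourierCoeffOn neg_pi_lt_pi hconv)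
    ((hasSum_sq_fourierCoeffOn neg_pi_lt_pi hF2).mul_left (M ^ 2))
  · simp only [intervalIntegral.integral_of_le neg_pi_lt_pi.le, smul_eq_mul] at hparseval
    rw [mul_left_comm] at hparseval
    rw [lintegral_enorm_sq_eq_ofReal hconv, lintegral_enorm_sq_eq_ofReal hF2,
      ← ENNReal.ofReal_pow hM0.le, ← ENNReal.ofReal_mul (by positivity)]
    exact ENNReal.ofReal_le_ofReal
      (le_of_mul_le_mul_left hparseval (inv_pos.mpr (sub_pos.mpr neg_pi_lt_pi)))
  · rw [fourierCoeffOn_convolution hk hper hA hF1, norm_mul, mul_pow]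
    gcongr
    exact hM n

end Convolution

/-! ### Polar coordinates in the plane -/

/-- The point of the plane with polar coordinates `(r, φ)`. -/
def polarPoint (r φ : ℝ) : Plane := !₂[r * Real.cos φ, r * Real.sin φ]

/-- The measure `r dr` on `(0, ∞)`. -/
def radialMeasure : Measure ℝ := (volume.restrict (Ioi 0)).withDensity ENNReal.ofReal

instance : SFinite radialMeasure := by unfold radialMeasure; infer_instance

lemma ae_radialMeasure_pos : ∀ᵐ r ∂radialMeasure, 0 < r :=
  (withDensity_absolutelyContinuous _ _).ae_le (ae_restrict_mem measurableSet_Ioi)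

lemma lintegral_radialMeasure {f : ℝ → ℝ≥0∞} (hf : Measurable f) :
    ∫⁻ r, f r ∂radialMeasure = ∫⁻ r in Ioi (0 : ℝ), ENNReal.ofReal r * f r :=
  lintegral_withDensity_eq_lintegral_mul _ ENNReal.measurable_ofReal hf

lemma setLIntegral_radialMeasure_le {f : ℝ → ℝ≥0∞} (hf : Measurable f) {R : ℝ} {C : ℝ≥0∞}
    (h : ∀ r, 0 < r → r ≤ R → ENNReal.ofReal r * f r ≤ C) :
    ∫⁻ r in Iic R, f r ∂radialMeasure ≤ C * ENNReal.ofReal R := by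
  rw [← lintegral_indicator measurableSet_Iic,
    lintegral_radialMeasure (hf.indicator measurableSet_Iic)]
  calc ∫⁻ r in Ioi (0 : ℝ), ENNReal.ofReal r * (Iic R).indicator f r
      = ∫⁻ r in Ioi (0 : ℝ), (Iic R).indicator (fun r => ENNReal.ofReal r * f r) r :=
        lintegral_congr fun r => (indicator_mul_right _ _ _).symm
    _ = ∫⁻ r in Ioc 0 R, ENNReal.ofReal r * f r := by
        rw [lintegral_indicator measurableSet_Iic, Measure.restrict_restrict measurableSet_Iic,
          inter_comm, Ioi_inter_Iic]
    _ ≤ ∫⁻ _ in Ioc 0 R, C := setLIntegral_mono measurable_const fun r hr => h r hr.1 hr.2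
    _ = C * ENNReal.ofReal R := by rw [setLIntegral_const, Real.volume_Ioc, sub_zero]

lemma measurePreserving_polarCoord_symm :
    MeasurePreserving polarCoord.symm (radialMeasure.prod angularMeasure)
      (volume : Measure (ℝ × ℝ)) := by
  refine ⟨continuous_polarCoord_symm.measurable, ?_⟩
  ext s hs
  rw [Measure.map_apply continuous_polarCoord_symm.measurable hs, ← lintegral_indicator_one hs,
    ← lintegral_comp_polarCoord_symm, radialMeasure, angularMeasure,
    prod_withDensity_left ENNReal.measurable_ofReal, Measure.prod_restrict,
    withDensity_apply _ (continuous_polarCoord_symm.measurable hs),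
    ← lintegral_indicator (continuous_polarCoord_symm.measurable hs), polarCoord_target]
  have hset : (Ioi (0 : ℝ) ×ˢ Ioc (-Real.pi) Real.pi : Set (ℝ × ℝ))
      =ᵐ[(volume : Measure ℝ).prod volume] (Ioi (0 : ℝ) ×ˢ Ioo (-Real.pi) Real.pi : Set (ℝ × ℝ)) :=
    Measure.set_prod_ae_eq Filter.EventuallyEq.rfl Ioo_ae_eq_Ioc.symm
  rw [Measure.restrict_congr_set hset]
  refine lintegral_congr fun p => ?_
  by_cases h : polarCoord.symm p ∈ s
  · have : p ∈ polarCoord.symm ⁻¹' s := h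
    rw [indicator_of_mem this, indicator_of_mem h]; simp
  · have : p ∉ polarCoord.symm ⁻¹' s := h
    rw [indicator_of_notMem this, indicator_of_notMem h]; simp

lemma measurePreserving_polarPoint :
    MeasurePreserving (fun p : ℝ × ℝ => polarPoint p.1 p.2)
      (radialMeasure.prod angularMeasure) volume := by
  have h := (PiLp.volume_preserving_toLp (Fin 2)).comp
    (((volume_preserving_finTwoArrow ℝ).symm).comp measurePreserving_polarCoord_symm)
  convert! h using 1

lemma measurable_polarPoint : Measurable fun p : ℝ × ℝ => polarPoint p.1 p.2 :=
  measurePreserving_polarPoint.measurable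

lemma lintegral_plane {F : Plane → ℝ≥0∞} (hF : Measurable F) :
    ∫⁻ x, F x = ∫⁻ r, ∫⁻ φ, F (polarPoint r φ) ∂angularMeasure ∂radialMeasure := by
  rw [← measurePreserving_polarPoint.lintegral_comp hF,
    lintegral_prod (fun p : ℝ × ℝ => F (polarPoint p.1 p.2))
      (hF.comp measurable_polarPoint).aemeasurable]

lemma integral_plane {F : Plane → ℂ} (hF : Integrable F) :
    ∫ x, F x = ∫ r, ∫ φ, F (polarPoint r φ) ∂angularMeasure ∂radialMeasure := by
  have hmap := measurePreserving_polarPoint.map_eq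
  rw [← hmap, integral_map measurable_polarPoint.aemeasurable (hmap ▸ hF.aestronglyMeasurable)]
  exact integral_prod _ ((measurePreserving_polarPoint.integrable_comp
    hF.aestronglyMeasurable).mpr hF)

lemma norm_polarPoint {r : ℝ} (hr : 0 < r) (φ : ℝ) : ‖polarPoint r φ‖ = r := by
  rw [polarPoint, EuclideanSpace.norm_eq, Fin.sum_univ_two]
  simp only [Real.norm_eq_abs, sq_abs]
  have : (!₂[r * Real.cos φ, r * Real.sin φ] : Plane) 0 ^ 2
      + (!₂[r * Real.cos φ, r * Real.sin φ] : Plane) 1 ^ 2 = r ^ 2 := by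
    simp only [Matrix.cons_val_zero, Matrix.cons_val_one]
    linear_combination r ^ 2 * Real.cos_sq_add_sin_sq φ
  rw [this, Real.sqrt_sq hr.le]

lemma polarAngle_polarPoint {r φ : ℝ} (hr : 0 < r) (hφ : φ ∈ Ioc (-Real.pi) Real.pi) :
    ∃ n : ℤ, polarAngle (polarPoint r φ) = φ - n * (2 * Real.pi) := by
  have h : Complex.arg ⟨(polarPoint r φ) 0, (polarPoint r φ) 1⟩ = φ := by
    refine Eq.trans (congrArg Complex.arg ?_) (Complex.arg_mul_cos_add_sin_mul_I hr hφ)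
    apply Complex.ext <;> simp [polarPoint, Complex.cos_ofReal_re, Complex.sin_ofReal_re]
  refine ⟨toIcoDiv Real.two_pi_pos 0 φ, ?_⟩
  rw [polarAngle, h, toIcoMod, zsmul_eq_mul]

lemma measurable_polarAngle : Measurable polarAngle := by
  have h : polarAngle = fun x => 0 + Int.fract ((Complex.arg ⟨x 0, x 1⟩ - 0) / (2 * Real.pi))
      * (2 * Real.pi) := by
    ext x
    rw [polarAngle, toIcoMod_eq_add_fract_mul]
  have harg : Measurable fun x : Plane => Complex.arg ⟨x 0, x 1⟩ :=
    Complex.measurable_arg.comp (Complex.measurableEquivRealProd.symm.measurable.comp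
      (by fun_prop : Measurable fun x : Plane => (x 0, x 1)))
  rw [h]
  fun_prop

lemma comp_polarAngle_sub_right {β : Type*} {g : ℝ → β} (hg : Function.Periodic g (2 * Real.pi))
    (θ : ℝ) {r φ : ℝ} (hr : 0 < r) (hφ : φ ∈ Ioc (-Real.pi) Real.pi) :
    g (θ - polarAngle (polarPoint r φ)) = g (θ - φ) := by
  obtain ⟨n, hn⟩ := polarAngle_polarPoint hr hφ
  rw [hn, show θ - (φ - n * (2 * Real.pi)) = θ - φ + n * (2 * Real.pi) by ring]
  exact hg.int_mul n _

lemma comp_polarAngle_sub_left {β : Type*} {g : ℝ → β} (hg : Function.Periodic g (2 * Real.pi))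
    (θ : ℝ) {r φ : ℝ} (hr : 0 < r) (hφ : φ ∈ Ioc (-Real.pi) Real.pi) :
    g (polarAngle (polarPoint r φ) - θ) = g (φ - θ) := by
  obtain ⟨n, hn⟩ := polarAngle_polarPoint hr hφ
  rw [hn, show φ - n * (2 * Real.pi) - θ = φ - θ - n * (2 * Real.pi) by ring]
  exact hg.sub_int_mul_eq n

lemma ae_ne_zero_plane : ∀ᵐ x : Plane, x ≠ 0 :=
  compl_mem_ae_iff.mpr (measure_singleton (0 : Plane))

/-! ### Kernels in polar coordinates -/

/-- Bounds on a kernel `k r₁ r₂ θ` localized to radii at most `2 L`. The last two fields are what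
stationary phase gives: decay in `min r₁ r₂` of the kernel away from `θ = π`, where the diffracted
wave meets the geometric one, and of its angular Fourier coefficients. -/
structure KernelBound (k : ℝ → ℝ → ℝ → ℂ) (L A : ℝ) : Prop where
  one_le : 1 ≤ L
  pos : 0 < A
  measurable : Measurable fun p : ℝ × ℝ × ℝ => k p.1 p.2.1 p.2.2
  periodic : ∀ r₁ r₂, Function.Periodic (k r₁ r₂) (2 * Real.pi)
  norm_le : ∀ r₁ r₂ θ, 0 < r₁ → 0 < r₂ → ‖k r₁ r₂ θ‖ ≤ A
  support : ∀ r₁ r₂ θ, 0 < r₁ → 0 < r₂ → k r₁ r₂ θ ≠ 0 → r₁ ≤ 2 * L ∧ r₂ ≤ 2 * L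
  cos_mul_norm_le : ∀ r₁ r₂ θ, 0 < r₁ → 0 < r₂ →
    |Real.cos (θ / 2)| * ‖k r₁ r₂ θ‖ ≤ A * (1 + min r₁ r₂) ^ (-(1 / 2) : ℝ)
  fourier_le : ∀ r₁ r₂, 0 < r₁ → 0 < r₂ → ∀ n : ℤ,
    ‖∫ θ in (-Real.pi)..Real.pi, k r₁ r₂ θ * Complex.exp (((-n : ℤ) : ℂ) * Complex.I * θ)‖
      ≤ A * (1 + min r₁ r₂) ^ (-(1 / 2) : ℝ)

namespace KernelBound

variable {k : ℝ → ℝ → ℝ → ℂ} {L A : ℝ}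

lemma measurable_planeKernel (hk : KernelBound k L A) :
    Measurable fun p : Plane × Plane => planeKernel k p.1 p.2 := by
  have := measurable_polarAngle
  have h : Measurable fun p : Plane × Plane =>
      (‖p.1‖, ‖p.2‖, polarAngle p.1 - polarAngle p.2) := by fun_prop
  exact hk.measurable.comp h

lemma norm_planeKernel_le (hk : KernelBound k L A) {x y : Plane} (hx : x ≠ 0) (hy : y ≠ 0) :
    ‖planeKernel k x y‖ ≤ (Metric.closedBall (0 : Plane) (2 * L)).indicator (fun _ => A) y := by
  have h := hk.support ‖x‖ ‖y‖ (polarAngle x - polarAngle y) (norm_pos_iff.mpr hx)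
    (norm_pos_iff.mpr hy)
  by_cases h0 : planeKernel k x y = 0
  · rw [h0, norm_zero]
    exact indicator_nonneg (fun _ _ => hk.pos.le) _
  · rw [indicator_of_mem (by simpa using (h h0).2)]
    exact hk.norm_le _ _ _ (norm_pos_iff.mpr hx) (norm_pos_iff.mpr hy)

lemma integrable_planeKernel_mul (hk : KernelBound k L A) {p : ℝ≥0∞} (hp : 1 ≤ p) {f : Plane → ℂ}
    (hf : MemLp f p volume) {x : Plane} (hx : x ≠ 0) :
    Integrable fun y => planeKernel k x y * f y := by
  have hf1 : IntegrableOn f (Metric.closedBall (0 : Plane) (2 * L)) := by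
    have : IsFiniteMeasure (volume.restrict (Metric.closedBall (0 : Plane) (2 * L))) :=
      isFiniteMeasure_restrict.mpr measure_closedBall_lt_top.ne
    exact (hf.restrict _).integrable hp
  refine Integrable.mono' (g := (Metric.closedBall (0 : Plane) (2 * L)).indicator
    fun y => A * ‖f y‖) ?_ ?_ ?_
  · exact IntegrableOn.integrable_indicator (f := fun y => A * ‖f y‖) (hf1.norm.const_mul A)
      measurableSet_closedBall
  · exact ((hk.measurable_planeKernel.comp measurable_prodMk_left).aestronglyMeasurable).mul
      hf.aestronglyMeasurable
  · filter_upwards [ae_ne_zero_plane] with y hy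
    rw [norm_mul]
    refine (mul_le_mul_of_nonneg_right (hk.norm_planeKernel_le hx hy) (norm_nonneg _)).trans
      (le_of_eq ?_)
    by_cases h : y ∈ Metric.closedBall (0 : Plane) (2 * L)
    · rw [indicator_of_mem h, indicator_of_mem h]
    · rw [indicator_of_notMem h, indicator_of_notMem h, zero_mul]

lemma stronglyMeasurable_integralOperator (hk : KernelBound k L A) {f : Plane → ℂ}
    (hf : StronglyMeasurable f) : StronglyMeasurable (integralOperator (planeKernel k) f) :=
  (hk.measurable_planeKernel.stronglyMeasurable.mul
    (hf.comp_measurable measurable_snd)).integral_prod_right'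

lemma lpNormBound (hk : KernelBound k L A) {p : ℝ≥0∞} (hp : 1 ≤ p) {M : ℝ}
    (h : ∀ f : Plane → ℂ, StronglyMeasurable f → MemLp f p volume →
      eLpNorm (integralOperator (planeKernel k) f) p volume
        ≤ ENNReal.ofReal M * eLpNorm f p volume) :
    LpNormBound (planeKernel k) p M := by
  intro f hf
  have hint : ∀ᵐ x : Plane, Integrable (fun y : Plane => planeKernel k x y * f y) volume := by
    filter_upwards [ae_ne_zero_plane] with x hx
    exact hk.integrable_planeKernel_mul hp hf hx
  set g := hf.aestronglyMeasurable.mk f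
  have hfg : f =ᵐ[volume] g := hf.aestronglyMeasurable.ae_eq_mk
  have hgm : StronglyMeasurable g := hf.aestronglyMeasurable.stronglyMeasurable_mk
  have hop : integralOperator (planeKernel k) f = integralOperator (planeKernel k) g := by
    ext x
    refine integral_congr_ae ?_
    filter_upwards [hfg] with y hy
    rw [hy]
  have hgL : MemLp g p volume := (memLp_congr_ae hfg).mp hf
  have hbd := h g hgm hgL
  have hmeas := hk.stronglyMeasurable_integralOperator hgm
  rw [hop, eLpNorm_congr_ae hfg]
  exact ⟨hint, ⟨hmeas.aestronglyMeasurable, hbd.trans_lt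
    (ENNReal.mul_lt_top ENNReal.ofReal_lt_top hgL.2)⟩, hbd⟩

lemma lpNormBound_top (hk : KernelBound k L A) :
    LpNormBound (planeKernel k) ⊤
      (4 * (volume (Metric.ball (0 : Plane) 1)).toReal * (A * L ^ 2)) := by
  refine hk.lpNormBound le_top fun f _ _ => ?_
  have hA := hk.pos
  have := hk.one_le
  rw [eLpNorm_exponent_top, eLpNorm_exponent_top]
  refine essSup_le_of_ae_le _ ?_
  filter_upwards [ae_ne_zero_plane] with x hx
  have hball : volume (Metric.closedBall (0 : Plane) (2 * L))
      = ENNReal.ofReal (4 * L ^ 2 * (volume (Metric.ball (0 : Plane) 1)).toReal) := by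
    rw [Measure.addHaar_closedBall _ _ (by positivity), ENNReal.ofReal_mul (by positivity),
      ENNReal.ofReal_toReal measure_ball_lt_top.ne]
    congr 2
    rw [finrank_euclideanSpace_fin]; ring
  calc ‖integralOperator (planeKernel k) f x‖ₑ
      ≤ ∫⁻ y, ‖planeKernel k x y * f y‖ₑ := enorm_integral_le_lintegral_enorm _
    _ ≤ ∫⁻ y, (Metric.closedBall (0 : Plane) (2 * L)).indicator
          (fun _ => ENNReal.ofReal A * eLpNormEssSup f volume) y := by
        refine lintegral_mono_ae ?_
        filter_upwards [ae_ne_zero_plane, enorm_ae_le_eLpNormEssSup f volume] with y hy hfy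
        have hker := hk.norm_planeKernel_le hx hy
        rw [enorm_mul]
        by_cases h : y ∈ Metric.closedBall (0 : Plane) (2 * L)
        · rw [indicator_of_mem h] at hker ⊢
          refine mul_le_mul' ?_ hfy
          rw [← ofReal_norm]
          exact ENNReal.ofReal_le_ofReal hker
        · rw [indicator_of_notMem h] at hker ⊢
          rw [norm_le_zero_iff.mp hker]; simp
    _ = ENNReal.ofReal A * eLpNormEssSup f volume
          * volume (Metric.closedBall (0 : Plane) (2 * L)) := by
        rw [lintegral_indicator measurableSet_closedBall, setLIntegral_const]
    _ = _ := by
        rw [hball, mul_right_comm, ← ENNReal.ofReal_mul hA.le]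
        congr 2; ring

end KernelBound

/-! ### The bound on `L²` -/

lemma sq_lintegral_le_mul {Ω : Type*} [MeasurableSpace Ω] {μ : Measure Ω} {U W : Ω → ℝ≥0∞}
    (hU : AEMeasurable U μ) (hW : AEMeasurable W μ) (h0 : ∀ᵐ x ∂μ, W x ≠ 0 ∧ W x ≠ ⊤) :
    (∫⁻ x, U x ∂μ) ^ 2 ≤ (∫⁻ x, W x ∂μ) * ∫⁻ x, (W x)⁻¹ * U x ^ 2 ∂μ := by
  have hhölder := ENNReal.lintegral_mul_le_Lp_mul_Lq μ Real.HolderConjugate.two_two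
    (f := fun x => W x ^ (1 / 2 : ℝ)) (g := fun x => (W x)⁻¹ ^ (1 / 2 : ℝ) * U x)
    (hW.pow_const _) ((hW.inv.pow_const _).mul hU)
  have hprod : ∫⁻ x, ((fun x => W x ^ (1 / 2 : ℝ)) * fun x => (W x)⁻¹ ^ (1 / 2 : ℝ) * U x) x ∂μ
      = ∫⁻ x, U x ∂μ := by
    refine lintegral_congr_ae ?_
    filter_upwards [h0] with x hx
    simp only [Pi.mul_apply]
    rw [← mul_assoc, ← ENNReal.mul_rpow_of_nonneg _ _ (by norm_num),
      ENNReal.mul_inv_cancel hx.1 hx.2, ENNReal.one_rpow, one_mul]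
  have hleft : ∀ x, (W x ^ (1 / 2 : ℝ)) ^ (2 : ℝ) = W x := fun x => by
    rw [← ENNReal.rpow_mul]; norm_num
  have hright : ∀ x, ((W x)⁻¹ ^ (1 / 2 : ℝ) * U x) ^ (2 : ℝ) = (W x)⁻¹ * U x ^ 2 := fun x => by
    rw [ENNReal.mul_rpow_of_nonneg _ _ (by norm_num), ← ENNReal.rpow_mul]; norm_num
  rw [hprod] at hhölder
  simp_rw [hleft, hright] at hhölder
  calc (∫⁻ x, U x ∂μ) ^ 2 ≤ ((∫⁻ x, W x ∂μ) ^ (1 / 2 : ℝ)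
        * (∫⁻ x, (W x)⁻¹ * U x ^ 2 ∂μ) ^ (1 / 2 : ℝ)) ^ 2 := by gcongr
    _ = _ := by
      rw [mul_pow, ← ENNReal.rpow_natCast, ← ENNReal.rpow_natCast, ← ENNReal.rpow_mul,
        ← ENNReal.rpow_mul]
      norm_num

section SchurTest

variable {X Θ : Type*} [MeasurableSpace X] [MeasurableSpace Θ] {μ : Measure X} [SFinite μ]
  {M : X → X → ℝ≥0∞} {w G : X → ℝ≥0∞} {D : ℝ≥0∞}

lemma lintegral_sq_lintegral_le {ν : Measure Θ} [SFinite ν] {m : X → ℝ≥0∞} {U : Θ → X → ℝ≥0∞}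
    (hm : Measurable m) (hw : Measurable w) (hU : Measurable fun p : Θ × X => U p.1 p.2)
    (hm0 : ∀ᵐ y ∂μ, m y ≠ 0 ∧ m y ≠ ⊤) (hw0 : ∀ᵐ y ∂μ, w y ≠ 0 ∧ w y ≠ ⊤)
    (hUm : ∀ᵐ y ∂μ, ∫⁻ θ, U θ y ^ 2 ∂ν ≤ m y ^ 2 * G y) :
    ∫⁻ θ, (∫⁻ y, U θ y ∂μ) ^ 2 ∂ν
      ≤ (∫⁻ y, m y * w y ∂μ) * ∫⁻ y, m y * (w y)⁻¹ * G y ∂μ := by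
  have hUθ : ∀ θ, Measurable (U θ) := fun θ => hU.comp measurable_prodMk_left
  have hUy : ∀ y, Measurable fun θ => U θ y := fun y => hU.comp measurable_prodMk_right
  have hdensity : Measurable fun p : Θ × X => (m p.2 * w p.2)⁻¹ * U p.1 p.2 ^ 2 := by fun_prop
  calc ∫⁻ θ, (∫⁻ y, U θ y ∂μ) ^ 2 ∂ν
      ≤ ∫⁻ θ, (∫⁻ y, m y * w y ∂μ) * ∫⁻ y, (m y * w y)⁻¹ * U θ y ^ 2 ∂μ ∂ν := by
        refine lintegral_mono fun θ =>
          sq_lintegral_le_mul (hUθ θ).aemeasurable (hm.mul hw).aemeasurable ?_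
        filter_upwards [hm0, hw0] with y hmy hwy
        exact ⟨mul_ne_zero hmy.1 hwy.1, ENNReal.mul_ne_top hmy.2 hwy.2⟩
    _ = (∫⁻ y, m y * w y ∂μ) * ∫⁻ y, (m y * w y)⁻¹ * ∫⁻ θ, U θ y ^ 2 ∂ν ∂μ := by
        rw [lintegral_const_mul _ hdensity.lintegral_prod_right',
          lintegral_lintegral_swap hdensity.aemeasurable]
        congr 1
        exact lintegral_congr fun y =>
          lintegral_const_mul (μ := ν) (m y * w y)⁻¹ ((hUy y).pow_const 2)
    _ ≤ (∫⁻ y, m y * w y ∂μ) * ∫⁻ y, m y * (w y)⁻¹ * G y ∂μ := by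
        refine mul_le_mul' le_rfl (lintegral_mono_ae ?_)
        filter_upwards [hm0, hUm] with y hmy hUmy
        refine (mul_le_mul' le_rfl hUmy).trans (le_of_eq ?_)
        rw [ENNReal.mul_inv (Or.inl hmy.1) (Or.inl hmy.2), sq]
        calc (m y)⁻¹ * (w y)⁻¹ * (m y * m y * G y)
            = ((m y)⁻¹ * m y) * (m y * (w y)⁻¹ * G y) := by ring
          _ = m y * (w y)⁻¹ * G y := by rw [ENNReal.inv_mul_cancel hmy.1 hmy.2, one_mul]

lemma lintegral_lintegral_mul_inv_le (hM : Measurable fun p : X × X => M p.1 p.2)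
    (hsymm : ∀ x y, M x y = M y x) (hw : Measurable w) (hG : Measurable G)
    (hw0 : ∀ᵐ y ∂μ, w y ≠ 0 ∧ w y ≠ ⊤) (hD : ∀ᵐ x ∂μ, ∫⁻ y, M x y * w y ∂μ ≤ D * w x) :
    ∫⁻ x, w x * ∫⁻ y, M x y * (w y)⁻¹ * G y ∂μ ∂μ ≤ D * ∫⁻ y, G y ∂μ := by
  have hMx : ∀ x, Measurable (M x) := fun x => hM.comp measurable_prodMk_left
  calc ∫⁻ x, w x * ∫⁻ y, M x y * (w y)⁻¹ * G y ∂μ ∂μ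
      = ∫⁻ x, ∫⁻ y, w x * (M x y * (w y)⁻¹ * G y) ∂μ ∂μ :=
        lintegral_congr fun x => (lintegral_const_mul _ (by fun_prop)).symm
    _ = ∫⁻ y, (w y)⁻¹ * G y * ∫⁻ x, M y x * w x ∂μ ∂μ := by
        rw [lintegral_lintegral_swap (by fun_prop)]
        refine lintegral_congr fun y => ?_
        rw [← lintegral_const_mul _ (by fun_prop)]
        exact lintegral_congr fun x => by rw [hsymm x y]; ring
    _ ≤ ∫⁻ y, D * G y ∂μ := by
        refine lintegral_mono_ae ?_
        filter_upwards [hw0, hD] with y hwy hDy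
        refine (mul_le_mul' le_rfl hDy).trans (le_of_eq ?_)
        calc (w y)⁻¹ * G y * (D * w y) = D * G y * ((w y)⁻¹ * w y) := by ring
          _ = D * G y := by rw [ENNReal.inv_mul_cancel hwy.1 hwy.2, mul_one]
    _ = D * ∫⁻ y, G y ∂μ := lintegral_const_mul _ hG

-- Schur's test with weight `w` for a kernel whose value at `(x, y)` is an operator into `L²(ν)`
-- of norm at most `M x y`.
theorem lintegral_lintegral_sq_le_of_schur {ν : Measure Θ} [SFinite ν] {U : X → Θ → X → ℝ≥0∞}
    (hM : Measurable fun p : X × X => M p.1 p.2) (hsymm : ∀ x y, M x y = M y x)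
    (hw : Measurable w) (hG : Measurable G)
    (hU : ∀ x, Measurable fun p : Θ × X => U x p.1 p.2)
    (hM0 : ∀ᵐ x ∂μ, ∀ᵐ y ∂μ, M x y ≠ 0 ∧ M x y ≠ ⊤) (hw0 : ∀ᵐ y ∂μ, w y ≠ 0 ∧ w y ≠ ⊤)
    (hD : ∀ᵐ x ∂μ, ∫⁻ y, M x y * w y ∂μ ≤ D * w x)
    (hUM : ∀ᵐ x ∂μ, ∀ᵐ y ∂μ, ∫⁻ θ, U x θ y ^ 2 ∂ν ≤ M x y ^ 2 * G y) :
    ∫⁻ x, ∫⁻ θ, (∫⁻ y, U x θ y ∂μ) ^ 2 ∂ν ∂μ ≤ D ^ 2 * ∫⁻ y, G y ∂μ := by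
  have hMx : ∀ x, Measurable (M x) := fun x => hM.comp measurable_prodMk_left
  have hinner : Measurable fun x => ∫⁻ y, M x y * (w y)⁻¹ * G y ∂μ := by
    have : Measurable fun p : X × X => M p.1 p.2 * (w p.2)⁻¹ * G p.2 := by fun_prop
    exact this.lintegral_prod_right'
  calc ∫⁻ x, ∫⁻ θ, (∫⁻ y, U x θ y ∂μ) ^ 2 ∂ν ∂μ
      ≤ ∫⁻ x, D * (w x * ∫⁻ y, M x y * (w y)⁻¹ * G y ∂μ) ∂μ := by
        refine lintegral_mono_ae ?_
        filter_upwards [hM0, hD, hUM] with x hMx0 hDx hUMx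
        refine (lintegral_sq_lintegral_le (hMx x) hw (hU x) hMx0 hw0 hUMx).trans ?_
        rw [← mul_assoc]
        exact mul_le_mul' hDx le_rfl
    _ = D * ∫⁻ x, w x * ∫⁻ y, M x y * (w y)⁻¹ * G y ∂μ ∂μ :=
        lintegral_const_mul _ (hw.mul hinner)
    _ ≤ D * (D * ∫⁻ y, G y ∂μ) :=
        mul_le_mul' le_rfl (lintegral_lintegral_mul_inv_le hM hsymm hw hG hw0 hD)
    _ = D ^ 2 * ∫⁻ y, G y ∂μ := by rw [← mul_assoc, sq]

end SchurTest

lemma eLpNorm_le_mul_of_lintegral_le {Ω E F : Type*} [MeasurableSpace Ω] {μ : Measure Ω}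
    [NormedAddCommGroup E] [NormedAddCommGroup F]
    {f : Ω → E} {g : Ω → F} {p : ℝ≥0∞} (hp0 : p ≠ 0) (hp : p ≠ ⊤) {D : ℝ≥0∞}
    (h : ∫⁻ x, ‖g x‖ₑ ^ p.toReal ∂μ ≤ D ^ p.toReal * ∫⁻ x, ‖f x‖ₑ ^ p.toReal ∂μ) :
    eLpNorm g p μ ≤ D * eLpNorm f p μ := by
  have hpos : 0 < p.toReal := ENNReal.toReal_pos hp0 hp
  rw [eLpNorm_eq_lintegral_rpow_enorm_toReal hp0 hp, eLpNorm_eq_lintegral_rpow_enorm_toReal hp0 hp]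
  calc _ ≤ (D ^ p.toReal * ∫⁻ x, ‖f x‖ₑ ^ p.toReal ∂μ) ^ (1 / p.toReal) := by gcongr
    _ = _ := by
      rw [ENNReal.mul_rpow_of_nonneg _ _ (by positivity), ← ENNReal.rpow_mul,
        mul_one_div_cancel hpos.ne', ENNReal.rpow_one]

/-- The weight `r^{-1/2}` of the radial Schur test on `L²`. -/
def schurWeight (r : ℝ) : ℝ≥0∞ := ENNReal.ofReal (r ^ (-(1 / 2) : ℝ))

lemma measurable_schurWeight : Measurable schurWeight := by unfold schurWeight; fun_prop

lemma schurWeight_ne_zero {r : ℝ} (hr : 0 < r) : schurWeight r ≠ 0 := by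
  have := Real.rpow_pos_of_pos hr (-(1 / 2) : ℝ)
  simpa [schurWeight] using this

lemma schurWeight_ne_top (r : ℝ) : schurWeight r ≠ ⊤ := ENNReal.ofReal_ne_top

lemma mul_rpow_add_rpow_mul_rpow_le {r r₁ R : ℝ} (hr : 0 < r) (hrR : r ≤ R) (h₁ : 0 < r₁)
    (h₁R : r₁ ≤ R) :
    r * ((r₁ ^ (-(1 / 2) : ℝ) + r ^ (-(1 / 2) : ℝ)) * r ^ (-(1 / 2) : ℝ))
      ≤ 2 * R ^ (1 / 2 : ℝ) * r₁ ^ (-(1 / 2) : ℝ) := by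
  have hsqrt : r * r ^ (-(1 / 2) : ℝ) = r ^ (1 / 2 : ℝ) := by
    rw [← Real.rpow_one_add' hr.le (by norm_num)]; norm_num
  have hcancel : ∀ {x : ℝ}, 0 < x → x ^ (1 / 2 : ℝ) * x ^ (-(1 / 2) : ℝ) = 1 := fun hx => by
    rw [← Real.rpow_add hx]; norm_num
  calc r * ((r₁ ^ (-(1 / 2) : ℝ) + r ^ (-(1 / 2) : ℝ)) * r ^ (-(1 / 2) : ℝ))
      = r * r ^ (-(1 / 2) : ℝ) * r₁ ^ (-(1 / 2) : ℝ)
        + r * r ^ (-(1 / 2) : ℝ) * r ^ (-(1 / 2) : ℝ) := by ring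
    _ = r ^ (1 / 2 : ℝ) * r₁ ^ (-(1 / 2) : ℝ) + r₁ ^ (1 / 2 : ℝ) * r₁ ^ (-(1 / 2) : ℝ) := by
        rw [hsqrt, hcancel hr, hcancel h₁]
    _ ≤ R ^ (1 / 2 : ℝ) * r₁ ^ (-(1 / 2) : ℝ) + R ^ (1 / 2 : ℝ) * r₁ ^ (-(1 / 2) : ℝ) := by
        gcongr
    _ = 2 * R ^ (1 / 2 : ℝ) * r₁ ^ (-(1 / 2) : ℝ) := by ring

lemma lintegral_schurWeight_le {R r₁ : ℝ} (h₁ : 0 < r₁) (h₁R : r₁ ≤ R) :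
    ∫⁻ r in Iic R, (schurWeight r₁ + schurWeight r) * schurWeight r ∂radialMeasure
      ≤ ENNReal.ofReal (2 * R ^ (3 / 2 : ℝ)) * schurWeight r₁ := by
  have hR : 0 < R := h₁.trans_le h₁R
  have := measurable_schurWeight
  have hpointwise : ∀ r, 0 < r → r ≤ R →
      ENNReal.ofReal r * ((schurWeight r₁ + schurWeight r) * schurWeight r)
        ≤ ENNReal.ofReal (2 * R ^ (1 / 2 : ℝ)) * schurWeight r₁ := by
    intro r hr hrR
    have : 0 < r₁ ^ (-(1 / 2) : ℝ) := Real.rpow_pos_of_pos h₁ _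
    have : 0 < r ^ (-(1 / 2) : ℝ) := Real.rpow_pos_of_pos hr _
    unfold schurWeight
    rw [← ENNReal.ofReal_add (by positivity) (by positivity),
      ← ENNReal.ofReal_mul (by positivity), ← ENNReal.ofReal_mul hr.le,
      ← ENNReal.ofReal_mul (by positivity)]
    exact ENNReal.ofReal_le_ofReal (mul_rpow_add_rpow_mul_rpow_le hr hrR h₁ h₁R)
  refine (setLIntegral_radialMeasure_le (by fun_prop) hpointwise).trans_eq ?_
  rw [mul_right_comm, ← ENNReal.ofReal_mul (by positivity), mul_assoc 2,
    ← Real.rpow_add_one hR.ne', show (1 / 2 + 1 : ℝ) = 3 / 2 by norm_num]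

lemma one_add_min_rpow_le {r₁ r₂ : ℝ} (σ : ℝ) (h₁ : 0 < r₁) (h₂ : 0 < r₂) :
    (1 + min r₁ r₂) ^ (-σ) ≤ (1 + r₁) ^ (-σ) + (1 + r₂) ^ (-σ) := by
  have : 0 < (1 + r₁) ^ (-σ) := Real.rpow_pos_of_pos (by linarith) _
  have : 0 < (1 + r₂) ^ (-σ) := Real.rpow_pos_of_pos (by linarith) _
  rcases min_choice r₁ r₂ with h | h <;> rw [h] <;> linarith

lemma one_add_min_rpow_le_rpow {r₁ r₂ : ℝ} (h₁ : 0 < r₁) (h₂ : 0 < r₂) :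
    (1 + min r₁ r₂) ^ (-(1 / 2) : ℝ) ≤ r₁ ^ (-(1 / 2) : ℝ) + r₂ ^ (-(1 / 2) : ℝ) :=
  (one_add_min_rpow_le _ h₁ h₂).trans (add_le_add
    (Real.rpow_le_rpow_of_nonpos h₁ (by linarith) (by norm_num))
    (Real.rpow_le_rpow_of_nonpos h₂ (by linarith) (by norm_num)))

namespace KernelBound

variable {k : ℝ → ℝ → ℝ → ℂ} {L A : ℝ} {f : Plane → ℂ}

lemma integralOperator_polarPoint (hk : KernelBound k L A) {p : ℝ≥0∞} (hp : 1 ≤ p)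
    (hf : MemLp f p volume) {r₁ θ : ℝ} (h₁ : 0 < r₁) (hθ : θ ∈ Ioc (-Real.pi) Real.pi) :
    integralOperator (planeKernel k) f (polarPoint r₁ θ)
      = ∫ r₂, ∫ φ, k r₁ r₂ (θ - φ) * f (polarPoint r₂ φ) ∂angularMeasure ∂radialMeasure := by
  have hne : polarPoint r₁ θ ≠ 0 := by
    rw [← norm_pos_iff, norm_polarPoint h₁]; exact h₁
  unfold integralOperator
  rw [integral_plane (hk.integrable_planeKernel_mul hp hf hne)]
  refine integral_congr_ae ?_
  filter_upwards [ae_radialMeasure_pos] with r₂ h₂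
  refine integral_congr_ae ?_
  filter_upwards [ae_angularMeasure_mem] with φ hφ
  unfold planeKernel
  rw [norm_polarPoint h₁, norm_polarPoint h₂, comp_polarAngle_sub_right (hk.periodic r₁ r₂) _ h₂ hφ,
    comp_polarAngle_sub_left (hk.periodic r₁ r₂) _ h₁ hθ]

lemma integral_mul_eq_zero (hk : KernelBound k L A) {r₁ r₂ : ℝ} (h₁ : 0 < r₁) (h₂ : 0 < r₂)
    (h : r₁ ∉ Iic (2 * L) ∨ r₂ ∉ Iic (2 * L)) (F : ℝ → ℂ) (θ : ℝ) :
    ∫ φ, k r₁ r₂ (θ - φ) * F φ ∂angularMeasure = 0 := by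
  have hvanish : ∀ φ, k r₁ r₂ (θ - φ) = 0 := fun φ => by
    by_contra hne
    have hsupp := hk.support _ _ _ h₁ h₂ hne
    exact h.elim (· hsupp.1) (· hsupp.2)
  simp [hvanish]

lemma enorm_integralOperator_polarPoint_le (hk : KernelBound k L A) {p : ℝ≥0∞} (hp : 1 ≤ p)
    (hf : MemLp f p volume) {r₁ θ : ℝ} (h₁ : 0 < r₁) (hθ : θ ∈ Ioc (-Real.pi) Real.pi) :
    ‖integralOperator (planeKernel k) f (polarPoint r₁ θ)‖ₑ
      ≤ (Iic (2 * L)).indicator (fun r₁ => ∫⁻ r₂ in Iic (2 * L),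
        ‖∫ φ, k r₁ r₂ (θ - φ) * f (polarPoint r₂ φ) ∂angularMeasure‖ₑ ∂radialMeasure) r₁ := by
  rw [hk.integralOperator_polarPoint hp hf h₁ hθ]
  refine (enorm_integral_le_lintegral_enorm _).trans ?_
  by_cases hr₁ : r₁ ∈ Iic (2 * L)
  · rw [indicator_of_mem hr₁, ← lintegral_indicator measurableSet_Iic]
    refine lintegral_mono_ae ?_
    filter_upwards [ae_radialMeasure_pos] with r₂ h₂
    by_cases hr₂ : r₂ ∈ Iic (2 * L)
    · rw [indicator_of_mem hr₂]
    · rw [hk.integral_mul_eq_zero h₁ h₂ (Or.inr hr₂), enorm_zero]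
      exact zero_le
  · rw [indicator_of_notMem hr₁]
    refine (lintegral_eq_zero_of_ae_eq_zero ?_).le
    filter_upwards [ae_radialMeasure_pos] with r₂ h₂
    rw [hk.integral_mul_eq_zero h₁ h₂ (Or.inl hr₁), enorm_zero, Pi.zero_apply]

lemma measurable_enorm_integral_mul (hk : KernelBound k L A)
    (hf : Measurable fun p : ℝ × ℝ => f (polarPoint p.1 p.2)) (r₁ : ℝ) :
    Measurable fun p : ℝ × ℝ =>
      ‖∫ φ, k r₁ p.2 (p.1 - φ) * f (polarPoint p.2 φ) ∂angularMeasure‖ₑ := by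
  have hker : Measurable fun q : (ℝ × ℝ) × ℝ => k r₁ q.1.2 (q.1.1 - q.2) :=
    hk.measurable.comp
      (by fun_prop : Measurable fun q : (ℝ × ℝ) × ℝ => (r₁, q.1.2, q.1.1 - q.2))
  have hfun : Measurable fun q : (ℝ × ℝ) × ℝ => f (polarPoint q.1.2 q.2) :=
    hf.comp (by fun_prop : Measurable fun q : (ℝ × ℝ) × ℝ => (q.1.2, q.2))
  exact (hker.mul hfun).stronglyMeasurable.integral_prod_right'.measurable.enorm

lemma lintegral_enorm_integral_mul_sq_le (hk : KernelBound k L A) {F : ℝ → ℂ}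
    (hF : Measurable F) {r₁ r₂ : ℝ} (h₁ : 0 < r₁) (h₂ : 0 < r₂) :
    ∫⁻ θ, ‖∫ φ, k r₁ r₂ (θ - φ) * F φ ∂angularMeasure‖ₑ ^ 2 ∂angularMeasure
      ≤ (ENNReal.ofReal A * (schurWeight r₁ + schurWeight r₂)) ^ 2
        * ∫⁻ φ, ‖F φ‖ₑ ^ 2 ∂angularMeasure := by
  have hA := hk.pos
  have hw₁ : 0 < r₁ ^ (-(1 / 2) : ℝ) := Real.rpow_pos_of_pos h₁ _
  have hw₂ : 0 < r₂ ^ (-(1 / 2) : ℝ) := Real.rpow_pos_of_pos h₂ _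
  have hker : Measurable (k r₁ r₂) :=
    hk.measurable.comp (by fun_prop : Measurable fun θ : ℝ => (r₁, r₂, θ))
  have hconv := lintegral_enorm_convolution_sq_le
    (M := A * (r₁ ^ (-(1 / 2) : ℝ) + r₂ ^ (-(1 / 2) : ℝ))) hker (hk.periodic r₁ r₂)
    (fun θ => hk.norm_le r₁ r₂ θ h₁ h₂) (by positivity)
    (fun n => (hk.fourier_le r₁ r₂ h₁ h₂ n).trans
      (mul_le_mul_of_nonneg_left (one_add_min_rpow_le_rpow h₁ h₂) hA.le)) hF
  rwa [ENNReal.ofReal_mul hA.le, ENNReal.ofReal_add hw₁.le hw₂.le] at hconv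

lemma lintegral_enorm_integralOperator_sq_le (hk : KernelBound k L A) (hf : StronglyMeasurable f)
    {p : ℝ≥0∞} (hp : 1 ≤ p) (hfp : MemLp f p volume) :
    ∫⁻ x, ‖integralOperator (planeKernel k) f x‖ₑ ^ 2
      ≤ ∫⁻ r₁ in Iic (2 * L), ∫⁻ θ, (∫⁻ r₂ in Iic (2 * L),
          ‖∫ φ, k r₁ r₂ (θ - φ) * f (polarPoint r₂ φ) ∂angularMeasure‖ₑ ∂radialMeasure) ^ 2
          ∂angularMeasure ∂radialMeasure := by
  rw [lintegral_plane ((hk.stronglyMeasurable_integralOperator hf).measurable.enorm.pow_const 2),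
    ← lintegral_indicator measurableSet_Iic]
  refine lintegral_mono_ae ?_
  filter_upwards [ae_radialMeasure_pos] with r₁ h₁
  by_cases hr₁ : r₁ ∈ Iic (2 * L)
  · rw [indicator_of_mem hr₁]
    refine lintegral_mono_ae ?_
    filter_upwards [ae_angularMeasure_mem] with θ hθ
    have h := hk.enorm_integralOperator_polarPoint_le hp hfp h₁ hθ
    rw [indicator_of_mem hr₁] at h
    exact pow_le_pow_left' h 2
  · rw [indicator_of_notMem hr₁]
    refine (lintegral_eq_zero_of_ae_eq_zero ?_).le
    filter_upwards [ae_angularMeasure_mem] with θ hθ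
    have h := hk.enorm_integralOperator_polarPoint_le hp hfp h₁ hθ
    rw [indicator_of_notMem hr₁, nonpos_iff_eq_zero] at h
    simp [h]

-- Parseval in the angular variable leaves the radial kernel `A (r₁^{-1/2} + r₂^{-1/2})` on
-- `(0, 2L]`, to which Schur's test applies.
theorem lpNormBound_two (hk : KernelBound k L A) :
    LpNormBound (planeKernel k) 2 (A * (2 * (2 * L) ^ (3 / 2 : ℝ))) := by
  refine hk.lpNormBound one_le_two fun f hf hf2 => ?_
  refine eLpNorm_le_mul_of_lintegral_le two_ne_zero ENNReal.ofNat_ne_top ?_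
  simp only [ENNReal.toReal_ofNat, ENNReal.rpow_ofNat]
  have hA := hk.pos
  have hw := measurable_schurWeight
  have hfpolar : Measurable fun p : ℝ × ℝ => f (polarPoint p.1 p.2) :=
    hf.measurable.comp measurable_polarPoint
  have hG : Measurable fun r => ∫⁻ φ, ‖f (polarPoint r φ)‖ₑ ^ 2 ∂angularMeasure :=
    (hfpolar.enorm.pow_const 2).lintegral_prod_right'
  have hpos : ∀ᵐ r ∂(radialMeasure.restrict (Iic (2 * L))), 0 < r :=
    ae_restrict_of_ae ae_radialMeasure_pos
  refine (hk.lintegral_enorm_integralOperator_sq_le hf one_le_two hf2).trans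
    ((lintegral_lintegral_sq_le_of_schur
      (M := fun r₁ r₂ => ENNReal.ofReal A * (schurWeight r₁ + schurWeight r₂))
      (w := schurWeight) (D := ENNReal.ofReal (A * (2 * (2 * L) ^ (3 / 2 : ℝ))))
      (by fun_prop) (fun r₁ r₂ => by rw [add_comm]) hw hG
      (U := fun r₁ θ r₂ => ‖∫ φ, k r₁ r₂ (θ - φ) * f (polarPoint r₂ φ) ∂angularMeasure‖ₑ)
      (hk.measurable_enorm_integral_mul hfpolar) ?_ ?_ ?_ ?_).trans ?_)
  · filter_upwards [hpos] with r₁ h₁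
    refine Filter.Eventually.of_forall fun r₂ => ⟨mul_ne_zero (by simpa using hA) ?_,
      ENNReal.mul_ne_top ENNReal.ofReal_ne_top
        (ENNReal.add_ne_top.mpr ⟨schurWeight_ne_top _, schurWeight_ne_top _⟩)⟩
    simp [schurWeight_ne_zero h₁]
  · filter_upwards [hpos] with r h using ⟨schurWeight_ne_zero h, schurWeight_ne_top r⟩
  · filter_upwards [hpos, ae_restrict_mem measurableSet_Iic] with r₁ h₁ hr₁
    simp only [mul_assoc (ENNReal.ofReal A)]
    rw [lintegral_const_mul _ (by fun_prop), ENNReal.ofReal_mul hA.le, mul_assoc]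
    exact mul_le_mul' le_rfl (lintegral_schurWeight_le h₁ hr₁)
  · filter_upwards [hpos] with r₁ h₁
    filter_upwards [hpos] with r₂ h₂
    exact hk.lintegral_enorm_integral_mul_sq_le (hfpolar.comp measurable_prodMk_left) h₁ h₂
  · rw [lintegral_plane (hf.measurable.enorm.pow_const 2)]
    exact mul_le_mul' le_rfl (lintegral_mono' Measure.restrict_le_self le_rfl)

end KernelBound

/-! ### The bounds on `L^p` -/

section SchurTest

variable {X Y : Type*} [MeasurableSpace X] [MeasurableSpace Y] {μ : Measure X} {ν : Measure Y}
  {p q : ℝ}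

lemma lintegral_mul_mul_le_rpow_mul_rpow (hpq : p.HolderConjugate q) {c f h : Y → ℝ≥0∞}
    (hc : Measurable c) (hh : Measurable h) (hf : Measurable f) :
    ∫⁻ y, c y * (h y * f y) ∂ν
      ≤ (∫⁻ y, c y * h y ^ q ∂ν) ^ (1 / q) * (∫⁻ y, c y * f y ^ p ∂ν) ^ (1 / p) := by
  have hhölder := ENNReal.lintegral_mul_le_Lp_mul_Lq (ν.withDensity c) hpq.symm hh.aemeasurable
    hf.aemeasurable
  rwa [lintegral_withDensity_eq_lintegral_mul ν hc (hh.mul hf),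
    lintegral_withDensity_eq_lintegral_mul ν hc (hh.pow_const q),
    lintegral_withDensity_eq_lintegral_mul ν hc (hf.pow_const p)] at hhölder

lemma lintegral_mul_lintegral_le [SFinite μ] [SFinite ν] {c : X → Y → ℝ≥0∞} {g : X → ℝ≥0∞}
    {f : Y → ℝ≥0∞} (hc : Measurable fun z : X × Y => c z.1 z.2) (hg : Measurable g)
    (hf : Measurable f) {G : ℝ≥0∞} (hG : ∀ y, ∫⁻ x, c x y * g x ∂μ ≤ G) :
    ∫⁻ x, g x * ∫⁻ y, c x y * f y ∂ν ∂μ ≤ G * ∫⁻ y, f y ∂ν := by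
  have hcx : ∀ x, Measurable (c x) := fun x => hc.comp measurable_prodMk_left
  have hcy : ∀ y, Measurable fun x => c x y := fun y => hc.comp measurable_prodMk_right
  calc ∫⁻ x, g x * ∫⁻ y, c x y * f y ∂ν ∂μ
      = ∫⁻ x, ∫⁻ y, g x * (c x y * f y) ∂ν ∂μ :=
        lintegral_congr fun x => (lintegral_const_mul _ (by fun_prop)).symm
    _ = ∫⁻ y, f y * ∫⁻ x, c x y * g x ∂μ ∂ν := by
        rw [lintegral_lintegral_swap (by fun_prop)]
        refine lintegral_congr fun y => ?_
        rw [← lintegral_const_mul _ (by fun_prop)]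
        exact lintegral_congr fun x => by ring
    _ ≤ ∫⁻ y, f y * G ∂ν := lintegral_mono fun y => mul_le_mul' le_rfl (hG y)
    _ = G * ∫⁻ y, f y ∂ν := by rw [lintegral_mul_const _ hf, mul_comm]

theorem lintegral_schur_rpow_le [SFinite μ] [SFinite ν] (hpq : p.HolderConjugate q)
    {c : X → Y → ℝ≥0∞} {g : X → ℝ≥0∞} {h f : Y → ℝ≥0∞}
    (hc : Measurable fun z : X × Y => c z.1 z.2) (hg : Measurable g) (hh : Measurable h)
    (hf : Measurable f) {H G : ℝ≥0∞} (hH : ∀ x, ∫⁻ y, c x y * h y ^ q ∂ν ≤ H)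
    (hG : ∀ y, ∫⁻ x, c x y * g x ^ p ∂μ ≤ G) :
    (∫⁻ x, (g x * ∫⁻ y, c x y * (h y * f y) ∂ν) ^ p ∂μ) ^ (1 / p)
      ≤ H ^ (1 / q) * G ^ (1 / p) * (∫⁻ y, f y ^ p ∂ν) ^ (1 / p) := by
  have hp : 0 < p := hpq.pos
  have hp' : 0 ≤ 1 / p := by positivity
  have hq' : 0 ≤ 1 / q := one_div_nonneg.mpr hpq.symm.pos.le
  have hcx : ∀ x, Measurable (c x) := fun x => hc.comp measurable_prodMk_left
  have : Measurable fun x => ∫⁻ y, c x y * f y ^ p ∂ν :=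
    (hc.mul ((hf.comp measurable_snd).pow_const p)).lintegral_prod_right'
  have hpointwise : ∀ x, (g x * ∫⁻ y, c x y * (h y * f y) ∂ν) ^ p
      ≤ (H ^ (1 / q)) ^ p * (g x ^ p * ∫⁻ y, c x y * f y ^ p ∂ν) := fun x => by
    calc (g x * ∫⁻ y, c x y * (h y * f y) ∂ν) ^ p
        ≤ (g x * (H ^ (1 / q) * (∫⁻ y, c x y * f y ^ p ∂ν) ^ (1 / p))) ^ p := by
          gcongr
          refine (lintegral_mul_mul_le_rpow_mul_rpow hpq (hcx x) hh hf).trans ?_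
          gcongr
          exact hH x
      _ = (H ^ (1 / q)) ^ p * (g x ^ p * ∫⁻ y, c x y * f y ^ p ∂ν) := by
          rw [ENNReal.mul_rpow_of_nonneg _ _ hp.le, ENNReal.mul_rpow_of_nonneg _ _ hp.le,
            ← ENNReal.rpow_mul (∫⁻ y, c x y * f y ^ p ∂ν), one_div_mul_cancel hp.ne',
            ENNReal.rpow_one, mul_left_comm]
  have hintegral : ∫⁻ x, (g x * ∫⁻ y, c x y * (h y * f y) ∂ν) ^ p ∂μ
      ≤ (H ^ (1 / q)) ^ p * (G * ∫⁻ y, f y ^ p ∂ν) := by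
    refine (lintegral_mono hpointwise).trans ?_
    rw [lintegral_const_mul _ (by fun_prop)]
    exact mul_le_mul' le_rfl
      (lintegral_mul_lintegral_le hc (hg.pow_const p) (hf.pow_const p) hG)
  refine (ENNReal.rpow_le_rpow hintegral hp').trans_eq ?_
  rw [ENNReal.mul_rpow_of_nonneg _ _ hp', ENNReal.mul_rpow_of_nonneg _ _ hp', ← ENNReal.rpow_mul,
    mul_one_div_cancel hp.ne', ENNReal.rpow_one, mul_assoc]

end SchurTest

/-- The angular singularity `|cos (θ / 2)|^{-2σ}` at `θ = π`, where for `σ > 0` it is infinite. -/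
def angularWeight (σ θ : ℝ) : ℝ≥0∞ := ENNReal.ofReal |Real.cos (θ / 2)| ^ (-(2 * σ))

lemma measurable_angularWeight (σ : ℝ) : Measurable (angularWeight σ) := by
  unfold angularWeight; fun_prop

lemma periodic_angularWeight (σ : ℝ) : Function.Periodic (angularWeight σ) (2 * Real.pi) := by
  intro θ
  unfold angularWeight
  rw [show (θ + 2 * Real.pi) / 2 = θ / 2 + Real.pi by ring, Real.cos_add_pi, abs_neg]

lemma angularWeight_neg (σ θ : ℝ) : angularWeight σ (-θ) = angularWeight σ θ := by
  unfold angularWeight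
  rw [neg_div, Real.cos_neg]

lemma div_pi_le_abs_cos_half {θ : ℝ} (hθ : |θ| ≤ Real.pi) :
    (Real.pi - |θ|) / Real.pi ≤ |Real.cos (θ / 2)| := by
  have hcos := Real.one_sub_mul_le_cos (x := |θ| / 2) (by positivity) (by linarith)
  have heven : Real.cos (|θ| / 2) = Real.cos (θ / 2) := by
    rw [← Real.cos_abs (θ / 2), abs_div, abs_two]
  rw [heven] at hcos
  refine le_trans (le_of_eq ?_) (hcos.trans (le_abs_self _))
  field_simp

lemma angularWeight_le {σ θ : ℝ} (hσ : 0 ≤ σ) (hθ : θ ∈ Ioo (-Real.pi) Real.pi) :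
    angularWeight σ θ ≤ ENNReal.ofReal
      (((Real.pi - θ) ^ (-(2 * σ)) + (Real.pi + θ) ^ (-(2 * σ))) / Real.pi ^ (-(2 * σ))) := by
  have habs := abs_lt.mpr hθ
  have hpos : 0 < (Real.pi - |θ|) / Real.pi := div_pos (by linarith) Real.pi_pos
  have hcos := div_pi_le_abs_cos_half habs.le
  unfold angularWeight
  rw [ENNReal.ofReal_rpow_of_pos (hpos.trans_le hcos)]
  refine ENNReal.ofReal_le_ofReal
    ((Real.rpow_le_rpow_of_nonpos hpos hcos (by linarith)).trans ?_)
  rw [Real.div_rpow (by linarith) Real.pi_pos.le]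
  gcongr
  have : 0 < (Real.pi - θ) ^ (-(2 * σ)) := Real.rpow_pos_of_pos (by linarith [hθ.2]) _
  have : 0 < (Real.pi + θ) ^ (-(2 * σ)) := Real.rpow_pos_of_pos (by linarith [hθ.1]) _
  rcases abs_choice θ with h | h <;> rw [h]
  · linarith
  · rw [sub_neg_eq_add]; linarith

lemma lintegral_angularWeight_lt_top {σ : ℝ} (h0 : 0 ≤ σ) (h1 : σ < 1 / 2) :
    ∫⁻ θ, angularWeight σ θ ∂angularMeasure < ⊤ := by
  have hpow : IntervalIntegrable (fun x : ℝ => x ^ (-(2 * σ))) volume 0 (2 * Real.pi) :=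
    intervalIntegral.intervalIntegrable_rpow' (by linarith)
  have hleft := (hpow.comp_sub_left Real.pi).symm
  have hright := hpow.comp_add_left Real.pi
  rw [sub_zero, show Real.pi - 2 * Real.pi = -Real.pi by ring] at hleft
  rw [zero_sub, show 2 * Real.pi - Real.pi = Real.pi by ring] at hright
  have hint := (intervalIntegrable_iff_integrableOn_Ioc_of_le neg_pi_lt_pi.le).mp
    ((hleft.add hright).div_const (Real.pi ^ (-(2 * σ))))
  refine lt_of_le_of_lt ?_ hint.lintegral_lt_top
  unfold angularMeasure
  rw [← Measure.restrict_congr_set Ioo_ae_eq_Ioc]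
  exact setLIntegral_mono' measurableSet_Ioo fun θ hθ => angularWeight_le h0 hθ

lemma lintegral_angularWeight_mul_left (σ : ℝ) (x : Plane) {H : ℝ → ℝ≥0∞} (hH : Measurable H) :
    ∫⁻ y : Plane, angularWeight σ (polarAngle x - polarAngle y) * H ‖y‖
      = (∫⁻ θ, angularWeight σ θ ∂angularMeasure) * ∫⁻ r, H r ∂radialMeasure := by
  have := measurable_angularWeight σ
  have := measurable_polarAngle
  rw [lintegral_plane (by fun_prop), ← lintegral_const_mul _ hH]
  refine lintegral_congr_ae ?_
  filter_upwards [ae_radialMeasure_pos] with r hr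
  calc ∫⁻ φ, angularWeight σ (polarAngle x - polarAngle (polarPoint r φ)) * H ‖polarPoint r φ‖
        ∂angularMeasure
      = ∫⁻ φ, angularWeight σ (polarAngle x - φ) * H r ∂angularMeasure := by
        refine lintegral_congr_ae ?_
        filter_upwards [ae_angularMeasure_mem] with φ hφ
        rw [norm_polarPoint hr, comp_polarAngle_sub_right (periodic_angularWeight σ) _ hr hφ]
    _ = (∫⁻ θ, angularWeight σ θ ∂angularMeasure) * H r := by
        rw [lintegral_mul_const _ (by fun_prop),
          lintegral_angularMeasure_comp_sub (periodic_angularWeight σ)]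

lemma lintegral_angularWeight_mul_right (σ : ℝ) (y : Plane) {H : ℝ → ℝ≥0∞} (hH : Measurable H) :
    ∫⁻ x : Plane, angularWeight σ (polarAngle x - polarAngle y) * H ‖x‖
      = (∫⁻ θ, angularWeight σ θ ∂angularMeasure) * ∫⁻ r, H r ∂radialMeasure := by
  rw [← lintegral_angularWeight_mul_left σ y hH]
  refine lintegral_congr fun x => ?_
  rw [← angularWeight_neg, neg_sub]

lemma lintegral_angularWeight_schur_le {p q σ : ℝ} (hpq : p.HolderConjugate q)
    {g h : ℝ → ℝ≥0∞} {f : Plane → ℝ≥0∞} (hg : Measurable g) (hh : Measurable h)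
    (hf : Measurable f) :
    (∫⁻ x : Plane, (g ‖x‖ * ∫⁻ y, angularWeight σ (polarAngle x - polarAngle y)
        * (h ‖y‖ * f y)) ^ p) ^ (1 / p)
      ≤ (∫⁻ θ, angularWeight σ θ ∂angularMeasure)
        * ((∫⁻ r, h r ^ q ∂radialMeasure) ^ (1 / q) * (∫⁻ r, g r ^ p ∂radialMeasure) ^ (1 / p))
        * (∫⁻ y, f y ^ p) ^ (1 / p) := by
  have := measurable_angularWeight σ
  have := measurable_polarAngle
  have hp' : 0 ≤ 1 / p := one_div_nonneg.mpr hpq.pos.le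
  have hq' : 0 ≤ 1 / q := one_div_nonneg.mpr hpq.symm.pos.le
  refine (lintegral_schur_rpow_le hpq (by fun_prop) (by fun_prop) (by fun_prop) hf
    (fun x => (lintegral_angularWeight_mul_left σ x (hh.pow_const q)).le)
    (fun y => (lintegral_angularWeight_mul_right σ y (hg.pow_const p)).le)).trans_eq ?_
  rw [ENNReal.mul_rpow_of_nonneg _ _ hq', ENNReal.mul_rpow_of_nonneg _ _ hp', mul_mul_mul_comm,
    ← ENNReal.rpow_add_of_nonneg _ _ hq' hp', one_div, one_div, hpq.symm.inv_add_inv_eq_one,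
    ENNReal.rpow_one]

/-- The function `(1 + r)^{-σ}` cut off to `r ≤ 2 L`, whose tensor products with itself dominate
a kernel satisfying `KernelBound`. -/
def radialWeight (L σ : ℝ) : ℝ → ℝ≥0∞ :=
  (Iic (2 * L)).indicator fun r => ENNReal.ofReal ((1 + r) ^ (-σ))

section RadialWeight

variable {L σ : ℝ}

lemma measurable_radialWeight : Measurable (radialWeight L σ) :=
  Measurable.indicator (by fun_prop) measurableSet_Iic

lemma radialWeight_of_le {r : ℝ} (hr : r ≤ 2 * L) :
    radialWeight L σ r = ENNReal.ofReal ((1 + r) ^ (-σ)) :=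
  indicator_of_mem (mem_Iic.mpr hr) _

lemma radialWeight_rpow {s r : ℝ} (hs : 0 < s) (hr : 0 < r) :
    radialWeight L σ r ^ s = radialWeight L (σ * s) r := by
  unfold radialWeight
  by_cases h : r ∈ Iic (2 * L)
  · rw [indicator_of_mem h, indicator_of_mem h, ENNReal.ofReal_rpow_of_pos
      (Real.rpow_pos_of_pos (by linarith) _), ← Real.rpow_mul (by linarith), neg_mul]
  · rw [indicator_of_notMem h, indicator_of_notMem h, ENNReal.zero_rpow_of_pos hs]

lemma lintegral_radialWeight_rpow {s : ℝ} (hs : 0 < s) :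
    ∫⁻ r, radialWeight L σ r ^ s ∂radialMeasure
      = ∫⁻ r in Iic (2 * L), ENNReal.ofReal ((1 + r) ^ (-(σ * s))) ∂radialMeasure := by
  rw [← lintegral_indicator measurableSet_Iic]
  refine lintegral_congr_ae ?_
  filter_upwards [ae_radialMeasure_pos] with r hr using radialWeight_rpow hs hr

lemma mul_one_add_rpow_le {r s : ℝ} (hr : 0 < r) : r * (1 + r) ^ (-s) ≤ (1 + r) ^ (1 - s) := by
  have : 0 < (1 + r) ^ (-s) := Real.rpow_pos_of_pos (by linarith) _
  rw [sub_eq_add_neg, Real.rpow_add (by linarith), Real.rpow_one]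
  gcongr
  linarith

lemma lintegral_radialWeight_rpow_le {s : ℝ} (hL : 1 ≤ L) (hs : 0 < s) (hσs : σ * s ≤ 1) :
    ∫⁻ r, radialWeight L σ r ^ s ∂radialMeasure ≤ ENNReal.ofReal ((3 * L) ^ (2 - σ * s)) := by
  rw [lintegral_radialWeight_rpow hs]
  refine (setLIntegral_radialMeasure_le (C := ENNReal.ofReal ((3 * L) ^ (1 - σ * s)))
    (by fun_prop) fun r hr hrL => ?_).trans ?_
  · rw [← ENNReal.ofReal_mul hr.le]
    exact ENNReal.ofReal_le_ofReal ((mul_one_add_rpow_le hr).trans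
      (Real.rpow_le_rpow (by linarith) (by linarith) (by linarith)))
  · rw [← ENNReal.ofReal_mul (by positivity)]
    refine ENNReal.ofReal_le_ofReal ?_
    calc (3 * L) ^ (1 - σ * s) * (2 * L) ≤ (3 * L) ^ (1 - σ * s) * (3 * L) := by gcongr; norm_num
      _ = (3 * L) ^ (2 - σ * s) := by rw [← Real.rpow_add_one (by positivity)]; ring_nf

lemma lintegral_one_add_rpow_lt_top {u : ℝ} (hu : 2 < u) :
    ∫⁻ r in Ioi (0 : ℝ), ENNReal.ofReal ((1 + r) ^ (1 - u)) < ⊤ := by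
  have hint := integrableOn_add_rpow_Ioi_of_lt (a := 1 - u) (c := 0) (m := 1) (by linarith)
    (by norm_num)
  simp only [add_comm _ (1 : ℝ)] at hint
  exact hint.lintegral_lt_top

lemma lintegral_radialWeight_rpow_le_tail {s t : ℝ} (hL : 1 ≤ L) (hs : 0 < s) (ht : 0 ≤ t) :
    ∫⁻ r, radialWeight L σ r ^ s ∂radialMeasure ≤ ENNReal.ofReal ((3 * L) ^ t)
      * ∫⁻ r in Ioi (0 : ℝ), ENNReal.ofReal ((1 + r) ^ (1 - (σ * s + t))) := by
  rw [lintegral_radialWeight_rpow hs, ← lintegral_indicator measurableSet_Iic,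
    lintegral_radialMeasure (Measurable.indicator (by fun_prop) measurableSet_Iic),
    ← lintegral_const_mul _ (by fun_prop)]
  refine setLIntegral_mono' measurableSet_Ioi fun r (hr : 0 < r) => ?_
  by_cases h : r ∈ Iic (2 * L)
  · have hrL : r ≤ 2 * L := h
    rw [indicator_of_mem h, ← ENNReal.ofReal_mul hr.le, ← ENNReal.ofReal_mul (by positivity)]
    refine ENNReal.ofReal_le_ofReal ?_
    calc r * (1 + r) ^ (-(σ * s)) ≤ (1 + r) ^ (1 - σ * s) := mul_one_add_rpow_le hr
      _ = (1 + r) ^ t * (1 + r) ^ (1 - (σ * s + t)) := by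
        rw [← Real.rpow_add (by linarith)]; ring_nf
      _ ≤ (3 * L) ^ t * (1 + r) ^ (1 - (σ * s + t)) := by
        gcongr; linarith
  · rw [indicator_of_notMem h, mul_zero]
    exact zero_le

end RadialWeight

lemma min_one_le_rpow {t s : ℝ} (ht : 0 < t) (hs0 : 0 ≤ s) (hs1 : s ≤ 1) : min 1 t ≤ t ^ s := by
  rcases le_total 1 t with h | h
  · exact (min_le_left _ _).trans (Real.one_le_rpow h hs0)
  · calc min 1 t ≤ t ^ (1 : ℝ) := by rw [Real.rpow_one]; exact min_le_right _ _
      _ ≤ t ^ s := Real.rpow_le_rpow_of_exponent_ge ht h hs1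

namespace KernelBound

variable {k : ℝ → ℝ → ℝ → ℂ} {L A σ : ℝ}

lemma norm_le_cos_rpow_mul (hk : KernelBound k L A) (h0 : 0 ≤ σ) (h1 : σ ≤ 1 / 2)
    {r₁ r₂ θ : ℝ} (h₁ : 0 < r₁) (h₂ : 0 < r₂) (hθ : 0 < |Real.cos (θ / 2)|) :
    ‖k r₁ r₂ θ‖
      ≤ |Real.cos (θ / 2)| ^ (-(2 * σ)) * (A * ((1 + r₁) ^ (-σ) + (1 + r₂) ^ (-σ))) := by
  have hA := hk.pos
  have hmin : 0 < 1 + min r₁ r₂ := by linarith [lt_min h₁ h₂]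
  set κ := |Real.cos (θ / 2)|
  set m := (1 + min r₁ r₂) ^ (-(1 / 2) : ℝ) with hm
  have hm0 : 0 < m := Real.rpow_pos_of_pos hmin _
  have hdecay : ‖k r₁ r₂ θ‖ ≤ A * (m / κ) := by
    rw [← mul_div_assoc, le_div_iff₀ hθ, mul_comm]
    exact hk.cos_mul_norm_le _ _ _ h₁ h₂
  calc ‖k r₁ r₂ θ‖ ≤ A * min 1 (m / κ) := by
        rw [mul_min_of_nonneg _ _ hA.le, mul_one]
        exact le_min (hk.norm_le _ _ _ h₁ h₂) hdecay
    _ ≤ A * (m / κ) ^ (2 * σ) := by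
        gcongr
        exact min_one_le_rpow (by positivity) (by linarith) (by linarith)
    _ = κ ^ (-(2 * σ)) * (A * (1 + min r₁ r₂) ^ (-σ)) := by
        rw [Real.div_rpow hm0.le hθ.le, hm, ← Real.rpow_mul hmin.le, Real.rpow_neg hθ.le]
        ring_nf
    _ ≤ κ ^ (-(2 * σ)) * (A * ((1 + r₁) ^ (-σ) + (1 + r₂) ^ (-σ))) := by
        gcongr
        exact one_add_min_rpow_le σ h₁ h₂

lemma enorm_planeKernel_le (hk : KernelBound k L A) (h0 : 0 < σ) (h1 : σ ≤ 1 / 2) {x y : Plane}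
    (hx : x ≠ 0) (hy : y ≠ 0) :
    ‖planeKernel k x y‖ₑ ≤ angularWeight σ (polarAngle x - polarAngle y) * (ENNReal.ofReal A
      * (radialWeight L σ ‖x‖ * radialWeight L 0 ‖y‖
        + radialWeight L 0 ‖x‖ * radialWeight L σ ‖y‖)) := by
  have hA := hk.pos
  have h₁ : 0 < ‖x‖ := norm_pos_iff.mpr hx
  have h₂ : 0 < ‖y‖ := norm_pos_iff.mpr hy
  unfold planeKernel
  set θ := polarAngle x - polarAngle y
  by_cases hne : k ‖x‖ ‖y‖ θ = 0
  · simp only [hne, enorm_zero, zero_le]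
  obtain ⟨hxL, hyL⟩ := hk.support _ _ _ h₁ h₂ hne
  have : 0 < (1 + ‖x‖) ^ (-σ) := Real.rpow_pos_of_pos (by linarith) _
  have : 0 < (1 + ‖y‖) ^ (-σ) := Real.rpow_pos_of_pos (by linarith) _
  simp only [radialWeight_of_le hxL, radialWeight_of_le hyL, neg_zero, Real.rpow_zero,
    ENNReal.ofReal_one, mul_one, one_mul]
  rw [← ENNReal.ofReal_add (by positivity) (by positivity), ← ENNReal.ofReal_mul hA.le]
  unfold angularWeight
  rcases (abs_nonneg (Real.cos (θ / 2))).eq_or_lt with hθ | hθ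
  · rw [← hθ, ENNReal.ofReal_zero, ENNReal.zero_rpow_of_neg (by linarith),
      ENNReal.top_mul (ENNReal.ofReal_pos.mpr (by positivity)).ne']
    exact le_top
  · rw [ENNReal.ofReal_rpow_of_pos hθ, ← ENNReal.ofReal_mul (by positivity), ← ofReal_norm]
    exact ENNReal.ofReal_le_ofReal (hk.norm_le_cos_rpow_mul h0.le h1 h₁ h₂ hθ)

lemma enorm_integralOperator_le (hk : KernelBound k L A) (h0 : 0 < σ) (h1 : σ ≤ 1 / 2)
    {f : Plane → ℂ} (hf : Measurable f) {x : Plane} (hx : x ≠ 0) :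
    ‖integralOperator (planeKernel k) f x‖ₑ ≤ ENNReal.ofReal A
      * (radialWeight L σ ‖x‖ * (∫⁻ y, angularWeight σ (polarAngle x - polarAngle y)
          * (radialWeight L 0 ‖y‖ * ‖f y‖ₑ))
        + radialWeight L 0 ‖x‖ * ∫⁻ y, angularWeight σ (polarAngle x - polarAngle y)
          * (radialWeight L σ ‖y‖ * ‖f y‖ₑ)) := by
  have := measurable_angularWeight σ
  have := measurable_polarAngle
  have hw : ∀ τ, Measurable (radialWeight L τ) := fun τ => measurable_radialWeight
  have := hw σ
  have := hw 0
  refine (enorm_integral_le_lintegral_enorm _).trans ?_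
  rw [← lintegral_const_mul _ (by fun_prop), ← lintegral_const_mul _ (by fun_prop),
    ← lintegral_add_left (by fun_prop), ← lintegral_const_mul _ (by fun_prop)]
  refine lintegral_mono_ae ?_
  filter_upwards [ae_ne_zero_plane] with y hy
  rw [enorm_mul]
  refine (mul_le_mul' (hk.enorm_planeKernel_le h0 h1 hx hy) le_rfl).trans_eq ?_
  ring

lemma lintegral_enorm_integralOperator_rpow_le (hk : KernelBound k L A) (h0 : 0 < σ)
    (h1 : σ ≤ 1 / 2) {p q : ℝ} (hpq : p.HolderConjugate q) {f : Plane → ℂ} (hf : Measurable f) :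
    (∫⁻ x, ‖integralOperator (planeKernel k) f x‖ₑ ^ p) ^ (1 / p)
      ≤ ENNReal.ofReal A * ((∫⁻ θ, angularWeight σ θ ∂angularMeasure)
        * ((∫⁻ r, radialWeight L 0 r ^ q ∂radialMeasure) ^ (1 / q)
            * (∫⁻ r, radialWeight L σ r ^ p ∂radialMeasure) ^ (1 / p)
          + (∫⁻ r, radialWeight L σ r ^ q ∂radialMeasure) ^ (1 / q)
            * (∫⁻ r, radialWeight L 0 r ^ p ∂radialMeasure) ^ (1 / p)))
        * (∫⁻ y, ‖f y‖ₑ ^ p) ^ (1 / p) := by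
  have hp0 : 0 ≤ p := hpq.pos.le
  have hp' : 0 ≤ 1 / p := one_div_nonneg.mpr hp0
  have := measurable_angularWeight σ
  have := measurable_polarAngle
  have hw : ∀ τ, Measurable (radialWeight L τ) := fun τ => measurable_radialWeight
  set S : ℝ → ℝ → Plane → ℝ≥0∞ := fun τ τ' x => radialWeight L τ ‖x‖
    * ∫⁻ y, angularWeight σ (polarAngle x - polarAngle y) * (radialWeight L τ' ‖y‖ * ‖f y‖ₑ)
  have hSm : ∀ τ τ', Measurable (S τ τ') := fun τ τ' => by
    have := hw τ'
    have : Measurable fun z : Plane × Plane => angularWeight σ (polarAngle z.1 - polarAngle z.2)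
        * (radialWeight L τ' ‖z.2‖ * ‖f z.2‖ₑ) := by fun_prop
    exact ((hw τ).comp measurable_norm).mul this.lintegral_prod_right'
  have hschur : ∀ τ τ', (∫⁻ x, S τ τ' x ^ p) ^ (1 / p) ≤ _ := fun τ τ' =>
    lintegral_angularWeight_schur_le hpq (hw τ) (hw τ') hf.enorm
  calc (∫⁻ x, ‖integralOperator (planeKernel k) f x‖ₑ ^ p) ^ (1 / p)
      ≤ (∫⁻ x, (ENNReal.ofReal A * (S σ 0 + S 0 σ) x) ^ p) ^ (1 / p) := by
        gcongr ?_ ^ _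
        refine lintegral_mono_ae ?_
        filter_upwards [ae_ne_zero_plane] with x hx
        gcongr
        exact hk.enorm_integralOperator_le h0 h1 hf hx
    _ = ENNReal.ofReal A * (∫⁻ x, (S σ 0 + S 0 σ) x ^ p) ^ (1 / p) := by
        simp_rw [ENNReal.mul_rpow_of_nonneg _ _ hp0]
        rw [lintegral_const_mul _ (((hSm σ 0).add (hSm 0 σ)).pow_const p),
          ENNReal.mul_rpow_of_nonneg _ _ hp', ← ENNReal.rpow_mul, mul_one_div_cancel hpq.pos.ne',
          ENNReal.rpow_one]
    _ ≤ ENNReal.ofReal A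
          * ((∫⁻ x, S σ 0 x ^ p) ^ (1 / p) + (∫⁻ x, S 0 σ x ^ p) ^ (1 / p)) := by
        gcongr
        exact ENNReal.lintegral_Lp_add_le (hSm σ 0).aemeasurable (hSm 0 σ).aemeasurable hpq.lt.le
    _ ≤ _ := by
        refine (mul_le_mul' le_rfl (add_le_add (hschur σ 0) (hschur 0 σ))).trans_eq ?_
        ring

end KernelBound

section Exponents

variable {L σ p q : ℝ}

lemma radialWeight_tail_mul_le (hL : 1 ≤ L) (hpq : p.HolderConjugate q) {η : ℝ} (hη : 0 ≤ η) :
    (∫⁻ r, radialWeight L 0 r ^ q ∂radialMeasure) ^ (1 / q)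
        * (∫⁻ r, radialWeight L σ r ^ p ∂radialMeasure) ^ (1 / p)
      ≤ ENNReal.ofReal ((3 * L) ^ (2 - 2 / p + η))
        * (∫⁻ r in Ioi (0 : ℝ), ENNReal.ofReal ((1 + r) ^ (1 - (σ + η) * p))) ^ (1 / p) := by
  have hp := hpq.pos
  have hq := hpq.symm.pos
  have h3L : 0 < 3 * L := by linarith
  have hconst := lintegral_radialWeight_rpow_le (σ := 0) hL hq (by linarith)
  have htail := lintegral_radialWeight_rpow_le_tail (σ := σ) hL hp (mul_nonneg hη hp.le)
  rw [← add_mul] at htail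
  set N := ∫⁻ r in Ioi (0 : ℝ), ENNReal.ofReal ((1 + r) ^ (1 - (σ + η) * p))
  calc _ ≤ ENNReal.ofReal ((3 * L) ^ (2 - 0 * q)) ^ (1 / q)
        * (ENNReal.ofReal ((3 * L) ^ (η * p)) * N) ^ (1 / p) := by gcongr
    _ = _ := by
      have hexp : (2 - 0 * q) * (1 / q) + η * p * (1 / p) = 2 - 2 / p + η := by
        rw [mul_assoc η, mul_one_div_cancel hp.ne', one_div, ← hpq.one_sub_inv]
        ring
      rw [ENNReal.mul_rpow_of_nonneg _ _ (by positivity), ← mul_assoc,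
        ENNReal.ofReal_rpow_of_pos (by positivity), ENNReal.ofReal_rpow_of_pos (by positivity),
        ← Real.rpow_mul h3L.le, ← Real.rpow_mul h3L.le, ← ENNReal.ofReal_mul (by positivity),
        ← Real.rpow_add h3L, hexp]

lemma radialWeight_mul_const_le (hL : 1 ≤ L) (hpq : p.HolderConjugate q) (hσq : σ * q ≤ 1) :
    (∫⁻ r, radialWeight L σ r ^ q ∂radialMeasure) ^ (1 / q)
        * (∫⁻ r, radialWeight L 0 r ^ p ∂radialMeasure) ^ (1 / p)
      ≤ ENNReal.ofReal ((3 * L) ^ (2 - σ)) := by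
  have hp := hpq.pos
  have hq := hpq.symm.pos
  have h3L : 0 < 3 * L := by linarith
  have hdecay := lintegral_radialWeight_rpow_le hL hq hσq
  have hconst := lintegral_radialWeight_rpow_le (σ := 0) hL hp (by linarith)
  calc _ ≤ ENNReal.ofReal ((3 * L) ^ (2 - σ * q)) ^ (1 / q)
        * ENNReal.ofReal ((3 * L) ^ (2 - 0 * p)) ^ (1 / p) := by gcongr
    _ = _ := by
      have hexp : (2 - σ * q) * (1 / q) + (2 - 0 * p) * (1 / p) = 2 - σ := by
        rw [sub_mul, mul_assoc, mul_one_div_cancel hq.ne', one_div, one_div, ← hpq.one_sub_inv]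
        ring
      rw [ENNReal.ofReal_rpow_of_pos (by positivity), ENNReal.ofReal_rpow_of_pos (by positivity),
        ← Real.rpow_mul h3L.le, ← Real.rpow_mul h3L.le, ← ENNReal.ofReal_mul (by positivity),
        ← Real.rpow_add h3L, hexp]

end Exponents

theorem exists_lpNormBound_of_kernelBound {p : ℝ≥0∞} (hp2 : 2 ≤ p) (hp : p ≠ ⊤) {σ η e : ℝ}
    (h0 : 0 < σ) (h1 : σ < 1 / 2) (hη : 0 ≤ η) (hση : 2 < (σ + η) * p.toReal)
    (he₁ : 2 - 2 / p.toReal + η ≤ e) (he₂ : 2 - σ ≤ e) :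
    ∃ C : ℝ, 0 < C ∧ ∀ (k : ℝ → ℝ → ℝ → ℂ) (L A : ℝ), KernelBound k L A →
      LpNormBound (planeKernel k) p (C * (A * L ^ e)) := by
  have hP2 : 2 ≤ p.toReal := by simpa using ENNReal.toReal_mono hp hp2
  have hp0 : p ≠ 0 := fun h => by simp [h] at hp2
  set P := p.toReal
  have hPQ : P.HolderConjugate (P / (P - 1)) := Real.HolderConjugate.conjExponent (by linarith)
  have hQ2 : P / (P - 1) ≤ 2 := by rw [div_le_iff₀ (by linarith)]; linarith
  set Q := P / (P - 1)
  set W := ∫⁻ θ, angularWeight σ θ ∂angularMeasure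
  set N := (∫⁻ r in Ioi (0 : ℝ), ENNReal.ofReal ((1 + r) ^ (1 - (σ + η) * P))) ^ (1 / P)
  have hfin : W * (N + 1) ≠ ⊤ := by
    have hN_top : N ≠ ⊤ :=
      ENNReal.rpow_ne_top_of_nonneg (by positivity) (lintegral_one_add_rpow_lt_top hση).ne
    exact ENNReal.mul_ne_top (lintegral_angularWeight_lt_top h0.le h1).ne
      (ENNReal.add_ne_top.mpr ⟨hN_top, ENNReal.one_ne_top⟩)
  refine ⟨((W * (N + 1)).toReal + 1) * 3 ^ e, by positivity, fun k L A hk => ?_⟩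
  have hA := hk.pos
  have hL := hk.one_le
  have hpow : ∀ u ≤ e, ENNReal.ofReal ((3 * L) ^ u) ≤ ENNReal.ofReal ((3 * L) ^ e) := fun u hu =>
    ENNReal.ofReal_le_ofReal (Real.rpow_le_rpow_of_exponent_le (by linarith) hu)
  refine hk.lpNormBound (one_le_two.trans hp2) fun f hf _ => ?_
  have hbound := hk.lintegral_enorm_integralOperator_rpow_le h0 h1.le hPQ hf.measurable
  have htail := (radialWeight_tail_mul_le (σ := σ) hL hPQ hη).trans
    (mul_le_mul' (hpow _ he₁) le_rfl)
  have hmain := (radialWeight_mul_const_le hL hPQ (by nlinarith)).trans (hpow _ he₂)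
  rw [eLpNorm_eq_lintegral_rpow_enorm_toReal hp0 hp, eLpNorm_eq_lintegral_rpow_enorm_toReal hp0 hp]
  refine hbound.trans (mul_le_mul' ?_ le_rfl)
  calc _ ≤ ENNReal.ofReal A
        * (W * (ENNReal.ofReal ((3 * L) ^ e) * N + ENNReal.ofReal ((3 * L) ^ e))) := by
        gcongr
    _ = W * (N + 1) * ENNReal.ofReal (A * (3 * L) ^ e) := by
        rw [ENNReal.ofReal_mul hA.le]; ring
    _ ≤ ENNReal.ofReal ((W * (N + 1)).toReal + 1) * ENNReal.ofReal (A * (3 * L) ^ e) := by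
        gcongr
        exact ENNReal.le_ofReal_iff_toReal_le hfin (by positivity) |>.mpr (by linarith)
    _ = ENNReal.ofReal (((W * (N + 1)).toReal + 1) * 3 ^ e * (A * L ^ e)) := by
        rw [← ENNReal.ofReal_mul (by positivity), Real.mul_rpow (by norm_num) (by linarith)]
        congr 1; ring

/-! ### The dyadic cutoffs -/

/-- Measurable dyadic partitions of unity on `(0, ∞)` bounded by `M`, with `β` supported in
`[3/8, 4/3]`. -/
structure IsBoundedDyadicPartition (β : ℝ → ℝ) (M : ℝ) : Prop where
  measurable : Measurable β
  abs_le : ∀ x, |β x| ≤ M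
  eq_zero : ∀ x ∉ Icc (3 / 8 : ℝ) (4 / 3), β x = 0
  sum_eq_one : ∀ r : ℝ, 0 < r → ∑' k : ℤ, β ((2 : ℝ) ^ (-k) * r) = 1

lemma IsDyadicPartition.exists_isBoundedDyadicPartition {β : ℝ → ℝ} (hβ : IsDyadicPartition β) :
    ∃ M, IsBoundedDyadicPartition β M := by
  have hcompact : HasCompactSupport β :=
    isCompact_Icc.of_isClosed_subset (isClosed_tsupport β) hβ.support
  obtain ⟨M, hM⟩ := hcompact.exists_bound_of_continuous hβ.smooth.continuous
  exact ⟨M, hβ.smooth.continuous.measurable, hM,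
    fun x hx => image_eq_zero_of_notMem_tsupport fun h => hx (hβ.support h), hβ.sum_eq_one⟩

/-- Bounded cutoffs to the dyadic scale `r ∼ L`, or to `r ≲ L` when `L ∼ 1`. -/
structure ScaleCutoff (χ : ℝ → ℝ) (L M : ℝ) : Prop where
  measurable : Measurable χ
  abs_le : ∀ r, |χ r| ≤ M
  le_two_mul : ∀ r, χ r ≠ 0 → r ≤ 2 * L
  le_four_mul : ∀ r, 0 < r → χ r ≠ 0 → L ≤ 4 * (1 + r)

lemma ScaleCutoff.norm_mul_le {χ : ℝ → ℝ} {L M μ R m : ℝ} (hχ : ScaleCutoff χ L M) (hL : 0 < L)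
    (hμ : 0 ≤ μ) (hR : 0 < R) (hm : 0 ≤ m) {z : ℂ} (hz : ‖z‖ ≤ (1 + R) ^ (-μ) * m) :
    ‖(χ R : ℂ) * z‖ ≤ M * (4 ^ μ * L ^ (-μ) * m) := by
  have hM : 0 ≤ M := (abs_nonneg _).trans (hχ.abs_le R)
  by_cases h0 : χ R = 0
  · rw [h0, Complex.ofReal_zero, zero_mul, norm_zero]; positivity
  have hdecay : (1 + R) ^ (-μ) ≤ 4 ^ μ * L ^ (-μ) := by
    have h4 : (4 : ℝ) ^ μ = (1 / 4) ^ (-μ) := by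
      rw [one_div, Real.inv_rpow (by norm_num), Real.rpow_neg (by norm_num), inv_inv]
    rw [h4, ← Real.mul_rpow (by norm_num) hL.le]
    exact Real.rpow_le_rpow_of_nonpos (by positivity) (by linarith [hχ.le_four_mul R hR h0])
      (by linarith)
  rw [norm_mul, Complex.norm_real, Real.norm_eq_abs]
  exact mul_le_mul (hχ.abs_le R) (hz.trans (by gcongr)) (norm_nonneg z) hM

namespace IsBoundedDyadicPartition

variable {β : ℝ → ℝ} {M : ℝ}

lemma bound_nonneg (hβ : IsBoundedDyadicPartition β M) : 0 ≤ M :=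
  (abs_nonneg _).trans (hβ.abs_le 0)

lemma eq_zero_of_lt (hβ : IsBoundedDyadicPartition β M) {x : ℝ} (hx : x < 3 / 8) : β x = 0 :=
  hβ.eq_zero x fun h => hx.not_ge h.1

lemma eq_zero_of_gt (hβ : IsBoundedDyadicPartition β M) {x : ℝ} (hx : 4 / 3 < x) : β x = 0 :=
  hβ.eq_zero x fun h => hx.not_ge h.2

lemma tsum_eq_of_le (hβ : IsBoundedDyadicPartition β M) {r : ℝ} (hr : r ≤ 4 / 3) :
    ∑' k : ℕ, β ((2 : ℝ) ^ (-((k : ℤ) + 1)) * r) = β (r / 2) := by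
  rw [tsum_eq_single 0]
  · norm_num [div_eq_inv_mul]
  · intro k hk
    have hpow : (2 : ℝ) ^ (-((k : ℤ) + 1)) ≤ 1 / 4 :=
      (zpow_le_zpow_right₀ one_le_two (by omega : -((k : ℤ) + 1) ≤ -2)).trans_eq (by norm_num)
    have : (0 : ℝ) < 2 ^ (-((k : ℤ) + 1)) := by positivity
    exact hβ.eq_zero_of_lt (by nlinarith)

lemma tsum_eq_one_of_gt (hβ : IsBoundedDyadicPartition β M) {r : ℝ} (hr : 4 / 3 < r) :
    ∑' k : ℕ, β ((2 : ℝ) ^ (-((k : ℤ) + 1)) * r) = 1 := by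
  have hinj : Function.Injective fun k : ℕ => (k : ℤ) + 1 := fun x y hxy => by simpa using hxy
  rw [hinj.tsum_eq (f := fun k : ℤ => β ((2 : ℝ) ^ (-k) * r)), hβ.sum_eq_one r (by linarith)]
  refine Function.support_subset_iff'.mpr fun k hk => hβ.eq_zero_of_gt ?_
  have hk0 : k ≤ 0 := not_lt.mp fun hpos => hk ⟨(k - 1).toNat, by simp only; omega⟩
  have hpow : (1 : ℝ) ≤ 2 ^ (-k) := one_le_zpow₀ one_le_two (by omega)
  nlinarith

lemma dyadicCutoff_zero (hβ : IsBoundedDyadicPartition β M) :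
    dyadicCutoff β 0 = (Iic (4 / 3)).indicator fun r => 1 - β (r / 2) := by
  funext r
  rcases le_or_gt r (4 / 3) with hr | hr
  · rw [indicator_of_mem (mem_Iic.mpr hr), dyadicCutoff, hβ.tsum_eq_of_le hr]
  · rw [indicator_of_notMem (notMem_Iic.mpr hr), dyadicCutoff, hβ.tsum_eq_one_of_gt hr, sub_self]

lemma scaleCutoff_zero (hβ : IsBoundedDyadicPartition β M) :
    ScaleCutoff (dyadicCutoff β 0) 1 (1 + M) := by
  have := hβ.measurable
  have := hβ.bound_nonneg
  rw [hβ.dyadicCutoff_zero]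
  refine ⟨Measurable.indicator (by fun_prop) measurableSet_Iic, fun r => ?_, fun r hr => ?_,
    fun r hr _ => by linarith⟩
  · rw [← Real.norm_eq_abs]
    refine (norm_indicator_le_norm_self _ _).trans ((norm_sub_le _ _).trans ?_)
    rw [norm_one]
    exact add_le_add_right (hβ.abs_le _) 1
  · have hle : r ∈ Iic (4 / 3 : ℝ) := Set.mem_of_indicator_ne_zero hr
    linarith [mem_Iic.mp hle]

lemma scaleCutoff_succ (hβ : IsBoundedDyadicPartition β M) (j : ℕ) :
    ScaleCutoff (dyadicCutoff β (j + 1)) (2 ^ (j + 1)) (1 + M) := by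
  have := hβ.measurable
  have hpow : (0 : ℝ) < 2 ^ (j + 1) := by positivity
  have hmem : ∀ r, dyadicCutoff β (j + 1) r ≠ 0 → r / 2 ^ (j + 1) ∈ Icc (3 / 8 : ℝ) (4 / 3) := by
    intro r hr
    have hscale : (2 : ℝ) ^ (-((j : ℤ) + 1)) * r = r / 2 ^ (j + 1) := by
      rw [zpow_neg, div_eq_inv_mul]; norm_cast
    rw [dyadicCutoff, hscale] at hr
    exact not_not.mp (mt (hβ.eq_zero _) hr)
  refine ⟨?_, fun r => (hβ.abs_le _).trans (by linarith), fun r hr => ?_, fun r _ hr => ?_⟩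
  · unfold dyadicCutoff; fun_prop
  · linarith [(div_le_iff₀ hpow).mp (hmem r hr).2]
  · linarith [(le_div_iff₀ hpow).mp (hmem r hr).1]

lemma scaleCutoff (hβ : IsBoundedDyadicPartition β M) :
    ∀ j, ScaleCutoff (dyadicCutoff β j) (2 ^ j) (1 + M)
  | 0 => by simpa using hβ.scaleCutoff_zero
  | j + 1 => hβ.scaleCutoff_succ j

end IsBoundedDyadicPartition

/-! ### The localized kernels -/

lemma measurable_diffWeight (α : ℝ) (ℓ : ℕ) :
    Measurable fun p : ℝ × ℝ => diffWeight α p.1 p.2 ℓ := by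
  match ℓ with
  | 0 | 1 | 2 | 3 | _ + 4 => unfold diffWeight; fun_prop

lemma periodic_diffWeight (α s : ℝ) (ℓ : ℕ) :
    Function.Periodic (fun θ => diffWeight α θ s ℓ) (2 * Real.pi) := by
  intro θ
  simp only [diffWeight, add_right_comm θ (2 * Real.pi), Real.cos_add_two_pi, Real.sin_add_two_pi]

lemma norm_integral_mul_exp_le {f : ℝ → ℂ} {M : ℝ} (hf : ∀ θ, ‖f θ‖ ≤ M) (n : ℤ) :
    ‖∫ θ in (-Real.pi)..Real.pi, f θ * Complex.exp ((n : ℂ) * Complex.I * θ)‖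
      ≤ M * (2 * Real.pi) := by
  have h := intervalIntegral.norm_integral_le_of_norm_le_const (a := -Real.pi) (b := Real.pi)
    (f := fun θ : ℝ => f θ * Complex.exp ((n : ℂ) * Complex.I * θ)) (C := M) fun θ _ => by
      rw [norm_mul, norm_exp_int_mul, mul_one]; exact hf θ
  rwa [sub_neg_eq_add, ← two_mul, abs_of_pos Real.two_pi_pos] at h

namespace SymbolBound

variable {μ C α r₁ r₂ : ℝ} {B : ℝ → ℂ} {ℓ : ℕ}

-- `|n_s|` vanishes at some `r₁, r₂ ≤ 0`, so the arbitrary value `B 0` matters for measurability.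
lemma measurable_indicator_Ici (hB : SymbolBound μ C B) : Measurable ((Ici 0).indicator B) := by
  classical
  have hpos : Measurable ((Ioi 0).piecewise B 0) :=
    hB.contDiffOn.continuousOn.measurable_piecewise continuousOn_const measurableSet_Ioi
  rw [piecewise_eq_indicator] at hpos
  refine hpos.measurable_of_countable_ne ((countable_singleton (0 : ℝ)).mono fun x hx => ?_)
  by_contra h0
  have hiff : x ∈ Ioi (0 : ℝ) ↔ x ∈ Ici (0 : ℝ) := 
    ⟨fun h => (mem_Ioi.mp h).le, fun h => lt_of_le_of_ne h (Ne.symm h0)⟩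
  exact hx (if_congr hiff rfl rfl)

lemma measurable_oscIntegral_diffWeight (hB : SymbolBound μ C B) (α : ℝ) (ℓ : ℕ) :
    Measurable fun p : ℝ × ℝ × ℝ =>
      oscIntegral B p.1 p.2.1 fun s => diffWeight α p.2.2 s ℓ := by
  have hdist : Measurable fun q : (ℝ × ℝ × ℝ) × ℝ => diffDist q.1.1 q.1.2.1 q.2 := by
    unfold diffDist; fun_prop
  have hweight : Measurable fun q : (ℝ × ℝ × ℝ) × ℝ => diffWeight α q.1.2.2 q.2 ℓ :=
    (measurable_diffWeight α ℓ).comp (by fun_prop : Measurable fun q : (ℝ × ℝ × ℝ) × ℝ =>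
      (q.1.2.2, q.2))
  have hamp : Measurable fun q : (ℝ × ℝ × ℝ) × ℝ => B (diffDist q.1.1 q.1.2.1 q.2) := by
    convert hB.measurable_indicator_Ici.comp hdist using 1
    exact funext fun q => (indicator_of_mem (mem_Ici.mpr (Real.sqrt_nonneg _)) B).symm
  have h : Measurable fun q : (ℝ × ℝ × ℝ) × ℝ =>
      oscFactor B q.1.1 q.1.2.1 q.2 * diffWeight α q.1.2.2 q.2 ℓ := by
    unfold oscFactor
    exact ((by fun_prop : Measurable fun q : (ℝ × ℝ × ℝ) × ℝ =>
      Complex.exp (Complex.I * diffDist q.1.1 q.1.2.1 q.2)).mul hamp).mul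
        (Complex.measurable_ofReal.comp hweight)
  exact h.stronglyMeasurable.integral_prod_right'.measurable

lemma norm_integral_diffWeight_mul_exp_le (hB : SymbolBound μ C B) (hμ : 0 ≤ μ) (hα : |α| < 1)
    (hα0 : α ≠ 0) (h₁ : 0 < r₁) (h₂ : 0 < r₂) (hℓ : ℓ ∈ Icc (1 : ℕ) 3) (n : ℤ) :
    ‖∫ θ in (-Real.pi)..Real.pi, oscIntegral B r₁ r₂ (fun s => diffWeight α θ s ℓ)
        * Complex.exp (((-n : ℤ) : ℂ) * Complex.I * θ)‖
      ≤ C * (1 + (r₁ + r₂)) ^ (-μ) * (1 + min r₁ r₂) ^ (-(1 / 2) : ℝ)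
        * (72 * Real.pi * weightBound α) := by
  by_cases h3 : ℓ = 3
  · subst h3
    refine (hB.norm_integral_oscIntegral_diffWeight_three_le hμ hα hα0 h₁ h₂ n).trans ?_
    have hC := hB.pos
    have hπ := Real.pi_pos
    have : 0 < 1 + min r₁ r₂ := by linarith [lt_min h₁ h₂]
    refine mul_le_mul_of_nonneg_left ?_ (by positivity)
    have hle : 1 + 2 / (1 - |α|) ≤ 2 * weightBound α := by
      have : 0 ≤ 1 / |α| := by positivity
      have : 0 ≤ 1 / (1 - |α|) := one_div_nonneg.mpr (by linarith)
      rw [weightBound, div_eq_mul_one_div 2, div_eq_mul_one_div 4]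
      linarith
    nlinarith
  · refine (norm_integral_mul_exp_le (fun θ =>
      hB.norm_oscIntegral_diffWeight_le_decay hμ hα hα0 h₁ h₂ θ hℓ h3) (-n)).trans_eq ?_
    ring

theorem kernelBound_mul_oscIntegral {χ : ℝ → ℝ} {L M : ℝ} (hB : SymbolBound μ C B) (hμ : 0 ≤ μ)
    (hα : |α| < 1) (hα0 : α ≠ 0) (hℓ : ℓ ∈ Icc (1 : ℕ) 3) (hχ : ScaleCutoff χ L M) (hL : 1 ≤ L)
    (hM : 0 < M) :
    KernelBound
      (fun r₁ r₂ θ => (χ (r₁ + r₂) : ℂ) * oscIntegral B r₁ r₂ fun s => diffWeight α θ s ℓ) L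
      (M * 4 ^ μ * C * (72 * Real.pi * weightBound α) * L ^ (-μ)) := by
  have hC := hB.pos
  have hπ := Real.pi_gt_three
  have hw : 0 < weightBound α := weightBound_pos hα.le
  have hmin {r₁ r₂ : ℝ} (h₁ : 0 < r₁) (h₂ : 0 < r₂) : 0 ≤ (1 + min r₁ r₂) ^ (-(1 / 2) : ℝ) :=
    Real.rpow_nonneg (by linarith [lt_min h₁ h₂]) _
  have hcut {R m K : ℝ} (hR : 0 < R) (hm : 0 ≤ m) (hK : K ≤ 72 * Real.pi * weightBound α) {z : ℂ}
      (hz : ‖z‖ ≤ C * (1 + R) ^ (-μ) * m * K) :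
      ‖(χ R : ℂ) * z‖ ≤ M * 4 ^ μ * C * (72 * Real.pi * weightBound α) * L ^ (-μ) * m := by
    refine (hχ.norm_mul_le (one_pos.trans_le hL) hμ hR
      (m := C * (72 * Real.pi * weightBound α) * m) (by positivity) ?_).trans_eq (by ring)
    calc ‖z‖ ≤ C * (1 + R) ^ (-μ) * m * (72 * Real.pi * weightBound α) := hz.trans (by gcongr)
      _ = (1 + R) ^ (-μ) * (C * (72 * Real.pi * weightBound α) * m) := by ring
  refine ⟨hL, by positivity, ?_, fun r₁ r₂ θ => ?_, fun r₁ r₂ θ h₁ h₂ => ?_,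
    fun r₁ r₂ θ h₁ h₂ hne => ?_, fun r₁ r₂ θ h₁ h₂ => ?_, fun r₁ r₂ h₁ h₂ n => ?_⟩
  · have := hχ.measurable
    have := hB.measurable_oscIntegral_diffWeight α ℓ
    fun_prop
  · simp only [oscIntegral, fun s => periodic_diffWeight α s ℓ θ]
  · have := hcut (add_pos h₁ h₂) zero_le_one (K := 2 * weightBound α) (by nlinarith)
      (by rw [mul_one]; exact hB.norm_oscIntegral_diffWeight_le hμ hα hα0 h₁ h₂ θ hℓ)
    rwa [mul_one] at this
  · have := hχ.le_two_mul _ fun h => hne (by rw [h, Complex.ofReal_zero, zero_mul])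
    constructor <;> linarith
  · have := hcut (add_pos h₁ h₂) (hmin h₁ h₂) (K := 36 * weightBound α) (by nlinarith)
      (z := (|Real.cos (θ / 2)| : ℝ) * oscIntegral B r₁ r₂ fun s => diffWeight α θ s ℓ) (by
        rw [norm_mul, Complex.norm_real, Real.norm_eq_abs, abs_abs]
        exact hB.abs_cos_mul_norm_oscIntegral_diffWeight_le hμ hα hα0 h₁ h₂ θ hℓ)
    rwa [mul_left_comm, norm_mul, Complex.norm_real, Real.norm_eq_abs, abs_abs] at this
  · simp_rw [mul_assoc (χ (r₁ + r₂) : ℂ), intervalIntegral.integral_const_mul]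
    exact hcut (add_pos h₁ h₂) (hmin h₁ h₂) le_rfl
      (hB.norm_integral_diffWeight_mul_exp_le hμ hα hα0 h₁ h₂ hℓ n)

end SymbolBound

theorem exists_kernelBound_diffKernelPiece {α δ M : ℝ} {a : ℝ → ℂ} {β : ℝ → ℝ} (hα : |α| < 1)
    (hα0 : α ≠ 0) (hδ : -(3 / 2) < δ) (ha : IsC1Amplitude a)
    (hβ : IsBoundedDyadicPartition β M) :
    ∃ D, 0 < D ∧ ∀ ℓ ∈ Icc (1 : ℕ) 3, ∀ j : ℕ,
      KernelBound (diffKernelPiece α δ a β ℓ j) (2 ^ j) (D * (2 ^ j) ^ (-(3 / 2 + δ))) := by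
  obtain ⟨C, hB⟩ := ha.exists_symbolBound hδ
  have hC := hB.pos
  have hM := hβ.bound_nonneg
  have hw : 0 < weightBound α := weightBound_pos hα.le
  have := Real.pi_pos
  refine ⟨(1 + M) * 4 ^ (3 / 2 + δ) * C * (72 * Real.pi * weightBound α), by positivity,
    fun ℓ hℓ j => ?_⟩
  unfold diffKernelPiece
  simp only [diffKernel_eq]
  exact hB.kernelBound_mul_oscIntegral (by linarith) hα hα0 hℓ (hβ.scaleCutoff j)
    (one_le_pow₀ one_le_two) (by linarith)

/-! ### Operator bounds -/

lemma LpNormBound.mono {k : Plane → Plane → ℂ} {p : ℝ≥0∞} {M M' : ℝ} (hk : LpNormBound k p M)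
    (hM : M ≤ M') : LpNormBound k p M' := fun f hf =>
  let ⟨hint, hmem, hle⟩ := hk f hf
  ⟨hint, hmem, hle.trans (by gcongr)⟩

lemma two_pow_rpow (j : ℕ) (x : ℝ) : ((2 : ℝ) ^ j) ^ x = 2 ^ ((j : ℝ) * x) := by
  rw [← Real.rpow_natCast, ← Real.rpow_mul zero_le_two]

lemma criticalIndex_of_two_le {p : ℝ≥0∞} (hp : 2 ≤ p) :
    criticalIndex p 2 = max 0 (1 / 2 - 2 * (p⁻¹).toReal) := by
  have hinv : (p⁻¹).toReal ≤ 1 / 2 := by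
    simpa using ENNReal.toReal_mono (by norm_num) (ENNReal.inv_le_inv.mpr hp)
  rw [criticalIndex, abs_of_nonneg (by linarith)]
  congr 1
  push_cast
  ring

section

variable {α δ M : ℝ} {a : ℝ → ℂ} {β : ℝ → ℝ}

lemma exists_lpNormBound_diffKernelPiece_of_kernelBound (hα : |α| < 1) (hα0 : α ≠ 0)
    (hδ : -(3 / 2) < δ) (ha : IsC1Amplitude a) (hβ : IsBoundedDyadicPartition β M) {p : ℝ≥0∞}
    {C e : ℝ} (hC : 0 < C)
    (h : ∀ k L A, KernelBound k L A → LpNormBound (planeKernel k) p (C * (A * L ^ (3 / 2 + e)))) :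
    ∃ C, 0 < C ∧ ∀ ℓ ∈ Icc (1 : ℕ) 3, ∀ j : ℕ,
      LpNormBound (planeKernel (diffKernelPiece α δ a β ℓ j)) p (C * 2 ^ ((j : ℝ) * (e - δ))) := by
  obtain ⟨D, hD, hk⟩ := exists_kernelBound_diffKernelPiece hα hα0 hδ ha hβ
  refine ⟨C * D, by positivity, fun ℓ hℓ j => (h _ _ _ (hk ℓ hℓ j)).mono (le_of_eq ?_)⟩
  rw [mul_assoc D, ← Real.rpow_add (by positivity), two_pow_rpow, mul_assoc]
  ring_nf

theorem exists_lpNormBound_diffKernelPiece_two (hα : |α| < 1) (hα0 : α ≠ 0)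
    (hδ : -(3 / 2) < δ) (ha : IsC1Amplitude a) (hβ : IsBoundedDyadicPartition β M) :
    ∃ C, 0 < C ∧ ∀ ℓ ∈ Icc (1 : ℕ) 3, ∀ j : ℕ,
      LpNormBound (planeKernel (diffKernelPiece α δ a β ℓ j)) 2 (C * 2 ^ (-(j : ℝ) * δ)) := by
  obtain ⟨C, hC, h⟩ := exists_lpNormBound_diffKernelPiece_of_kernelBound hα hα0 hδ ha hβ (p := 2)
    (C := 2 * 2 ^ (3 / 2 : ℝ)) (e := 0) (by positivity) fun k L A hk =>
      hk.lpNormBound_two.mono <| le_of_eq <| by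
        rw [Real.mul_rpow zero_le_two (zero_le_one.trans hk.one_le), add_zero]; ring
  exact ⟨C, hC, fun ℓ hℓ j => by simpa using h ℓ hℓ j⟩

theorem exists_lpNormBound_diffKernelPiece_top (hα : |α| < 1) (hα0 : α ≠ 0)
    (hδ : -(3 / 2) < δ) (ha : IsC1Amplitude a) (hβ : IsBoundedDyadicPartition β M) :
    ∃ C, 0 < C ∧ ∀ ℓ ∈ Icc (1 : ℕ) 3, ∀ j : ℕ,
      LpNormBound (planeKernel (diffKernelPiece α δ a β ℓ j)) ⊤
        (C * 2 ^ ((j : ℝ) * (criticalIndex ⊤ 2 - δ))) := by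
  have hball : 0 < (volume (Metric.ball (0 : Plane) 1)).toReal :=
    ENNReal.toReal_pos (Metric.measure_ball_pos _ _ one_pos).ne' measure_ball_lt_top.ne
  have hcrit : criticalIndex ⊤ 2 = 1 / 2 := by
    rw [criticalIndex_of_two_le le_top]; norm_num
  refine exists_lpNormBound_diffKernelPiece_of_kernelBound hα hα0 hδ ha hβ
    (mul_pos four_pos hball) fun k L A hk => hk.lpNormBound_top.mono <| le_of_eq ?_
  rw [hcrit, ← Real.rpow_two]
  norm_num

theorem exists_lpNormBound_diffKernelPiece_of_four_lt (hα : |α| < 1) (hα0 : α ≠ 0)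
    (hδ : -(3 / 2) < δ) (ha : IsC1Amplitude a) (hβ : IsBoundedDyadicPartition β M) {p : ℝ≥0∞}
    (hp4 : 4 < p) :
    ∃ C, 0 < C ∧ ∀ ℓ ∈ Icc (1 : ℕ) 3, ∀ j : ℕ,
      LpNormBound (planeKernel (diffKernelPiece α δ a β ℓ j)) p
        (C * 2 ^ ((j : ℝ) * (criticalIndex p 2 - δ))) := by
  by_cases hp : p = ⊤
  · subst hp
    exact exists_lpNormBound_diffKernelPiece_top hα hα0 hδ ha hβ
  have hp2 : 2 ≤ p := (by norm_num : (2 : ℝ≥0∞) ≤ 4).trans hp4.le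
  have hP : 4 < p.toReal := by simpa using (ENNReal.toReal_lt_toReal (by norm_num) hp).mpr hp4
  have hinv : p.toReal⁻¹ < 1 / 4 := by
    rw [one_div]; exact inv_strictAnti₀ four_pos hP
  have hcrit : 1 / 2 - 2 * p.toReal⁻¹ ≤ criticalIndex p 2 := by
    rw [criticalIndex_of_two_le hp2, ENNReal.toReal_inv]; exact le_max_right _ _
  have hσ : 2 < (p.toReal⁻¹ + 1 / 4 + 0) * p.toReal := by
    rw [add_zero, add_mul, inv_mul_cancel₀ (by linarith)]; linarith
  obtain ⟨C, hC, h⟩ := exists_lpNormBound_of_kernelBound hp2 hp (σ := p.toReal⁻¹ + 1 / 4) (η := 0)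
    (e := 3 / 2 + criticalIndex p 2) (by positivity) (by linarith) le_rfl hσ
    (by rw [div_eq_mul_inv]; linarith) (by linarith)
  exact exists_lpNormBound_diffKernelPiece_of_kernelBound hα hα0 hδ ha hβ hC h

theorem exists_lpNormBound_diffKernelPiece_of_two_le (hα : |α| < 1) (hα0 : α ≠ 0)
    (hδ : -(3 / 2) < δ) (ha : IsC1Amplitude a) (hβ : IsBoundedDyadicPartition β M) {p : ℝ≥0∞}
    (hp2 : 2 ≤ p) {ε : ℝ} (hε : 0 < ε) :
    ∃ C, 0 < C ∧ ∀ ℓ ∈ Icc (1 : ℕ) 3, ∀ j : ℕ,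
      LpNormBound (planeKernel (diffKernelPiece α δ a β ℓ j)) p
        (C * 2 ^ ((j : ℝ) * (criticalIndex p 2 - δ)) * 2 ^ ((j : ℝ) * ε)) := by
  by_cases hp : p = ⊤
  · subst hp
    obtain ⟨C, hC, h⟩ := exists_lpNormBound_diffKernelPiece_top hα hα0 hδ ha hβ
    exact ⟨C, hC, fun ℓ hℓ j => (h ℓ hℓ j).mono <| le_mul_of_one_le_right (by positivity) <|
      Real.one_le_rpow one_le_two (by positivity)⟩
  obtain ⟨ν, hν, hνε, hν4⟩ : ∃ ν > 0, 2 * ν ≤ ε ∧ ν ≤ 1 / 4 :=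
    ⟨min (ε / 2) (1 / 4), by positivity, by linarith [min_le_left (ε / 2) (1 / 4)],
      min_le_right _ _⟩
  have hP : 2 ≤ p.toReal := by simpa using ENNReal.toReal_mono hp hp2
  have hcrit : criticalIndex p 2 = max 0 (1 / 2 - 2 * p.toReal⁻¹) := by
    rw [criticalIndex_of_two_le hp2, ENNReal.toReal_inv]
  have hcrit0 : 0 ≤ criticalIndex p 2 := le_max_left _ _
  have hmax : 1 / 2 - 2 * p.toReal⁻¹ + max 0 (2 * p.toReal⁻¹ - 1 / 2) = criticalIndex p 2 := by
    rw [hcrit, ← max_add_add_left]; ring_nf; rw [max_comm]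
  have hσ : 2 < (1 / 2 - ν + (max 0 (2 * p.toReal⁻¹ - 1 / 2) + 2 * ν)) * p.toReal := by
    have : 2 * p.toReal⁻¹ * p.toReal = 2 := by field_simp
    have := le_max_right 0 (2 * p.toReal⁻¹ - 1 / 2)
    nlinarith
  obtain ⟨C, hC, h⟩ := exists_lpNormBound_of_kernelBound hp2 hp (σ := 1 / 2 - ν)
    (e := 3 / 2 + (criticalIndex p 2 + ε)) (by linarith) (by linarith) (by positivity) hσ
    (by rw [div_eq_mul_inv]; linarith) (by linarith)
  obtain ⟨C, hC, h⟩ := exists_lpNormBound_diffKernelPiece_of_kernelBound hα hα0 hδ ha hβ hC h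
  refine ⟨C, hC, fun ℓ hℓ j => ?_⟩
  rw [mul_assoc, ← Real.rpow_add two_pos, ← mul_add, sub_add_eq_add_sub]
  exact h ℓ hℓ j

end

end DiffractiveBR

end

open DiffractiveBR in
theorem proposition3p2_general {α δ M : ℝ} {a : ℝ → ℂ} {β : ℝ → ℝ} (hα : |α| < 1) (hα0 : α ≠ 0)
    (hδ : -(3 / 2) < δ) (ha : IsC1Amplitude a) (hβ : IsBoundedDyadicPartition β M) :
    (∀ ℓ ∈ Icc (1 : ℕ) 3, ∀ r₁ r₂ θ : ℝ, 0 < r₁ → 0 < r₂ →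
      IntegrableOn (diffIntegrand α δ a ℓ r₁ r₂ θ) (Ioi 0)) ∧
    (∃ C : ℝ, 0 < C ∧ ∀ ℓ ∈ Icc (1 : ℕ) 3, ∀ j : ℕ,
      LpNormBound (planeKernel (diffKernelPiece α δ a β ℓ j)) 2 (C * 2 ^ (-(j : ℝ) * δ))) ∧
    (∀ p : ℝ≥0∞, 4 < p → ∃ C : ℝ, 0 < C ∧ ∀ ℓ ∈ Icc (1 : ℕ) 3, ∀ j : ℕ,
      LpNormBound (planeKernel (diffKernelPiece α δ a β ℓ j)) p
        (C * 2 ^ ((j : ℝ) * (criticalIndex p 2 - δ)))) ∧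
    (∀ p : ℝ≥0∞, 2 ≤ p → ∀ ε : ℝ, 0 < ε → ∃ C : ℝ, 0 < C ∧ ∀ ℓ ∈ Icc (1 : ℕ) 3, ∀ j : ℕ,
      LpNormBound (planeKernel (diffKernelPiece α δ a β ℓ j)) p
        (C * 2 ^ ((j : ℝ) * (criticalIndex p 2 - δ)) * 2 ^ ((j : ℝ) * ε))) := by
  refine ⟨fun ℓ hℓ r₁ r₂ θ h₁ h₂ => ?_,
    exists_lpNormBound_diffKernelPiece_two hα hα0 hδ ha hβ,
    fun p hp => exists_lpNormBound_diffKernelPiece_of_four_lt hα hα0 hδ ha hβ hp,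
    fun p hp ε hε => exists_lpNormBound_diffKernelPiece_of_two_le hα hα0 hδ ha hβ hp hε⟩
  obtain ⟨C, hB⟩ := ha.exists_symbolBound hδ
  simp only [funext (diffIntegrand_eq α δ a ℓ r₁ r₂ θ)]
  exact hB.integrableOn_oscFactor_mul (by linarith) h₁ h₂ (integrableOn_diffWeight hα hα0 θ hℓ)

theorem proposition3p2 (α δ : ℝ) (a : ℝ → ℂ) (β : ℝ → ℝ)
    (hα : |α| < 1) (hα0 : α ≠ 0) (hδ : 0 ≤ δ)
    (ha : DiffractiveBR.IsAmplitude a) (hβ : DiffractiveBR.IsDyadicPartition β) :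
    -- the integrals defining the kernels converge absolutely
    (∀ ℓ ∈ Set.Icc (1 : ℕ) 3, ∀ r₁ r₂ θ : ℝ, 0 < r₁ → 0 < r₂ →
      MeasureTheory.IntegrableOn (DiffractiveBR.diffIntegrand α δ a ℓ r₁ r₂ θ) (Set.Ioi 0)) ∧
    -- the bound on L²
    (∃ C : ℝ, 0 < C ∧ ∀ ℓ ∈ Set.Icc (1 : ℕ) 3, ∀ j : ℕ,
      DiffractiveBR.LpNormBound
        (DiffractiveBR.planeKernel (DiffractiveBR.diffKernelPiece α δ a β ℓ j)) 2
        (C * (2 : ℝ) ^ (-(j : ℝ) * δ))) ∧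
    -- the bound on Lᵖ, 6 ≤ p ≤ ∞
    (∀ p : ENNReal, 6 ≤ p → ∃ C : ℝ, 0 < C ∧ ∀ ℓ ∈ Set.Icc (1 : ℕ) 3, ∀ j : ℕ,
      DiffractiveBR.LpNormBound
        (DiffractiveBR.planeKernel (DiffractiveBR.diffKernelPiece α δ a β ℓ j)) p
        (C * (2 : ℝ) ^ ((j : ℝ) * (DiffractiveBR.criticalIndex p 2 - δ)))) ∧
    -- the bound on Lᵖ, 4 ≤ p < 6, with an arbitrarily small loss
    (∀ p : ENNReal, 4 ≤ p → p < 6 → ∀ ε : ℝ, 0 < ε →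
      ∃ C : ℝ, 0 < C ∧ ∀ ℓ ∈ Set.Icc (1 : ℕ) 3, ∀ j : ℕ,
      DiffractiveBR.LpNormBound
        (DiffractiveBR.planeKernel (DiffractiveBR.diffKernelPiece α δ a β ℓ j)) p
        (C * (2 : ℝ) ^ ((j : ℝ) * (DiffractiveBR.criticalIndex p 2 - δ))
          * (2 : ℝ) ^ ((j : ℝ) * ε))) := by
  obtain ⟨M, hβ'⟩ := hβ.exists_isBoundedDyadicPartition
  obtain ⟨hint, h2, hp, hpε⟩ := proposition3p2_general hα hα0
    (by linarith : -(3 / 2) < δ) ha.isC1Amplitude hβ'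
  exact ⟨hint, h2, fun p h6 => hp p (lt_of_lt_of_le (by norm_num) h6),
    fun p h4 _ => hpε p (le_trans (by norm_num) h4)⟩
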